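/- **Setting.** Let $\Gamma$ be a finite set of colours with an involution $x\mapsto x^{-1}$: a symmetric binary relation is a colour with $x^{-1}=x$, and an asymmetric one gives a pair of mutually converse colours $R^+,R^-$. Structures are taken in the relational language with one binary symbol per colour. A structure $A$ is *complete* if its relations are irreflexive, any ordered pair $(a,b)$ of distinct elements satisfies exactly one colour $\mathbf r(a,b)$, and $\mathbf r(b,a)=\mathbf r(a,b)^{-1}$. A *triangle* is a complete structure on three points. For a set $S$ of triangles, $\mathrm{Forb}_c(S)$ is the class of all finite complete structures that embed no triangle from $S$. A class $\mathcal C$ of finite structures is an *amalgamation class* if it is nonempty, contains only countably many structures up to isomorphism, is closed under isomorphism and substructures, and has the joint embedding and amalgamation properties. It is a *semi-free amalgamation class with set of solutions* $L'\subsetneq\Gamma$ if moreover for all $A,B,C\in\mathcal C$ and embeddings $f_1:B\to A$, $f_2:B\to C$ there are $D\in\mathcal C$ and embeddings $g_1:A\to D$, $g_2:C\to D$ with $g_1f_1=g_2f_2$, $g_1(A)\cap g_2(C)=g_1f_1(B)$, and $\mathbf r(g_1a,g_2c)\in L'$ for all $a\in A\setminus f_1(B)$, $c\in C\setminus f_2(B)$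 (for $\mathcal C=\mathrm{Forb}_c(S)$). Order $L'$ as $R_1>\dots>R_m$. For $B\subseteq A,C$ in $\mathrm{Forb}_c(S)$, the amalgam $A\otimes_BC$ is the complete structure on the disjoint union of $A$ and $C$ over $B$ in which, for $a\in A\setminus B$ and $c\in C\setminus B$, $\mathbf r(a,c)=R_i$ with $i$ least such that for no $b\in B$ is the triangle $abc$ with colours $\mathbf r(a,b)$, $\mathbf r(a,c)=R_i$, $\mathbf r(b,c)$ isomorphic to a member of $S$. The class $\mathrm{Forb}_c(S)$ is a *prioritised semi-free amalgamation class* (with respect to this order) if it is an amalgamation class and, for all such $A,B,C$, the amalgam $A\otimes_BC$ exists and lies in $\mathrm{Forb}_c(S)$. Let $M$ be a structure, $G=\mathrm{Aut}(M)$; two $n$-tuples have the same type over a finite $B\subseteq M$ if they lie in the same orbit of the pointwise stabiliser $G_{(B)}$, and an $n$-type over $B$ is such an orbit. Write $AB$ for $A\cup B$, identify a tuple with the set of its entries, and let $[g,h]=g^{-1}h^{-1}gh$. A *stationary weak independence relation* on $M$ is a ternary relation $A\perp_BC$ on finite subsets of $M$ such that for all finite $A,B,C,D\subseteq M$ and $g\in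 G$: * (invariance) $A\perp_BC\Rightarrow gA\perp_{gB}gC$; * (monotonicity) $A\perp_BCD\Rightarrow A\perp_BC$ and $A\perp_{BC}D$; $AD\perp_BC\Rightarrow A\perp_BC$ and $D\perp_{AB}C$; * (transitivity) $A\perp_BC$, $A\perp_{BC}D\Rightarrow A\perp_BD$; $A\perp_BC$, $D\perp_{AB}C\Rightarrow D\perp_BC$; * (existence) every $n$-type over $B$ has a realisation $a$ with $a\perp_BC$, and one with $C\perp_Ba$; * (stationarity) if $a,a'$ are $n$-tuples with the same type over $B$, and either $a\perp_BC$, $a'\perp_BC$, or $C\perp_Ba$, $C\perp_Ba'$, then $a,a'$ have the same type over $BC$. An automorphism $g$ *moves almost $R$-maximally* (resp. *almost $L$-maximally*) if for every finite $X\subseteq M$ every $n$-type over $X$ has a realisation $a$ with $a\perp_Xg(a)$ (resp. $g(a)\perp_Xa$). **Theorem.** Let $S$ be a set of triangles such that $\mathrm{Forb}_c(S)$ is a semi-free amalgamation class with set of solutions $L'\subsetneq\Gamma$, where $L'$ is ordered in any way as $R_1>\dots>R_m$. Assume that no triangle in $S$ has two edges coloured from $L'$, where an edge $\{u,v\}$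 is coloured from $L'$ if $\mathbf r(u,v)\in L'$ or $\mathbf r(v,u)\in L'$. Then: 1. $\mathrm{Forb}_c(S)$ is a prioritised semi-free amalgamation class with respect to the given order on $L'$; in particular it has a (countable, homogeneous) Fraïssé limit $M_S$. 2. There is a stationary weak independence relation on $M_S$ such that for every non-trivial $g\in\mathrm{Aut}(M_S)$ there are $h,k\in\mathrm{Aut}(M_S)$ for which $[[h,g],k]$ moves both almost $R$-maximally and almost $L$-maximally. 3. $\mathrm{Aut}(M_S)$ is a simple group. -/

import Mathlib

open scoped FirstOrder

universe u w

namespace ForbTriangles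

/-- Relation symbols of the language: one binary symbol for every (oriented) colour. -/
inductive ColourRel (Γ : Type u) : ℕ → Type u
  | edge : Γ → ColourRel Γ 2

/-- The relational language whose symbols are the binary relations in `Γ`. -/
def colourLang (Γ : Type u) : FirstOrder.Language.{0, u} := ⟨fun _ => Empty, ColourRel Γ⟩

instance (Γ : Type u) : (colourLang Γ).IsRelational :=
  fun _ => (inferInstance : IsEmpty Empty)

/-- The automorphisms of a structure form a group under composition. -/
instance autGroup (L : FirstOrder.Language.{0, u}) (M : Type w) [L.Structure M] : Group (M ≃[L] M) where
  mul f g := f.comp g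
  one := FirstOrder.Language.Equiv.refl L M
  inv f := f.symm
  mul_assoc _ _ _ := rfl
  one_mul _ := rfl
  mul_one _ := rfl
  inv_mul_cancel f := f.symm_comp_self

section Structures

variable {Γ : Type u}

/-- The pair `(a, b)` satisfies the relation `x`. -/
def HasColour {A : Type w} [(colourLang Γ).Structure A] (x : Γ) (a b : A) : Prop :=
  FirstOrder.Language.Structure.RelMap (L := colourLang Γ) (M := A) (ColourRel.edge x : (colourLang Γ).Relations 2)
    ![a, b]

/-- Complete structures. The map `inv` sends every colour to its converse: a symmetric relation
is its own converse, and an asymmetric relation gives two colours `R⁺`, `R⁻` that are converses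
of each other. -/
structure IsCompleteStructure (inv : Γ → Γ) (A : Type w) [(colourLang Γ).Structure A] : Prop where
  irrefl : ∀ (x : Γ) (a : A), ¬ HasColour x a a
  existsUnique : ∀ a b : A, a ≠ b → ∃! x : Γ, HasColour x a b
  converse : ∀ (x : Γ) (a b : A), HasColour x a b → HasColour (inv x) b a

/-- A triangle is a complete structure on three points. -/
def IsTriangle (inv : Γ → Γ) (T : CategoryTheory.Bundled.{0} (colourLang Γ).Structure) : Prop :=
  IsCompleteStructure inv T ∧ Nat.card T = 3

/-- The class of all finite complete structures that embed no triangle from `S`. -/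
def Forb (inv : Γ → Γ) (S : Set (CategoryTheory.Bundled.{0} (colourLang Γ).Structure)) :
    Set (CategoryTheory.Bundled.{w} (colourLang Γ).Structure) :=
  {A | Finite A ∧ IsCompleteStructure inv A ∧ ∀ T ∈ S, IsEmpty (T ↪[colourLang Γ] A)}

/-- `g₁ : A → D` and `g₂ : C → D` amalgamate `f₁ : B → A` and `f₂ : B → C`, and the images of
`A` and `C` meet exactly in the image of `B`. -/
def IsStrongAmalgam {A B C D : CategoryTheory.Bundled.{w} (colourLang Γ).Structure}
    (f₁ : B ↪[colourLang Γ] A) (f₂ : B ↪[colourLang Γ] C)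
    (g₁ : A ↪[colourLang Γ] D) (g₂ : C ↪[colourLang Γ] D) : Prop :=
  (∀ b, g₁ (f₁ b) = g₂ (f₂ b)) ∧ Set.range g₁ ∩ Set.range g₂ = Set.range fun b => g₁ (f₁ b)

/-- `K` is a semi-free amalgamation class with the proper subset `L'` of the colours as its set
of solutions. -/
def IsSemiFree (K : Set (CategoryTheory.Bundled.{w} (colourLang Γ).Structure)) (L' : Set Γ) : Prop :=
  FirstOrder.Language.IsFraisse K ∧ L' ⊂ Set.univ ∧
    ∀ A ∈ K, ∀ B ∈ K, ∀ C ∈ K, ∀ (f₁ : B ↪[colourLang Γ] A) (f₂ : B ↪[colourLang Γ] C),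
      ∃ D ∈ K, ∃ (g₁ : A ↪[colourLang Γ] D) (g₂ : C ↪[colourLang Γ] D),
        IsStrongAmalgam f₁ f₂ g₁ g₂ ∧
        ∀ a ∉ Set.range f₁, ∀ c ∉ Set.range f₂, ∀ x : Γ, HasColour x (g₁ a) (g₂ c) → x ∈ L'

/-- The triangle `pqr` whose edges `(p, q)`, `(p, r)`, `(q, r)` are coloured `x`, `y`, `z`
is (isomorphic to) a member of `S`. -/
def IsForbidden (S : Set (CategoryTheory.Bundled.{0} (colourLang Γ).Structure)) (x y z : Γ) : Prop :=
  ∃ T ∈ S, ∃ p q r : T, HasColour x p q ∧ HasColour y p r ∧ HasColour z q r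

/-- For some `b` in `B`, colouring `(a, c)` by `y` makes `abc` a forbidden triangle. -/
def Blocks (S : Set (CategoryTheory.Bundled.{0} (colourLang Γ).Structure))
    {A B C : CategoryTheory.Bundled.{w} (colourLang Γ).Structure}
    (f₁ : B ↪[colourLang Γ] A) (f₂ : B ↪[colourLang Γ] C) (a : A) (c : C) (y : Γ) : Prop :=
  ∃ (b : B) (x z : Γ), HasColour x a (f₁ b) ∧ HasColour z (f₂ b) c ∧ IsForbidden S x y z

/-- `D` is the prioritised amalgam of `A` and `C` over `B`: the underlying set is the union of
`A` and `C` over `B`, and a new pair `(a, c)` gets the first colour in the list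
`ℓ = [R₁, …, Rₘ]` that creates no forbidden triangle `abc` with `b` in `B`. -/
def IsPrioritisedAmalgam (S : Set (CategoryTheory.Bundled.{0} (colourLang Γ).Structure)) (ℓ : List Γ)
    {A B C D : CategoryTheory.Bundled.{w} (colourLang Γ).Structure}
    (f₁ : B ↪[colourLang Γ] A) (f₂ : B ↪[colourLang Γ] C)
    (g₁ : A ↪[colourLang Γ] D) (g₂ : C ↪[colourLang Γ] D) : Prop :=
  IsStrongAmalgam f₁ f₂ g₁ g₂ ∧ Set.range g₁ ∪ Set.range g₂ = Set.univ ∧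
    ∀ a ∉ Set.range f₁, ∀ c ∉ Set.range f₂, ∃ i : Fin ℓ.length,
      HasColour (ℓ.get i) (g₁ a) (g₂ c) ∧ ¬ Blocks S f₁ f₂ a c (ℓ.get i) ∧
        ∀ j < i, Blocks S f₁ f₂ a c (ℓ.get j)

/-- `Forb inv S` is a prioritised semi-free amalgamation class with respect to the solution set
`L' = {R₁ > ⋯ > Rₘ}` enumerated by the list `ℓ`. -/
def IsPrioritisedSemiFree (inv : Γ → Γ) (S : Set (CategoryTheory.Bundled.{0} (colourLang Γ).Structure))
    (ℓ : List Γ) : Prop :=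
  FirstOrder.Language.IsFraisse (Forb.{u, w} inv S) ∧ ℓ.Nodup ∧ {x | x ∈ ℓ} ⊂ Set.univ ∧
    ∀ A ∈ Forb.{u, w} inv S, ∀ B ∈ Forb.{u, w} inv S, ∀ C ∈ Forb.{u, w} inv S,
      ∀ (f₁ : B ↪[colourLang Γ] A) (f₂ : B ↪[colourLang Γ] C),
        ∃ D ∈ Forb.{u, w} inv S, ∃ (g₁ : A ↪[colourLang Γ] D) (g₂ : C ↪[colourLang Γ] D),
          IsPrioritisedAmalgam S ℓ f₁ f₂ g₁ g₂

/-- The edge between `p` and `q` is coloured from `L'` (in at least one of its directions). -/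
def IsSolutionEdge (L' : Set Γ) {A : Type w} [(colourLang Γ).Structure A] (p q : A) : Prop :=
  ∃ x ∈ L', HasColour x p q ∨ HasColour x q p

/-- No triangle in `S` has two edges coloured from `L'`. -/
def NoTwoSolutionEdges (S : Set (CategoryTheory.Bundled.{0} (colourLang Γ).Structure)) (L' : Set Γ) : Prop :=
  ∀ T ∈ S, ∀ p q r : T, q ≠ r → ¬ (IsSolutionEdge L' p q ∧ IsSolutionEdge L' p r)

end Structures

section Independence

variable {L : FirstOrder.Language.{0, u}} {M : Type w} [L.Structure M]

/-- The tuples `a` and `a'` have the same type over `B`: they lie in the same orbit of the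
pointwise stabiliser of `B` in the automorphism group. -/
def SameType (L : FirstOrder.Language.{0, u}) {M : Type w} [L.Structure M] (B : Finset M) {n : ℕ}
    (a a' : Fin n → M) : Prop :=
  ∃ σ : M ≃[L] M, (∀ b ∈ B, σ b = b) ∧ ∀ i, σ (a i) = a' i

open Classical in
/-- The finite set of entries of a tuple. -/
noncomputable def entries {n : ℕ} (a : Fin n → M) : Finset M := Finset.univ.image a

open Classical in
/-- Stationary weak independence relations; `ind A B C` is read as
"`A` is independent from `C` over `B`". As the language is relational, finite substructures
are finite subsets. -/
structure IsStationaryWeakIndependence (L : FirstOrder.Language.{0, u}) (M : Type w) [L.Structure M]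
    (ind : Finset M → Finset M → Finset M → Prop) : Prop where
  invariance : ∀ (g : M ≃[L] M) (A B C : Finset M),
    ind A B C → ind (A.image g) (B.image g) (C.image g)
  monotonicity_right : ∀ A B C D : Finset M, ind A B (C ∪ D) → ind A B C ∧ ind A (B ∪ C) D
  monotonicity_left : ∀ A B C D : Finset M, ind (A ∪ D) B C → ind A B C ∧ ind D (A ∪ B) C
  transitivity_right : ∀ A B C D : Finset M, ind A B C → ind A (B ∪ C) D → ind A B D
  transitivity_left : ∀ A B C D : Finset M, ind A B C → ind D (A ∪ B) C → ind D B C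
  existence_left : ∀ (B C : Finset M) (n : ℕ) (p : Fin n → M),
    ∃ a, SameType L B p a ∧ ind (entries a) B C
  existence_right : ∀ (B C : Finset M) (n : ℕ) (p : Fin n → M),
    ∃ a, SameType L B p a ∧ ind C B (entries a)
  stationarity_left : ∀ (B C : Finset M) (n : ℕ) (a a' : Fin n → M), SameType L B a a' →
    ind (entries a) B C → ind (entries a') B C → SameType L (B ∪ C) a a'
  stationarity_right : ∀ (B C : Finset M) (n : ℕ) (a a' : Fin n → M), SameType L B a a' →
    ind C B (entries a) → ind C B (entries a') → SameType L (B ∪ C) a a'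

/-- `g` moves almost `R`-maximally: every type over a finite set `X` has a realisation `a` that
is independent from `g a` over `X`. -/
def MovesAlmostRMax (ind : Finset M → Finset M → Finset M → Prop) (g : M ≃[L] M) : Prop :=
  ∀ (X : Finset M) (n : ℕ) (p : Fin n → M),
    ∃ a, SameType L X p a ∧ ind (entries a) X (entries fun i => g (a i))

/-- `g` moves almost `L`-maximally: every type over a finite set `X` has a realisation `a` such
that `g a` is independent from `a` over `X`. -/
def MovesAlmostLMax (ind : Finset M → Finset M → Finset M → Prop) (g : M ≃[L] M) : Prop :=
  ∀ (X : Finset M) (n : ℕ) (p : Fin n → M),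
    ∃ a, SameType L X p a ∧ ind (entries fun i => g (a i)) X (entries a)

end Independence

/-- The commutator convention `[g, h] = g⁻¹ h⁻¹ g h`. -/
def commutator {G : Type w} [Group G] (g h : G) : G := g⁻¹ * h⁻¹ * g * h

end ForbTriangles

/-!
Complete structures are treated as edge colourings, and the members of `S` as forbidden triples of
colours; call an edge *solved* if it is coloured from the list `ℓ` in one of its directions. The
whole proof rests on one observation: as no forbidden triangle has two solved edges, joining
points by solved edges is almost unobstructed. A new edge coloured by a solution can only be in
conflict with triangles whose other two edges are not solved.

**Prioritised amalgams.** In a semi-free amalgam over `B` the pair `(a, c)` has a colour of `ℓ`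
that is not blocked by `B`, so there is a first such colour. Recolouring all new pairs in this way
creates no forbidden triangle: one with a single new edge has its third vertex in `B` and is
excluded by the choice of the colour, and one with several new edges has two solved edges
(`isGood_recolour`).

**The Fraïssé limit.** It is built on `ℕ` by adding points that realise consistent one-point
extensions (`exists_saturated_colouring`). A consistent extension over a finite set extends to any
finite superset, because two one-point extensions always amalgamate (`exists_solution`). All that
is used of the limit afterwards is recorded in `IsGeneric`: homogeneity and the extension
property, in terms of colours.

**Independence.** `A` is independent from `C` over `B` if `A ∪ B ∪ C` is the prioritised amalgam
of `A ∪ B` and `C ∪ B` over `B` (`IndCol` with `prio`). Monotonicity and transitivity hold because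
points of the base joined to `a` or `c` by a solved edge do not influence the choice of the colour
(`IsChooser.base_eq`). The relation is not symmetric; exchanging its sides replaces the choice
`prio` by `flipCol inv prio`, and the arguments are carried out for an arbitrary choice function
with the properties collected in `IsChooser`, so that they apply to both sides.

**Commutators.** A non-trivial automorphism `g` moves some realisation of every one-point type:
move along edges whose colour is not a solution, and note that a fixed point cannot be joined to
`w` and `g w` by different colours (`IsGeneric.exists_moved_point`). A generic `h` then makes
`v = [h, g]` move realisations of all types along solved edges
(`IsGeneric.exists_commutator_movesSol`), and a generic `k` makes `[v, k]` move almost maximally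
on both sides (`IsGeneric.exists_commutator_max`). The generic elements are obtained by meeting
countably many dense requirements (`exists_aut_of_dense`).

**Simplicity.** Let `g` move almost maximally on both sides. The word map that sends four
automorphisms to the product of the corresponding conjugates of `g`, `g⁻¹`, `g`, `g⁻¹` has
somewhere dense image near every tuple (`IsStationaryWeakIndependence.exists_isDenseNear`): the
outer conjugates bring source and target into independent position, and the inner ones connect
them through an independent realisation, by stationarity. A back-and-forth construction of two
tuples makes two such words meet exactly (`exists_conjWord_eq_mul`). Hence the normal closure of
`g` contains the pointwise stabiliser of a finite set, and stationarity over the empty set shows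
that it is the whole group (`IsStationaryWeakIndependence.normal_eq_top`).
-/

namespace ForbTriangles

/-! ### Automorphisms and limits of finite approximations -/

section Automorphisms

variable {L : FirstOrder.Language.{0, u}} {M : Type w} [L.Structure M]

@[simp] theorem aut_mul_apply (f g : M ≃[L] M) (x : M) : (f * g) x = f (g x) := rfl

@[simp] theorem aut_one_apply (x : M) : (1 : M ≃[L] M) x = x := rfl

@[simp] theorem aut_inv_apply_self (f : M ≃[L] M) (x : M) : f⁻¹ (f x) = x :=
  f.symm_apply_apply x

@[simp] theorem aut_apply_inv_self (f : M ≃[L] M) (x : M) : f (f⁻¹ x) = x :=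
  f.apply_symm_apply x

theorem aut_ext {f g : M ≃[L] M} (h : ∀ x, f x = g x) : f = g := FirstOrder.Language.Equiv.ext h

theorem aut_inj (f : M ≃[L] M) {x y : M} : f x = f y ↔ x = y := f.injective.eq_iff

theorem aut_inv_eq_iff {f : M ≃[L] M} {x y : M} : f⁻¹ x = y ↔ x = f y :=
  ⟨fun h => by rw [← h, aut_apply_inv_self], fun h => by rw [h, aut_inv_apply_self]⟩

theorem aut_inv_eq_self {f : M ≃[L] M} {x : M} (h : f x = x) : f⁻¹ x = x :=
  aut_inv_eq_iff.2 h.symm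

/-- A sequence of automorphisms that agree on larger and larger finite sets, exhausting the
structure both as domains and as ranges, converges to an automorphism. -/
theorem exists_limit (k : ℕ → M ≃[L] M) (D : ℕ → Finset M) (hD : Monotone D)
    (hk : ∀ n, ∀ x ∈ D n, k (n + 1) x = k n x) (hdom : ∀ m, ∃ n, m ∈ D n)
    (hran : ∀ m, ∃ n, ∃ x ∈ D n, k n x = m) :
    ∃ k' : M ≃[L] M, ∀ n, ∀ x ∈ D n, k' x = k n x := by
  have hk' : ∀ n n', n ≤ n' → ∀ x ∈ D n, k n' x = k n x := by
    intro n n' h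
    induction n', h using Nat.le_induction with
    | base => intros; rfl
    | succ n' h ih => intro x hx; rw [hk n' x (hD h hx), ih x hx]
  choose N hN using hdom
  let f : M → M := fun x => k (N x) x
  have hf : ∀ n, ∀ x ∈ D n, f x = k n x := by
    intro n x hx
    rcases le_total n (N x) with h | h
    · exact hk' _ _ h x hx
    · exact (hk' _ _ h x (hN x)).symm
  have hfin : ∀ {m : ℕ} (v : Fin m → M), ∃ n, ∀ i, v i ∈ D n := by
    intro m v
    obtain ⟨n, hn⟩ := Finset.exists_le (Finset.univ.image fun i => N (v i))
    exact ⟨n, fun i => hD (hn _ (Finset.mem_image_of_mem _ (Finset.mem_univ i))) (hN _)⟩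
  have hbij : Function.Bijective f := by
    constructor
    · intro x y hxy
      obtain ⟨n, hn⟩ := hfin ![x, y]
      have hx : x ∈ D n := hn 0
      have hy : y ∈ D n := hn 1
      rw [hf n x hx, hf n y hy] at hxy
      exact (k n).injective hxy
    · intro m
      obtain ⟨n, x, hx, rfl⟩ := hran m
      exact ⟨x, hf n x hx⟩
  refine ⟨⟨Equiv.ofBijective f hbij, ?_, ?_⟩, fun n x hx => hf n x hx⟩
  · intro m F v
    obtain ⟨n, hn⟩ := hfin (Fin.cons (FirstOrder.Language.Structure.funMap F v) v : Fin (m + 1) → M)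
    have h0 : f (FirstOrder.Language.Structure.funMap F v) = _ := hf n _ (hn 0)
    have h1 : f ∘ v = k n ∘ v := funext fun i => hf n _ (hn i.succ)
    change f _ = FirstOrder.Language.Structure.funMap F (f ∘ v)
    rw [h0, h1]
    exact (k n).map_fun F v
  · intro m R v
    obtain ⟨n, hn⟩ := hfin v
    have h1 : f ∘ v = k n ∘ v := funext fun i => hf n _ (hn i)
    change FirstOrder.Language.Structure.RelMap R (f ∘ v) ↔ _
    rw [h1]
    exact (k n).map_rel R v

/-- Dependent choice for sequences of states satisfying an invariant `P`. -/
theorem exists_seq {σ : Type*} (P : σ → Prop) (R : ℕ → σ → σ → Prop)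
    (step : ∀ n s, P s → ∃ s', P s' ∧ R n s s') {s₀ : σ} (h₀ : P s₀) :
    ∃ f : ℕ → σ, f 0 = s₀ ∧ ∀ n, P (f n) ∧ R n (f n) (f (n + 1)) := by
  choose! next hP hR using step
  let f : ℕ → σ := fun n => Nat.rec s₀ next n
  have hf : ∀ n, P (f n) := by
    intro n
    induction n with
    | zero => exact h₀
    | succ n ih => exact hP n _ ih
  exact ⟨f, rfl, fun n => ⟨hf n, hR n _ (hf n)⟩⟩

/-- An automorphism can be built that meets countably many requirements, provided that each of
them can be secured by a finite part of an automorphism, whatever finite part has been fixed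
before. -/
theorem exists_aut_of_dense [Countable M] {ι : Type*} [Countable ι] (Req : ι → (M ≃[L] M) → Prop)
    (dense : ∀ i (k : M ≃[L] M) (D : Finset M), ∃ k₁ : M ≃[L] M, (∀ x ∈ D, k₁ x = k x) ∧
      ∃ D₁ : Finset M, ∀ k₂ : M ≃[L] M, (∀ x ∈ D₁, k₂ x = k₁ x) → Req i k₂) :
    ∃ k, ∀ i, Req i k := by
  classical
  rcases isEmpty_or_nonempty ι with hι | hι
  · exact ⟨1, fun i => isEmptyElim i⟩
  obtain ⟨e, he⟩ := exists_surjective_nat ι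
  obtain ⟨d, hd⟩ := exists_injective_nat M
  let Q : ℕ → Finset M := fun n =>
    ((Set.finite_Iic n).preimage (f := d) hd.injOn).toFinset
  have hQ : ∀ x, x ∈ Q (d x) := fun x => by simp [Q]
  have hQm : Monotone Q := fun a b hab x hx => by
    simp only [Q, Set.Finite.mem_toFinset, Set.mem_preimage, Set.mem_Iic] at hx ⊢
    exact hx.trans hab
  obtain ⟨f, -, hf⟩ := exists_seq (σ := (M ≃[L] M) × Finset M) (fun _ => True)
    (fun n s s' => (∀ x ∈ s.2, s'.1 x = s.1 x) ∧ s.2 ⊆ s'.2 ∧ Q n ⊆ s'.2 ∧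
      (Q n).image (s'.1⁻¹ : M ≃[L] M) ⊆ s'.2 ∧
      ∀ k₂ : M ≃[L] M, (∀ x ∈ s'.2, k₂ x = s'.1 x) → Req (e n) k₂) (by
    rintro n ⟨k, D⟩ -
    obtain ⟨k₁, hk₁, D₁, hD₁⟩ := dense (e n) k D
    refine ⟨⟨k₁, D ∪ (D₁ ∪ (Q n ∪ (Q n).image (k₁⁻¹ : M ≃[L] M)))⟩, trivial, hk₁, ?_, ?_, ?_, ?_⟩
    · exact Finset.subset_union_left
    · intro x hx; simp [hx]
    · intro x hx; simp only [Finset.mem_union]; tauto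
    · intro k₂ hk₂
      exact hD₁ k₂ fun x hx => hk₂ x (by simp [hx])) (s₀ := (1, ∅)) trivial
  obtain ⟨k, hk⟩ := exists_limit (fun n => (f n).1) (fun n => (f n).2)
    (monotone_nat_of_le_succ fun n => (hf n).2.2.1) (fun n x hx => (hf n).2.1 x hx)
    (fun m => ⟨d m + 1, (hf (d m)).2.2.2.1 (hQ m)⟩)
    (fun m => ⟨d m + 1, (f (d m + 1)).1⁻¹ m,
      (hf (d m)).2.2.2.2.1 (Finset.mem_image_of_mem _ (hQ m)), by simp⟩)
  refine ⟨k, fun i => ?_⟩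
  obtain ⟨n, rfl⟩ := he i
  exact (hf n).2.2.2.2.2 k (hk (n + 1))

end Automorphisms

/-! ### Stationary weak independence of finite sets -/

section Simplicity

open Classical

variable {L : FirstOrder.Language.{0, u}} {M : Type w} [L.Structure M]
  {ind : Finset M → Finset M → Finset M → Prop}

theorem mem_entries {n : ℕ} {a : Fin n → M} {x : M} : x ∈ entries a ↔ ∃ i, a i = x := by
  simp [entries]

theorem entries_comp {n : ℕ} (a : Fin n → M) (σ : M → M) :
    entries (fun i => σ (a i)) = (entries a).image σ := by
  ext x; simp [mem_entries]

theorem exists_entries_eq (A : Finset M) : ∃ (n : ℕ) (a : Fin n → M), entries a = A := by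
  refine ⟨A.card, fun i => (A.equivFin.symm i : M), ?_⟩
  ext x
  rw [mem_entries]
  constructor
  · rintro ⟨i, rfl⟩; exact (A.equivFin.symm i).2
  · intro hx; exact ⟨A.equivFin ⟨x, hx⟩, by simp⟩

theorem image_eq_self {σ : M ≃[L] M} {B : Finset M} (h : ∀ b ∈ B, σ b = b) : B.image σ = B := by
  ext x
  rw [Finset.mem_image]
  constructor
  · rintro ⟨b, hb, rfl⟩; rwa [h b hb]
  · intro hx; exact ⟨x, hx, h x hx⟩

theorem image_mul (σ τ : M ≃[L] M) (B : Finset M) : B.image (σ * τ) = (B.image τ).image σ := by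
  rw [Finset.image_image]; rfl

theorem image_image_inv (σ : M ≃[L] M) (B : Finset M) : (B.image (σ⁻¹ : M ≃[L] M)).image σ = B := by
  ext x; simp

theorem image_inv_image (σ : M ≃[L] M) (B : Finset M) : (B.image σ).image (σ⁻¹ : M ≃[L] M) = B := by
  ext x; simp

theorem mem_image_inv {σ : M ≃[L] M} {B : Finset M} {x : M} :
    x ∈ B.image (σ⁻¹ : M ≃[L] M) ↔ σ x ∈ B := by
  rw [Finset.mem_image]
  constructor
  · rintro ⟨b, hb, rfl⟩; simpa
  · intro h; exact ⟨σ x, h, by simp⟩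

theorem mem_image_aut {σ : M ≃[L] M} {B : Finset M} {x : M} :
    x ∈ B.image σ ↔ σ⁻¹ x ∈ B := by
  rw [Finset.mem_image]
  constructor
  · rintro ⟨b, hb, rfl⟩; simpa
  · intro h; exact ⟨σ⁻¹ x, h, by simp⟩

namespace IsStationaryWeakIndependence

variable (hi : IsStationaryWeakIndependence L M ind)
include hi

theorem exists_left (A B C : Finset M) :
    ∃ σ : M ≃[L] M, (∀ b ∈ B, σ b = b) ∧ ind (A.image σ) B C := by
  obtain ⟨n, p, rfl⟩ := exists_entries_eq A
  obtain ⟨a, ⟨σ, hσ, ha⟩, h⟩ := hi.existence_left B C n p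
  refine ⟨σ, hσ, ?_⟩
  rwa [← entries_comp, show (fun i => σ (p i)) = a from funext ha]

theorem stationary_left {A B C : Finset M} {σ : M ≃[L] M} (hσ : ∀ b ∈ B, σ b = b)
    (h₁ : ind A B C) (h₂ : ind (A.image σ) B C) :
    ∃ τ : M ≃[L] M, (∀ b ∈ B ∪ C, τ b = b) ∧ ∀ a ∈ A, τ a = σ a := by
  obtain ⟨n, p, rfl⟩ := exists_entries_eq A
  obtain ⟨τ, hτ, h⟩ := hi.stationarity_left B C n p (fun i => σ (p i)) ⟨σ, hσ, fun _ => rfl⟩ h₁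
    (by rwa [entries_comp])
  refine ⟨τ, hτ, fun a ha => ?_⟩
  obtain ⟨i, rfl⟩ := mem_entries.1 ha
  exact h i

theorem stationary_right {A B C : Finset M} {σ : M ≃[L] M} (hσ : ∀ b ∈ B, σ b = b)
    (h₁ : ind C B A) (h₂ : ind C B (A.image σ)) :
    ∃ τ : M ≃[L] M, (∀ b ∈ B ∪ C, τ b = b) ∧ ∀ a ∈ A, τ a = σ a := by
  obtain ⟨n, p, rfl⟩ := exists_entries_eq A
  obtain ⟨τ, hτ, h⟩ := hi.stationarity_right B C n p (fun i => σ (p i)) ⟨σ, hσ, fun _ => rfl⟩ h₁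
    (by rwa [entries_comp])
  refine ⟨τ, hτ, fun a ha => ?_⟩
  obtain ⟨i, rfl⟩ := mem_entries.1 ha
  exact h i

theorem invariant (g : M ≃[L] M) {A B C A' B' C' : Finset M} (h : ind A B C)
    (hA : A.image g = A') (hB : B.image g = B') (hC : C.image g = C') : ind A' B' C' := by
  subst hA hB hC
  convert hi.invariance g A B C h

theorem mono_right {A B C C' : Finset M} (h : ind A B C) (hC : C' ⊆ C) : ind A B C' := by
  refine (hi.monotonicity_right A B C' C ?_).1
  convert h
  exact Finset.union_eq_right.2 hC

theorem base_right {A B C C₁ C₂ : Finset M} (h : ind A B C) (h₁ : C₁ ⊆ C) (h₂ : C₂ ⊆ C) :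
    ind A (B ∪ C₁) C₂ := by
  have := (hi.monotonicity_right A B C₁ C₂ (hi.mono_right h (by
    intro x hx; rcases Finset.mem_union.1 hx with hx | hx
    exacts [h₁ hx, h₂ hx]))).2
  convert this

theorem trans_right {A B B' C D : Finset M} (h₁ : ind A B C) (h₂ : ind A B' D)
    (hB : B' = B ∪ C) : ind A B D := by
  refine hi.transitivity_right A B C D h₁ ?_
  convert h₂
  rw [hB]

theorem trans_left {A B B' C D : Finset M} (h₁ : ind A B C) (h₂ : ind D B' C)
    (hB : B' = A ∪ B) : ind D B C := by
  refine hi.transitivity_left A B C D h₁ ?_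
  convert h₂
  rw [hB]

end IsStationaryWeakIndependence

theorem MovesAlmostRMax.exists_aut {g : M ≃[L] M} (hg : MovesAlmostRMax ind g) (X A : Finset M) :
    ∃ σ : M ≃[L] M, (∀ x ∈ X, σ x = x) ∧ ind (A.image σ) X ((A.image σ).image g) := by
  obtain ⟨n, p, rfl⟩ := exists_entries_eq A
  obtain ⟨a, ⟨σ, hσ, ha⟩, h⟩ := hg X n p
  refine ⟨σ, hσ, ?_⟩
  simpa only [← entries_comp, ha] using h

theorem MovesAlmostLMax.exists_aut {g : M ≃[L] M} (hg : MovesAlmostLMax ind g) (X A : Finset M) :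
    ∃ σ : M ≃[L] M, (∀ x ∈ X, σ x = x) ∧ ind ((A.image σ).image g) X (A.image σ) := by
  obtain ⟨n, p, rfl⟩ := exists_entries_eq A
  obtain ⟨a, ⟨σ, hσ, ha⟩, h⟩ := hg X n p
  refine ⟨σ, hσ, ?_⟩
  simpa only [← entries_comp, ha] using h

/-- The conjugate `h g h⁻¹`. -/
def conjBy (h g : M ≃[L] M) : M ≃[L] M := h * g * h⁻¹

theorem conjBy_apply (h g : M ≃[L] M) (x : M) : conjBy h g x = h (g (h⁻¹ x)) := rfl

theorem conjBy_inv (h g : M ≃[L] M) : (conjBy h g)⁻¹ = conjBy h g⁻¹ := by simp [conjBy, mul_assoc]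

theorem conjBy_mul (a h g : M ≃[L] M) : conjBy (a * h) g = conjBy a (conjBy h g) := by
  simp [conjBy, mul_assoc]

theorem conjBy_apply_fixed {a g : M ≃[L] M} {x : M} (h₁ : a x = x) (h₂ : a (g x) = g x) :
    conjBy a g x = g x := by
  rw [conjBy_apply, aut_inv_eq_self h₁, h₂]

theorem IsStationaryWeakIndependence.conj_RMax (hi : IsStationaryWeakIndependence L M ind)
    (h : M ≃[L] M) {g : M ≃[L] M} (hg : MovesAlmostRMax ind g) :
    MovesAlmostRMax ind (conjBy h g) := by
  intro X n p
  obtain ⟨a, ⟨σ, hσ, ha⟩, hind⟩ := hg (X.image (h⁻¹ : M ≃[L] M)) n (fun i => h⁻¹ (p i))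
  refine ⟨fun i => h (a i), ⟨h * σ * h⁻¹, fun x hx => ?_, fun i => ?_⟩, ?_⟩
  · simp [hσ _ (Finset.mem_image_of_mem _ hx)]
  · simp [ha]
  · refine hi.invariant h hind (entries_comp _ _).symm (image_image_inv _ _) ?_
    rw [← entries_comp]
    simp [conjBy]

theorem IsStationaryWeakIndependence.conj_LMax (hi : IsStationaryWeakIndependence L M ind)
    (h : M ≃[L] M) {g : M ≃[L] M} (hg : MovesAlmostLMax ind g) :
    MovesAlmostLMax ind (conjBy h g) := by
  intro X n p
  obtain ⟨a, ⟨σ, hσ, ha⟩, hind⟩ := hg (X.image (h⁻¹ : M ≃[L] M)) n (fun i => h⁻¹ (p i))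
  refine ⟨fun i => h (a i), ⟨h * σ * h⁻¹, fun x hx => ?_, fun i => ?_⟩, ?_⟩
  · simp [hσ _ (Finset.mem_image_of_mem _ hx)]
  · simp [ha]
  · refine hi.invariant h hind ?_ (image_image_inv _ _) (entries_comp _ _).symm
    rw [← entries_comp]
    simp [conjBy]

/-- If `g` moves almost `R`-maximally, then every map `ρ` that agrees with `g` on `X` agrees on
`A` with a conjugate of `g` by an automorphism fixing `X` and `g X` pointwise, as soon as `A` and
its image `ρ A` are in independent position. -/
theorem IsStationaryWeakIndependence.exists_conj_eq (hi : IsStationaryWeakIndependence L M ind)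
    {g : M ≃[L] M} (hg : MovesAlmostRMax ind g) {X Y A : Finset M} (hY : X.image g = Y)
    {ρ : M ≃[L] M} (hρ : ∀ x ∈ X, ρ x = g x) (h₁ : ind A X Y) (h₂ : ind (A.image ρ) Y X)
    (h₃ : ind A (X ∪ Y) (A.image ρ)) :
    ∃ a : M ≃[L] M, (∀ x ∈ X ∪ Y, a x = x) ∧ ∀ x ∈ A, conjBy a g x = ρ x := by
  set V := X.image (g⁻¹ : M ≃[L] M) with hV
  obtain ⟨σ₁, hσ₁, hi₁⟩ := hi.exists_left A (X ∪ Y) (Y ∪ V)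
  obtain ⟨σ₂, hσ₂, hi₂⟩ := hg.exists_aut (X ∪ Y ∪ (Y ∪ V)) (A.image σ₁)
  rw [← image_mul] at hi₂
  have hσ : ∀ x ∈ X ∪ Y, (σ₂ * σ₁) x = x := fun x hx => by
    rw [aut_mul_apply, hσ₁ x hx, hσ₂ x (Finset.mem_union_left _ hx)]
  replace hi₁ : ind (A.image (σ₂ * σ₁)) (X ∪ Y) (Y ∪ V) := by
    refine hi.invariant σ₂ hi₁ (image_mul _ _ _).symm (image_eq_self fun x hx => ?_)
      (image_eq_self fun x hx => ?_)
    · exact hσ₂ x (Finset.mem_union_left _ hx)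
    · exact hσ₂ x (Finset.mem_union_right _ hx)
  generalize σ₂ * σ₁ = σ at hσ hi₁ hi₂
  have hσX : ∀ x ∈ X, σ x = x := fun x hx => hσ x (Finset.mem_union_left _ hx)
  have hσY : ∀ x ∈ Y, σ x = x := fun x hx => hσ x (Finset.mem_union_right _ hx)
  have i₁ : ind (A.image σ) X Y :=
    hi.invariant σ h₁ rfl (image_eq_self hσX) (image_eq_self hσY)
  have i₂ : ind (A.image σ) X V :=
    hi.mono_right (hi.trans_right i₁ hi₁ rfl) Finset.subset_union_right
  have i₃ : ind ((A.image σ).image g) Y X := hi.invariant g i₂ rfl hY (image_image_inv _ _)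
  have i₄ : ind (A.image σ) (X ∪ Y) ((A.image σ).image g) := hi.trans_right hi₁ hi₂ rfl
  obtain ⟨τ, hτ, hτA⟩ := hi.stationary_left (A := A.image ρ) (B := Y) (C := X)
    (σ := g * σ * ρ⁻¹) (by
      intro y hy
      rw [← hY, Finset.mem_image] at hy
      obtain ⟨x, hx, rfl⟩ := hy
      rw [← hρ x hx, aut_mul_apply, aut_inv_apply_self, aut_mul_apply, hσX x hx, hρ x hx]) h₂ (by
      convert i₃ using 1
      rw [image_mul, image_inv_image, image_mul])
  have hτ' : ∀ x ∈ X ∪ Y, τ⁻¹ x = x := fun x hx =>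
    aut_inv_eq_self (hτ x (by rwa [Finset.union_comm]))
  have hτA' : ∀ x ∈ A, τ⁻¹ (g (σ x)) = ρ x := fun x hx => by
    have := hτA (ρ x) (Finset.mem_image_of_mem _ hx)
    rw [aut_mul_apply, aut_inv_apply_self, aut_mul_apply] at this
    rw [← this, aut_inv_apply_self]
  obtain ⟨τ', hτ'', hτA''⟩ := hi.stationary_left (A := A) (B := X ∪ Y) (C := A.image ρ)
    (σ := τ⁻¹ * σ) (fun x hx => by rw [aut_mul_apply, hσ x hx, hτ' x hx]) h₃ (by
      refine hi.invariant τ⁻¹ i₄ (image_mul _ _ _).symm (image_eq_self hτ') ?_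
      ext y
      simp only [Finset.mem_image, exists_exists_and_eq_and]
      constructor
      · rintro ⟨x, hx, rfl⟩; exact ⟨x, hx, (hτA' x hx).symm⟩
      · rintro ⟨x, hx, rfl⟩; exact ⟨x, hx, hτA' x hx⟩)
  have key : ∀ x ∈ A, (τ'⁻¹ * τ⁻¹) (σ x) = x := fun x hx => by
    rw [aut_mul_apply, aut_inv_eq_iff, hτA'' x hx, aut_mul_apply]
  refine ⟨τ'⁻¹ * τ⁻¹, fun x hx => ?_, fun x hx => ?_⟩
  · rw [aut_mul_apply, hτ' x hx]
    exact aut_inv_eq_self (hτ'' x (Finset.mem_union_left _ hx))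
  · rw [conjBy_apply, show (τ'⁻¹ * τ⁻¹)⁻¹ x = σ x from aut_inv_eq_iff.2 (key x hx).symm,
      aut_mul_apply, hτA' x hx]
    exact aut_inv_eq_self (hτ'' _ (Finset.mem_union_right _ (Finset.mem_image_of_mem _ hx)))

/-- If `g` moves almost `L`-maximally, then an arbitrary finite set `A` is brought into independent
position by a conjugate of `g` that agrees with `g` on a prescribed set `X`. -/
theorem IsStationaryWeakIndependence.exists_conj_ind (hi : IsStationaryWeakIndependence L M ind)
    {g : M ≃[L] M} (hg : MovesAlmostLMax ind g) {X Y W : Finset M} (A : Finset M)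
    (hW : ind X Y W) :
    ∃ a : M ≃[L] M, (∀ x ∈ X ∪ Y, a x = x) ∧ ind (A.image (conjBy a g)) Y W := by
  obtain ⟨σ, hσ, hi₁⟩ := hg.exists_aut (X ∪ Y) A
  have hσ' : ∀ x ∈ X ∪ Y, σ⁻¹ x = x := fun x hx => aut_inv_eq_self (hσ x hx)
  replace hi₁ : ind (A.image (conjBy σ⁻¹ g)) (X ∪ Y) A := by
    refine hi.invariant σ⁻¹ hi₁ ?_ (image_eq_self hσ') (image_inv_image _ _)
    rw [conjBy, image_mul, image_mul, inv_inv]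
  obtain ⟨τ, hτ, hi₂⟩ := hi.exists_left (A.image (conjBy σ⁻¹ g)) (X ∪ Y ∪ A) W
  have hτ' : ∀ x ∈ X ∪ Y, τ x = x := fun x hx => hτ x (Finset.mem_union_left _ hx)
  have hτA : ∀ x ∈ A, τ x = x := fun x hx => hτ x (Finset.mem_union_right _ hx)
  have hi₃ : ind ((A.image (conjBy σ⁻¹ g)).image τ) (X ∪ Y) A :=
    hi.invariant τ hi₁ rfl (image_eq_self hτ') (image_eq_self hτA)
  refine ⟨τ * σ⁻¹, fun x hx => by rw [aut_mul_apply, hσ' x hx, hτ' x hx], ?_⟩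
  have hA : A.image (conjBy (τ * σ⁻¹) g) = (A.image (conjBy σ⁻¹ g)).image τ := by
    ext y
    simp only [Finset.mem_image, exists_exists_and_eq_and]
    have : ∀ x ∈ A, conjBy (τ * σ⁻¹) g x = τ (conjBy σ⁻¹ g x) := fun x hx => by
      rw [conjBy_mul, conjBy_apply, aut_inv_eq_self (hτA x hx)]
    constructor
    · rintro ⟨x, hx, rfl⟩; exact ⟨x, hx, (this x hx).symm⟩
    · rintro ⟨x, hx, rfl⟩; exact ⟨x, hx, this x hx⟩
  rw [hA]
  exact hi.trans_left hW (hi.trans_right hi₃ hi₂ rfl) rfl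

end Simplicity

/-! ### Density of the values of a word map -/

section Density

open Classical

variable {L : FirstOrder.Language.{0, u}} {M : Type w} [L.Structure M]
  {ind : Finset M → Finset M → Finset M → Prop}

/-- The product `(g⁻¹)^(h₃) g^(h₂) (g⁻¹)^(h₁) g^(h₀)` of conjugates of `g` and `g⁻¹`. -/
def conjWord (g : M ≃[L] M) (h : Fin 4 → M ≃[L] M) : M ≃[L] M :=
  conjBy (h 3) g⁻¹ * conjBy (h 2) g * conjBy (h 1) g⁻¹ * conjBy (h 0) g

theorem conjWord_mem {N : Subgroup (M ≃[L] M)} (hN : N.Normal) {g : M ≃[L] M} (hg : g ∈ N)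
    (h : Fin 4 → M ≃[L] M) : conjWord g h ∈ N :=
  N.mul_mem (N.mul_mem (N.mul_mem (hN.conj_mem _ (N.inv_mem hg) _) (hN.conj_mem _ hg _))
    (hN.conj_mem _ (N.inv_mem hg) _)) (hN.conj_mem _ hg _)

/-- The tuple `h'` agrees with `h` wherever `h` takes values in the finite set `E`. -/
def Near (E : Finset M) (h h' : Fin 4 → M ≃[L] M) : Prop := ∀ i x, h i x ∈ E → h' i x = h i x

theorem Near.trans {E E' : Finset M} {h h' h'' : Fin 4 → M ≃[L] M} (h₁ : Near E h h')
    (h₂ : Near E' h' h'') (hE : E ⊆ E') : Near E h h'' := fun i x hx => by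
  rw [h₂ i x (hE (by rwa [h₁ i x hx])), h₁ i x hx]

theorem Near.mono {E E' : Finset M} {h h' : Fin 4 → M ≃[L] M} (h₁ : Near E' h h') (hE : E ⊆ E') :
    Near E h h' := fun i x hx => h₁ i x (hE hx)

theorem conjBy_eq_of_near {h h' g : M ≃[L] M} {E : Finset M} (hn : ∀ x, h x ∈ E → h' x = h x)
    {x : M} (h₁ : x ∈ E) (h₂ : conjBy h g x ∈ E) : conjBy h' g x = conjBy h g x := by
  have : h'⁻¹ x = h⁻¹ x := by
    rw [aut_inv_eq_iff, hn _ (by rwa [aut_apply_inv_self]), aut_apply_inv_self]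
  rw [conjBy_apply, this]
  exact hn _ h₂

/-- Continuity of the word map. -/
theorem exists_near_conjWord_eq (g : M ≃[L] M) (h : Fin 4 → M ≃[L] M) (A : Finset M) :
    ∃ E : Finset M, ∀ h', Near E h h' → ∀ x ∈ A, conjWord g h' x = conjWord g h x := by
  let A₁ := A.image (conjBy (h 0) g)
  let A₂ := A₁.image (conjBy (h 1) g⁻¹)
  let A₃ := A₂.image (conjBy (h 2) g)
  let A₄ := A₃.image (conjBy (h 3) g⁻¹)
  refine ⟨A ∪ A₁ ∪ A₂ ∪ A₃ ∪ A₄, fun h' hn x hx => ?_⟩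
  have h₁ := Finset.mem_image_of_mem (conjBy (h 0) g) hx
  have h₂ := Finset.mem_image_of_mem (conjBy (h 1) g⁻¹) h₁
  have h₃ := Finset.mem_image_of_mem (conjBy (h 2) g) h₂
  have h₄ := Finset.mem_image_of_mem (conjBy (h 3) g⁻¹) h₃
  simp only [conjWord, aut_mul_apply]
  rw [conjBy_eq_of_near (hn 0) (by simp only [Finset.mem_union]; tauto)
      (by simp only [Finset.mem_union]; tauto),
    conjBy_eq_of_near (hn 1) (by simp only [Finset.mem_union]; tauto)
      (by simp only [Finset.mem_union]; tauto),
    conjBy_eq_of_near (hn 2) (by simp only [Finset.mem_union]; tauto)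
      (by simp only [Finset.mem_union]; tauto),
    conjBy_eq_of_near (hn 3) (by simp only [Finset.mem_union]; tauto)
      (by simp only [Finset.mem_union]; tauto)]

/-- The values of the word map on the neighbourhood of `h` given by `E` are dense in the
neighbourhood of `conjWord g h` given by `A`. -/
def IsDenseNear (g : M ≃[L] M) (h : Fin 4 → M ≃[L] M) (E A : Finset M) : Prop :=
  ∀ f : M ≃[L] M, (∀ x ∈ A, f x = conjWord g h x) → ∀ B : Finset M,
    ∃ h', Near E h h' ∧ ∀ x ∈ B, conjWord g h' x = f x

/-- Every neighbourhood in the space of tuples contains one whose image under the word map is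
somewhere dense. The two outer conjugates bring source and target into independent position, and
the two inner ones meet in a generic realisation over the middle set. -/
theorem IsStationaryWeakIndependence.exists_isDenseNear (hi : IsStationaryWeakIndependence L M ind)
    {g : M ≃[L] M} (hR : MovesAlmostRMax ind g) (hL : MovesAlmostLMax ind g)
    (h : Fin 4 → M ≃[L] M) (E : Finset M) :
    ∃ h' A, Near E h h' ∧ IsDenseNear g h' E A := by
  obtain ⟨g₂, hg₂⟩ : ∃ k, k = conjBy (h 1) g⁻¹ := ⟨_, rfl⟩
  obtain ⟨g₃, hg₃⟩ : ∃ k, k = conjBy (h 2) g := ⟨_, rfl⟩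
  set Y₂ := E.image g₂ ∪ E.image (g₃⁻¹ : M ≃[L] M) with hY₂
  set Y₁ := Y₂.image (g₂⁻¹ : M ≃[L] M) with hY₁
  set Y₃ := Y₂.image g₃ with hY₃
  have hE₁ : E ⊆ Y₁ := fun x hx => by
    rw [hY₁, mem_image_inv, hY₂]
    exact Finset.mem_union_left _ (Finset.mem_image_of_mem _ hx)
  have hE₃ : E ⊆ Y₃ := fun x hx => by
    rw [hY₃, mem_image_aut, hY₂]
    exact Finset.mem_union_right _ (Finset.mem_image_of_mem _ hx)
  obtain ⟨a, ha, hia⟩ := hi.exists_left (Y₁.image ((conjBy (h 0) g)⁻¹ : M ≃[L] M)) Y₁ Y₂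
  obtain ⟨b, hb, hib⟩ := hi.exists_left (Y₃.image (conjBy (h 3) g⁻¹)) Y₃ Y₂
  set Y₀ := (Y₁.image ((conjBy (h 0) g)⁻¹ : M ≃[L] M)).image a with hY₀
  set Y₄ := (Y₃.image (conjBy (h 3) g⁻¹)).image b with hY₄
  obtain ⟨g₁, hg₁⟩ : ∃ k, k = conjBy (a * h 0) g := ⟨_, rfl⟩
  obtain ⟨g₄, hg₄⟩ : ∃ k, k = conjBy (b * h 3) g⁻¹ := ⟨_, rfl⟩
  have hg₁Y : ∀ x ∈ Y₀, g₁ x ∈ Y₁ := by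
    intro x hx
    rw [hY₀, mem_image_aut, mem_image_inv] at hx
    rw [hg₁, conjBy_mul, conjBy_apply, ha _ hx]
    exact hx
  have hg₄Y : ∀ x ∈ Y₃, g₄ x ∈ Y₄ := by
    intro x hx
    rw [hg₄, conjBy_mul, conjBy_apply, aut_inv_eq_self (hb x hx)]
    exact Finset.mem_image_of_mem _ (Finset.mem_image_of_mem _ hx)
  refine ⟨![a * h 0, h 1, h 2, b * h 3], Y₀, ?_, ?_⟩
  · intro i x hx
    fin_cases i
    · exact ha _ (hE₁ hx)
    · rfl
    · rfl
    · exact hb _ (hE₃ hx)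
  intro f hf B
  replace hf : ∀ x ∈ Y₀, f x = g₄ (g₃ (g₂ (g₁ x))) := by
    intro x hx
    rw [hf x hx, hg₁, hg₂, hg₃, hg₄]
    rfl
  have hR₃ : MovesAlmostRMax ind g₃ := by rw [hg₃]; exact hi.conj_RMax _ hR
  have hR₂ : MovesAlmostRMax ind g₂⁻¹ := by
    rw [hg₂, conjBy_inv, inv_inv]; exact hi.conj_RMax _ hR
  have hL₁ : MovesAlmostLMax ind g₁ := by rw [hg₁]; exact hi.conj_LMax _ hL
  have hL₄ : MovesAlmostLMax ind g₄⁻¹ := by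
    rw [hg₄, conjBy_inv, inv_inv]; exact hi.conj_LMax _ hL
  -- the outer conjugates, read inwards from both ends
  obtain ⟨a₁, ha₁, hi₁⟩ := hi.exists_conj_ind hL₁ B hia
  obtain ⟨a₄, ha₄, hi₄⟩ := hi.exists_conj_ind hL₄ (B.image f) hib
  set ρ₁ := conjBy a₁ g₁ with hρ₁
  set ρ₄ := conjBy a₄ g₄⁻¹ with hρ₄
  have hρ₁Y : ∀ x ∈ Y₀, ρ₁ x = g₁ x := fun x hx =>
    conjBy_apply_fixed (ha₁ x (Finset.mem_union_left _ hx))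
      (ha₁ _ (Finset.mem_union_right _ (hg₁Y x hx)))
  have hρ₄Y : ∀ x ∈ Y₃, ρ₄ (g₄ x) = x := fun x hx => by
    rw [hρ₄, conjBy_apply_fixed (ha₄ _ (Finset.mem_union_left _ (hg₄Y x hx))), aut_inv_apply_self]
    rw [aut_inv_apply_self]
    exact ha₄ _ (Finset.mem_union_right _ hx)
  -- a generic realisation over the middle set
  obtain ⟨σ, hσ, hi₂⟩ := hi.exists_left ((B.image ρ₁).image g₂) Y₂
    (Y₁ ∪ B.image ρ₁ ∪ (Y₃ ∪ (B.image f).image ρ₄))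
  set X₂ := ((B.image ρ₁).image g₂).image σ with hX₂
  have hs₁ : Y₁ ⊆ Y₁ ∪ B.image ρ₁ ∪ (Y₃ ∪ (B.image f).image ρ₄) := fun x hx => by
    simp only [Finset.mem_union]; tauto
  have hs₂ : B.image ρ₁ ⊆ Y₁ ∪ B.image ρ₁ ∪ (Y₃ ∪ (B.image f).image ρ₄) := fun x hx => by
    simp only [Finset.mem_union]; tauto
  have hs₃ : Y₃ ⊆ Y₁ ∪ B.image ρ₁ ∪ (Y₃ ∪ (B.image f).image ρ₄) := fun x hx => by
    simp only [Finset.mem_union]; tauto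
  have hs₄ : (B.image f).image ρ₄ ⊆ Y₁ ∪ B.image ρ₁ ∪ (Y₃ ∪ (B.image f).image ρ₄) :=
    Finset.subset_union_right.trans Finset.subset_union_right
  have hX₂₁ : X₂.image ((σ * g₂)⁻¹ : M ≃[L] M) = B.image ρ₁ := by
    rw [hX₂, ← image_mul σ g₂, image_inv_image]
  have hX₂₃ : X₂.image (ρ₄ * f * (σ * g₂ * ρ₁)⁻¹) = (B.image f).image ρ₄ := by
    rw [hX₂, ← image_mul σ g₂, ← image_mul (σ * g₂) ρ₁, image_mul, image_inv_image, image_mul]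
  obtain ⟨a₂, ha₂, hA₂⟩ := hi.exists_conj_eq hR₂ (X := Y₂) (Y := Y₁) (A := X₂) hY₁.symm
    (ρ := (σ * g₂)⁻¹) (fun x hx => by
      rw [mul_inv_rev, aut_mul_apply, aut_inv_eq_self (hσ x hx)])
    (hi.mono_right hi₂ hs₁) (by rwa [hX₂₁]) (by rw [hX₂₁]; exact hi.base_right hi₂ hs₁ hs₂)
  obtain ⟨a₃, ha₃, hA₃⟩ := hi.exists_conj_eq hR₃ (X := Y₂) (Y := Y₃) (A := X₂) hY₃.symm
    (ρ := ρ₄ * f * (σ * g₂ * ρ₁)⁻¹) (fun x hx => by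
      have h0 : a (((conjBy (h 0) g)⁻¹ : M ≃[L] M) (g₂⁻¹ x)) ∈ Y₀ :=
        Finset.mem_image_of_mem _ (Finset.mem_image_of_mem _ (Finset.mem_image_of_mem _ hx))
      set y := a (((conjBy (h 0) g)⁻¹ : M ≃[L] M) (g₂⁻¹ x)) with hy
      have hyx : g₁ y = g₂⁻¹ x := by
        rw [hg₁, conjBy_mul, conjBy_apply, hy, aut_inv_apply_self, aut_apply_inv_self]
        exact ha _ (Finset.mem_image_of_mem _ hx)
      have hyx' : (σ * g₂ * ρ₁)⁻¹ x = y := by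
        rw [aut_inv_eq_iff, aut_mul_apply, hρ₁Y y h0, hyx, aut_mul_apply, aut_apply_inv_self,
          hσ x hx]
      rw [aut_mul_apply, hyx', aut_mul_apply, hf y h0, hyx, aut_apply_inv_self]
      exact hρ₄Y _ (Finset.mem_image_of_mem _ hx))
    (hi.mono_right hi₂ hs₃) (by rwa [hX₂₃]) (by rw [hX₂₃]; exact hi.base_right hi₂ hs₃ hs₄)
  refine ⟨![a₁ * (a * h 0), a₂ * h 1, a₃ * h 2, a₄ * (b * h 3)], ?_, ?_⟩
  · intro i x hx
    fin_cases i
    · exact ha₁ _ (Finset.mem_union_right _ (hE₁ hx))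
    · exact ha₂ _ (Finset.mem_union_right _ (hE₁ hx))
    · exact ha₃ _ (Finset.mem_union_right _ (hE₃ hx))
    · exact ha₄ _ (Finset.mem_union_right _ (hE₃ hx))
  · intro x hx
    have hx₂ : σ (g₂ (ρ₁ x)) ∈ X₂ := Finset.mem_image_of_mem _ (Finset.mem_image_of_mem _
      (Finset.mem_image_of_mem _ hx))
    have e₂ : conjBy a₂ g₂ (ρ₁ x) = σ (g₂ (ρ₁ x)) := by
      have := hA₂ _ hx₂
      rw [← conjBy_inv, aut_inv_eq_iff] at this
      rw [this]
      congr 1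
      rw [eq_comm, aut_inv_eq_iff]
      rfl
    have e₃ : conjBy a₃ g₃ (σ (g₂ (ρ₁ x))) = ρ₄ (f x) := by
      rw [hA₃ _ hx₂, aut_mul_apply, aut_mul_apply]
      congr 2
      rw [aut_inv_eq_iff]
      rfl
    have e₄ : conjBy a₄ g₄ (ρ₄ (f x)) = f x := by
      rw [hρ₄, ← conjBy_inv, aut_apply_inv_self]
    simp only [conjWord, aut_mul_apply]
    change conjBy (a₄ * (b * h 3)) g⁻¹ (conjBy (a₃ * h 2) g (conjBy (a₂ * h 1) g⁻¹
      (conjBy (a₁ * (a * h 0)) g x))) = f x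
    rw [conjBy_mul a₁, conjBy_mul a₂, conjBy_mul a₃, conjBy_mul a₄, ← hg₁, ← hg₂, ← hg₃, ← hg₄,
      ← hρ₁, e₂, e₃, e₄]

end Density

/-! ### Normal subgroups of the automorphism group -/

section BackAndForth

open Classical

variable {L : FirstOrder.Language.{0, u}} {M : Type w} [L.Structure M]
  {ind : Finset M → Finset M → Finset M → Prop}

theorem IsDenseNear.mono {g : M ≃[L] M} {h : Fin 4 → M ≃[L] M} {E A A' : Finset M}
    (hd : IsDenseNear g h E A) (hA : A ⊆ A') : IsDenseNear g h E A' :=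
  fun f hf B => hd f (fun x hx => hf x (hA hx)) B

/-- The finite set of all values of the automorphisms of the tuple `h` on `P`. -/
noncomputable def tupleImage (h : Fin 4 → M ≃[L] M) (P : Finset M) : Finset M :=
  Finset.univ.biUnion fun i => P.image (h i)

theorem mem_tupleImage (h : Fin 4 → M ≃[L] M) {P : Finset M} (i : Fin 4) {x : M} (hx : x ∈ P) :
    h i x ∈ tupleImage h P :=
  Finset.mem_biUnion.2 ⟨i, Finset.mem_univ i, Finset.mem_image_of_mem _ hx⟩

/-- The limit of a sequence of tuples that stabilise on neighbourhoods shrinking to a point. -/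
theorem exists_tuple_limit (h : ℕ → Fin 4 → M ≃[L] M) (E : ℕ → Finset M) (hE : Monotone E)
    (hn : ∀ n, Near (E n) (h n) (h (n + 1))) (hran : ∀ m, ∃ n, m ∈ E n)
    (hdom : ∀ m, ∃ n, ∀ i, h n i m ∈ E n) :
    ∃ k : Fin 4 → M ≃[L] M, ∀ n i x, h n i x ∈ E n → k i x = h n i x := by
  have : ∀ i, ∃ k' : M ≃[L] M, ∀ n, ∀ x ∈ (E n).image ((h n i)⁻¹ : M ≃[L] M), k' x = h n i x := by
    intro i
    refine exists_limit (fun n => h n i) _ (monotone_nat_of_le_succ fun n x hx => ?_)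
      (fun n x hx => ?_) (fun m => ?_) (fun m => ?_)
    · rw [mem_image_inv] at hx ⊢
      rw [hn n i x hx]
      exact hE n.le_succ hx
    · rw [mem_image_inv] at hx
      exact hn n i x hx
    · obtain ⟨n, hn⟩ := hdom m
      exact ⟨n, mem_image_inv.2 (hn i)⟩
    · obtain ⟨n, hn⟩ := hran m
      exact ⟨n, (h n i)⁻¹ m, Finset.mem_image_of_mem _ hn, by simp⟩
  choose k hk using this
  exact ⟨k, fun n i x hx => hk i n x (mem_image_inv.2 hx)⟩

/-- If the word map is somewhere dense near every tuple, then two words can be made to meet: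
every `f` that carries the value at `h` into the dense region is a quotient of two words. -/
theorem exists_conjWord_eq_mul [Countable M] {g : M ≃[L] M}
    (hdense : ∀ (h : Fin 4 → M ≃[L] M) (E : Finset M), ∃ h' A, Near E h h' ∧ IsDenseNear g h' E A)
    {h : Fin 4 → M ≃[L] M} {E A : Finset M} (hd : IsDenseNear g h E A) {f : M ≃[L] M}
    (hf : ∀ x ∈ A, f (conjWord g h x) = conjWord g h x) :
    ∃ h' k', conjWord g h' = f * conjWord g k' := by
  obtain ⟨d, hd'⟩ := exists_injective_nat M
  let Q : ℕ → Finset M := fun n =>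
    ((Set.finite_Iic n).preimage (f := d) hd'.injOn).toFinset
  have hQ : ∀ n x, x ∈ Q n ↔ d x ≤ n := fun n x => by simp [Q]
  -- a state consists of two tuples, with a neighbourhood of each, and the set on which
  -- the first word agrees with the translate of the second
  let P : ((Fin 4 → M ≃[L] M) × Finset M) × ((Fin 4 → M ≃[L] M) × Finset M) × Finset M → Prop :=
    fun s => IsDenseNear g s.1.1 s.1.2 s.2.2 ∧
      ∀ x ∈ s.2.2, conjWord g s.1.1 x = f (conjWord g s.2.1.1 x)
  obtain ⟨s, -, hs⟩ := exists_seq P (fun n s s' =>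
      (Near s.1.2 s.1.1 s'.1.1 ∧ s.1.2 ⊆ s'.1.2 ∧ Q n ⊆ s'.1.2 ∧
        ∀ x ∈ Q n, ∀ i, s'.1.1 i x ∈ s'.1.2) ∧
      (Near s.2.1.2 s.2.1.1 s'.2.1.1 ∧ s.2.1.2 ⊆ s'.2.1.2 ∧ Q n ⊆ s'.2.1.2 ∧
        ∀ x ∈ Q n, ∀ i, s'.2.1.1 i x ∈ s'.2.1.2) ∧ Q n ⊆ s'.2.2) (by
    rintro n ⟨⟨h, E⟩, ⟨k, F⟩, A⟩ ⟨hA, hf⟩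
    dsimp only at hA hf
    obtain ⟨F', hF'⟩ := exists_near_conjWord_eq g k A
    obtain ⟨k₁, A₁, hk₁, hA₁⟩ := hdense k (F ∪ F' ∪ Q n ∪ tupleImage k (Q n))
    obtain ⟨h₁, hh₁, hfh₁⟩ := hA (f * conjWord g k₁) (fun x hx => by
      rw [aut_mul_apply, hF' k₁ (hk₁.mono fun y hy => by simp [hy]) x hx, ← hf x hx]) A₁
    obtain ⟨E', hE'⟩ := exists_near_conjWord_eq g h₁ A₁
    obtain ⟨h₂, A₂, hh₂, hA₂⟩ := hdense h₁ (E ∪ E' ∪ Q n ∪ tupleImage h₁ (Q n))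
    obtain ⟨k₂, hk₂, hfk₂⟩ := hA₁ (f⁻¹ * conjWord g h₂) (fun x hx => by
      rw [aut_mul_apply, hE' h₂ (hh₂.mono fun y hy => by simp [hy]) x hx, hfh₁ x hx,
        aut_mul_apply, aut_inv_apply_self]) (A₂ ∪ Q n)
    refine ⟨⟨⟨h₂, E ∪ E' ∪ Q n ∪ tupleImage h₁ (Q n)⟩,
      ⟨k₂, F ∪ F' ∪ Q n ∪ tupleImage k (Q n)⟩, A₂ ∪ Q n⟩,
      ⟨hA₂.mono Finset.subset_union_left, fun x hx => ?_⟩,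
      ⟨hh₁.trans hh₂ fun y hy => by simp [hy], fun y hy => by simp [hy], fun y hy => by simp [hy],
        fun x hx i => ?_⟩,
      ⟨(hk₁.trans hk₂ subset_rfl).mono fun y hy => by simp [hy], fun y hy => by simp [hy],
        fun y hy => by simp [hy], fun x hx i => ?_⟩, Finset.subset_union_right⟩
    · dsimp only
      rw [hfk₂ x hx, aut_mul_apply, aut_apply_inv_self]
    · have := Finset.mem_union_right (E ∪ E' ∪ Q n) (mem_tupleImage h₁ i hx)
      dsimp only
      rwa [hh₂ i x this]
    · have := Finset.mem_union_right (F ∪ F' ∪ Q n) (mem_tupleImage k i hx)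
      dsimp only
      rwa [(hk₁.trans hk₂ subset_rfl) i x this]) (s₀ := ((h, E), (h, ∅), A))
    ⟨hd, fun x hx => (hf x hx).symm⟩
  obtain ⟨h', hh'⟩ := exists_tuple_limit (fun n => (s n).1.1) (fun n => (s n).1.2)
    (monotone_nat_of_le_succ fun n => (hs n).2.1.2.1) (fun n => (hs n).2.1.1)
    (fun m => ⟨d m + 1, (hs (d m)).2.1.2.2.1 ((hQ _ _).2 le_rfl)⟩)
    (fun m => ⟨d m + 1, (hs (d m)).2.1.2.2.2 m ((hQ _ _).2 le_rfl)⟩)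
  obtain ⟨k', hk'⟩ := exists_tuple_limit (fun n => (s n).2.1.1) (fun n => (s n).2.1.2)
    (monotone_nat_of_le_succ fun n => (hs n).2.2.1.2.1) (fun n => (hs n).2.2.1.1)
    (fun m => ⟨d m + 1, (hs (d m)).2.2.1.2.2.1 ((hQ _ _).2 le_rfl)⟩)
    (fun m => ⟨d m + 1, (hs (d m)).2.2.1.2.2.2 m ((hQ _ _).2 le_rfl)⟩)
  refine ⟨h', k', aut_ext fun x => ?_⟩
  obtain ⟨E₁, hE₁⟩ := exists_near_conjWord_eq g h' {x}
  obtain ⟨E₂, hE₂⟩ := exists_near_conjWord_eq g k' {x}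
  -- a stage at which all points relevant for the value at `x` have been treated
  let T : Finset M := insert x
    (Finset.univ.biUnion fun i => E₁.image ((h' i)⁻¹ : M ≃[L] M) ∪ E₂.image ((k' i)⁻¹ : M ≃[L] M))
  obtain ⟨n, hn⟩ := Finset.exists_le (T.image d)
  have hT : ∀ y ∈ T, y ∈ Q n := fun y hy => (hQ _ _).2 (hn _ (Finset.mem_image_of_mem _ hy))
  have e₁ : Near E₁ h' (s (n + 1)).1.1 := by
    intro i y hy
    refine (hh' (n + 1) i y ((hs n).2.1.2.2.2 y (hT y ?_) i)).symm
    refine Finset.mem_insert_of_mem (Finset.mem_biUnion.2 ⟨i, Finset.mem_univ i, ?_⟩)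
    exact Finset.mem_union_left _ (mem_image_inv.2 hy)
  have e₂ : Near E₂ k' (s (n + 1)).2.1.1 := by
    intro i y hy
    refine (hk' (n + 1) i y ((hs n).2.2.1.2.2.2 y (hT y ?_) i)).symm
    refine Finset.mem_insert_of_mem (Finset.mem_biUnion.2 ⟨i, Finset.mem_univ i, ?_⟩)
    exact Finset.mem_union_right _ (mem_image_inv.2 hy)
  rw [← hE₁ _ e₁ x (Finset.mem_singleton_self x), aut_mul_apply,
    ← hE₂ _ e₂ x (Finset.mem_singleton_self x)]
  exact (hs (n + 1)).1.2 x ((hs n).2.2.2 (hT x (Finset.mem_insert_self _ _)))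

/-- A normal subgroup containing an element that moves almost maximally on both sides is the whole
automorphism group: it contains the pointwise stabiliser of a finite set by the meeting of words,
and the conjugates of such a stabiliser generate the group by stationarity. -/
theorem IsStationaryWeakIndependence.normal_eq_top [Countable M]
    (hi : IsStationaryWeakIndependence L M ind) {g : M ≃[L] M} (hR : MovesAlmostRMax ind g)
    (hL : MovesAlmostLMax ind g) {N : Subgroup (M ≃[L] M)} (hN : N.Normal) (hg : g ∈ N) :
    N = ⊤ := by
  obtain ⟨h, A, -, hd⟩ := hi.exists_isDenseNear hR hL (fun _ => 1) ∅
  set A₁ := A.image (conjWord g h) with hA₁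
  have hstab : ∀ f : M ≃[L] M, (∀ x ∈ A₁, f x = x) → f ∈ N := by
    intro f hf
    obtain ⟨h', k', hk⟩ := exists_conjWord_eq_mul (hi.exists_isDenseNear hR hL) hd (f := f)
      fun x hx => hf _ (Finset.mem_image_of_mem _ hx)
    rw [show f = conjWord g h' * (conjWord g k')⁻¹ by rw [hk]; group]
    exact N.mul_mem (conjWord_mem hN hg _) (N.inv_mem (conjWord_mem hN hg _))
  rw [eq_top_iff]
  rintro f -
  obtain ⟨ρ, -, hρ⟩ := hi.exists_left A₁ ∅ (A₁ ∪ A₁.image f)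
  obtain ⟨τ, hτ, hτA⟩ := hi.stationary_right (A := A₁) (B := ∅) (C := A₁.image ρ) (σ := f)
    (fun b hb => absurd hb (Finset.notMem_empty b)) (hi.mono_right hρ Finset.subset_union_left)
    (hi.mono_right hρ Finset.subset_union_right)
  have h₁ : ρ⁻¹ * τ * ρ ∈ N := hstab _ fun x hx => by
    rw [aut_mul_apply, aut_mul_apply, aut_inv_eq_iff]
    exact hτ _ (Finset.mem_union_right _ (Finset.mem_image_of_mem _ hx))
  have h₂ : τ ∈ N := by
    have := hN.conj_mem _ h₁ ρ
    simpa [mul_assoc] using this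
  have h₃ : τ⁻¹ * f ∈ N := hstab _ fun x hx => by
    rw [aut_mul_apply, aut_inv_eq_iff, hτA x hx]
  simpa using N.mul_mem h₂ h₃

theorem commutator_mem {G : Type w} [Group G] {N : Subgroup G} (hN : N.Normal) {g : G}
    (hg : g ∈ N) (h : G) : commutator h g ∈ N := by
  have h₁ := hN.conj_mem _ (N.inv_mem hg) h⁻¹
  rw [inv_inv] at h₁
  exact N.mul_mem h₁ hg

theorem commutator_mem_left {G : Type w} [Group G] {N : Subgroup G} (hN : N.Normal) {g : G}
    (hg : g ∈ N) (k : G) : commutator g k ∈ N := by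
  have h₁ := hN.conj_mem _ hg k⁻¹
  rw [inv_inv] at h₁
  have := N.mul_mem (N.inv_mem hg) h₁
  simpa [commutator, mul_assoc] using this

/-- The criterion for simplicity: the double commutator of a non-trivial element lies in its normal
closure. -/
theorem IsStationaryWeakIndependence.isSimpleGroup [Countable M] [Nontrivial (M ≃[L] M)]
    (hi : IsStationaryWeakIndependence L M ind)
    (hc : ∀ g : M ≃[L] M, g ≠ 1 → ∃ h k : M ≃[L] M,
      MovesAlmostRMax ind (commutator (commutator h g) k) ∧
      MovesAlmostLMax ind (commutator (commutator h g) k)) : IsSimpleGroup (M ≃[L] M) := by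
  refine ⟨fun N hN => or_iff_not_imp_left.2 fun hne => ?_⟩
  obtain ⟨⟨g, hg⟩, hg₁⟩ := Subgroup.ne_bot_iff_exists_ne_one.1 hne
  replace hg₁ : g ≠ 1 := fun h => hg₁ (Subtype.ext h)
  obtain ⟨h, k, hR, hL⟩ := hc g hg₁
  exact hi.normal_eq_top hR hL hN (commutator_mem_left hN (commutator_mem hN hg h) k)

end BackAndForth

/-! ### Forbidden triangles and generic coloured structures -/

section Generic

variable {Γ : Type u}

/-- The colour `x` or its converse is a solution: edges of this colour are coloured
from `ℓ`, in at least one of their directions. -/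
def IsSol (inv : Γ → Γ) (ℓ : List Γ) (x : Γ) : Prop := x ∈ ℓ ∨ inv x ∈ ℓ

/-- `F x y z` says that the triangle `pqr` with colours `x` on `(p, q)`, `y` on `(p, r)` and `z` on
`(q, r)` is forbidden. Such a system is closed under renaming the vertices (two transpositions
suffice), and no forbidden triangle has two edges coloured from `ℓ`. -/
structure IsTriangleSystem (inv : Γ → Γ) (F : Γ → Γ → Γ → Prop) (ℓ : List Γ) : Prop where
  invol : Function.Involutive inv
  swap : ∀ {x y z}, F x y z → F (inv x) z y
  swap' : ∀ {x y z}, F x y z → F y x (inv z)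
  two : ∀ {x y z}, F x y z → ¬ (IsSol inv ℓ x ∧ IsSol inv ℓ y)

namespace IsTriangleSystem

variable {inv : Γ → Γ} {F : Γ → Γ → Γ → Prop} {ℓ : List Γ}

theorem isSol_inv (h : IsTriangleSystem inv F ℓ) {x : Γ} : IsSol inv ℓ (inv x) ↔ IsSol inv ℓ x := by
  rw [IsSol, IsSol, h.invol, or_comm]

theorem rev (h : IsTriangleSystem inv F ℓ) {x y z : Γ} (hF : F x y z) :
    F (inv z) (inv y) (inv x) := by
  have := h.swap (h.swap' (h.swap hF))
  exact this

theorem two_left (h : IsTriangleSystem inv F ℓ) {x y z : Γ} (hF : F x y z) (hx : IsSol inv ℓ x) :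
    ¬ IsSol inv ℓ z := fun hz => h.two (h.swap hF) ⟨h.isSol_inv.2 hx, hz⟩

theorem two_right (h : IsTriangleSystem inv F ℓ) {x y z : Γ} (hF : F x y z) (hy : IsSol inv ℓ y) :
    ¬ IsSol inv ℓ z := fun hz => h.two (h.swap (h.swap' hF)) ⟨h.isSol_inv.2 hy, h.isSol_inv.2 hz⟩

end IsTriangleSystem

/-- The combinatorial description of the Fraïssé limit, in terms of its colouring `r`: it contains
no forbidden triangle, it realises every consistent one-point extension of a finite subset, and
every finite partial map that preserves colours extends to an automorphism. -/
structure IsGeneric (inv : Γ → Γ) (F : Γ → Γ → Γ → Prop) (ℓ : List Γ)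
    (L : FirstOrder.Language.{0, u}) {M : Type w} [L.Structure M] (r : M → M → Γ) : Prop
    extends IsTriangleSystem inv F ℓ where
  symm : ∀ {a b : M}, a ≠ b → r b a = inv (r a b)
  aut : ∀ (g : M ≃[L] M) (a b : M), r (g a) (g b) = r a b
  avoid : ∀ {a b c : M}, a ≠ b → a ≠ c → b ≠ c → ¬ F (r a b) (r a c) (r b c)
  solve : ∀ (B : Finset M) {a c : M}, a ∉ B → c ∉ B → ∃ R ∈ ℓ, ∀ b ∈ B, ¬ F (r a b) R (r b c)
  hom : ∀ (X : Finset M) (f : M → M), Set.InjOn f X →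
    (∀ x ∈ X, ∀ y ∈ X, x ≠ y → r (f x) (f y) = r x y) → ∃ g : M ≃[L] M, ∀ x ∈ X, g x = f x
  ext : ∀ (X : Finset M) (t : M → Γ), (∀ x ∈ X, ∀ y ∈ X, x ≠ y → ¬ F (t x) (t y) (r x y)) →
    ∃ a ∉ X, ∀ x ∈ X, r a x = t x
  exists_notMem : ∃ Q, Q ∉ ℓ

variable {inv : Γ → Γ} {F : Γ → Γ → Γ → Prop} {ℓ : List Γ}
  {L : FirstOrder.Language.{0, u}} {M : Type w} [L.Structure M] {r : M → M → Γ}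

open Classical

namespace IsGeneric

theorem isSol_symm (hG : IsGeneric inv F ℓ L r) {a b : M} (hab : a ≠ b) :
    IsSol inv ℓ (r b a) ↔ IsSol inv ℓ (r a b) := by
  rw [hG.symm hab, hG.isSol_inv]

/-- Realising a one-point type over `Y` with prescribed colours towards `C`. -/
theorem exists_point (hG : IsGeneric inv F ℓ L r) {Y : Finset M} {a : M} (ha : a ∉ Y)
    (C : Finset M) (q : M → Γ)
    (hq : ∀ x ∈ C, ∀ y ∈ C, x ∉ Y → y ∉ Y → x ≠ y → ¬ F (q x) (q y) (r x y))
    (hF : ∀ y ∈ Y, ∀ x ∈ C, x ∉ Y → ¬ F (r a y) (q x) (r y x)) :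
    ∃ τ : M ≃[L] M, (∀ y ∈ Y, τ y = y) ∧ τ a ∉ Y ∧ τ a ∉ C ∧ ∀ x ∈ C, x ∉ Y → r (τ a) x = q x := by
  obtain ⟨e, he, hre⟩ := hG.ext (Y ∪ C) (fun x => if x ∈ Y then r a x else q x) (by
    intro x hx y hy hxy
    have hxC : x ∉ Y → x ∈ C := fun h => (Finset.mem_union.1 hx).resolve_left h
    have hyC : y ∉ Y → y ∈ C := fun h => (Finset.mem_union.1 hy).resolve_left h
    by_cases hxY : x ∈ Y <;> by_cases hyY : y ∈ Y
    · simp only [hxY, hyY, if_true]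
      exact hG.avoid (fun h => ha (h ▸ hxY)) (fun h => ha (h ▸ hyY)) hxy
    · simp only [hxY, hyY, if_true, if_false]
      exact hF x hxY y (hyC hyY) hyY
    · simp only [hxY, hyY, if_true, if_false]
      intro h
      have := hG.swap' h
      rw [← hG.symm hxy] at this
      exact hF y hyY x (hxC hxY) hxY this
    · simp only [hxY, hyY, if_false]
      exact hq x (hxC hxY) y (hyC hyY) hxY hyY hxy)
  rw [Finset.mem_union, not_or] at he
  have hea : ∀ y ∈ Y, r e y = r a y := fun y hy => by
    rw [hre y (Finset.mem_union_left _ hy), if_pos hy]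
  have hne : ∀ y ∈ Y, y ≠ a := fun y hy h => ha (h ▸ hy)
  have hne' : ∀ y ∈ Y, y ≠ e := fun y hy h => he.1 (h ▸ hy)
  obtain ⟨τ, hτ⟩ := hG.hom (insert a Y) (fun x => if x = a then e else x) (by
      intro x hx y hy hxy
      simp only [Finset.coe_insert, Set.mem_insert_iff, Finset.mem_coe] at hx hy
      rcases hx with rfl | hx <;> rcases hy with rfl | hy
      · rfl
      · simp only [if_true, hne y hy, if_false] at hxy
        exact absurd hxy.symm (hne' y hy)
      · simp only [if_true, hne x hx, if_false] at hxy
        exact absurd hxy (hne' x hx)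
      · simpa only [hne x hx, hne y hy, if_false] using hxy) (by
      intro x hx y hy hxy
      rw [Finset.mem_insert] at hx hy
      rcases hx with rfl | hx <;> rcases hy with rfl | hy
      · exact absurd rfl hxy
      · simp only [if_true, hne y hy, if_false, hea y hy]
      · simp only [if_true, hne x hx, if_false]
        rw [hG.symm (hne' x hx).symm, hea x hx, hG.symm hxy, hG.invol]
      · simp only [hne x hx, hne y hy, if_false])
  have hτa : τ a = e := by rw [hτ a (Finset.mem_insert_self _ _), if_pos rfl]
  refine ⟨τ, fun y hy => ?_, hτa ▸ he.1, hτa ▸ he.2, fun x hx hxY => ?_⟩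
  · rw [hτ y (Finset.mem_insert_of_mem hy), if_neg (hne y hy)]
  · rw [hτa, hre x (Finset.mem_union_right _ hx), if_neg hxY]

end IsGeneric

/-! ### Independence with respect to a choice of solutions -/

/-- Giving the pair `(a, c)` the colour `R` creates a forbidden triangle with a point of `B`. -/
def Blk (F : Γ → Γ → Γ → Prop) (r : M → M → Γ) (B : Finset M) (a c : M) (R : Γ) : Prop :=
  ∃ b ∈ B, F (r a b) R (r b c)

/-- A rule that selects for any two points outside `B` a solution that creates no forbidden triangle
over `B`, and that depends only on which solutions do create one. -/
structure IsChooser (inv : Γ → Γ) (F : Γ → Γ → Γ → Prop) (ℓ : List Γ) (r : M → M → Γ)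
    (col : Finset M → M → M → Γ) : Prop where
  isSol : ∀ {B a c}, a ∉ B → c ∉ B → IsSol inv ℓ (col B a c)
  not_blk : ∀ {B a c}, a ∉ B → c ∉ B → ¬ Blk F r B a c (col B a c)
  congr : ∀ {B B' : Finset M} {a a' c c'}, a ∉ B → c ∉ B → a' ∉ B' → c' ∉ B' →
    (∀ R, IsSol inv ℓ R → (Blk F r B a c R ↔ Blk F r B' a' c' R)) → col B a c = col B' a' c'

/-- The choice of colours for the pairs `(c, a)` in place of `(a, c)`. -/
def flipCol (inv : Γ → Γ) (col : Finset M → M → M → Γ) : Finset M → M → M → Γ :=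
  fun B a c => inv (col B c a)

/-- The first colour of the list `ℓ` that creates no forbidden triangle over `B`. The default value
`r a c`, for the case that all of them do, is irrelevant: this case does not occur for points
outside `B`. -/
noncomputable def prio (F : Γ → Γ → Γ → Prop) (ℓ : List Γ) (r : M → M → Γ) :
    Finset M → M → M → Γ :=
  fun B a c => (ℓ.find? fun R => decide (¬ Blk F r B a c R)).getD (r a c)

/-- All pairs of points of `A \ B` and `C \ B` carry the colour selected by `col`; in particular
these sets are disjoint. For `col = prio` this says that `A ∪ B ∪ C` is the prioritised amalgam. -/
def IndCol (r : M → M → Γ) (col : Finset M → M → M → Γ) (A B C : Finset M) : Prop :=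
  ∀ a ∈ A, a ∉ B → ∀ c ∈ C, c ∉ B → a ≠ c ∧ r a c = col B a c

theorem flipCol_flipCol (hinv : Function.Involutive inv) (col : Finset M → M → M → Γ) :
    flipCol inv (flipCol inv col) = col := by
  funext B a c
  exact hinv _

theorem IsGeneric.prio_mem (hG : IsGeneric inv F ℓ L r) {B : Finset M} {a c : M} (ha : a ∉ B)
    (hc : c ∉ B) : (ℓ.find? fun R => decide (¬ Blk F r B a c R)) = some (prio F ℓ r B a c) := by
  obtain ⟨R, hR, hRB⟩ := hG.solve B ha hc
  have : (ℓ.find? fun R => decide (¬ Blk F r B a c R)).isSome := by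
    rw [List.find?_isSome]
    exact ⟨R, hR, by simpa [Blk] using hRB⟩
  obtain ⟨R', hR'⟩ := Option.isSome_iff_exists.1 this
  rw [prio, hR', Option.getD_some]

theorem IsGeneric.prio_mem_list (hG : IsGeneric inv F ℓ L r) {B : Finset M} {a c : M} (ha : a ∉ B)
    (hc : c ∉ B) : prio F ℓ r B a c ∈ ℓ := List.mem_of_find?_eq_some (hG.prio_mem ha hc)

theorem IsGeneric.isChooser_prio (hG : IsGeneric inv F ℓ L r) :
    IsChooser inv F ℓ r (prio F ℓ r) where
  isSol ha hc := Or.inl (hG.prio_mem_list ha hc)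
  not_blk ha hc := by simpa using List.find?_some (hG.prio_mem ha hc)
  congr {B B' a a' c c'} ha hc ha' hc' h := by
    have h₁ := hG.prio_mem ha hc
    have h₂ := hG.prio_mem ha' hc'
    have : (ℓ.find? fun R => decide (¬ Blk F r B a c R)) =
        ℓ.find? fun R => decide (¬ Blk F r B' a' c' R) := by
      have hmem : ∀ R ∈ ℓ, (Blk F r B a c R ↔ Blk F r B' a' c' R) := fun R hR => h R (Or.inl hR)
      clear h h₁ h₂ hG
      induction ℓ with
      | nil => rfl
      | cons R l ih =>
        simp only [List.find?_cons]
        rw [ih fun R hR => hmem R (List.mem_cons_of_mem _ hR)]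
        simp only [hmem R List.mem_cons_self]
    exact Option.some.inj (h₁.symm.trans (this.trans h₂))

theorem IsGeneric.blk_flip (hG : IsGeneric inv F ℓ L r) {B : Finset M} {a c : M} (ha : a ∉ B)
    (hc : c ∉ B) {R : Γ} (h : Blk F r B a c R) : Blk F r B c a (inv R) := by
  obtain ⟨b, hb, h⟩ := h
  refine ⟨b, hb, ?_⟩
  have := hG.rev h
  have hbc : b ≠ c := fun e => hc (e ▸ hb)
  have hab : a ≠ b := fun e => ha (e ▸ hb)
  rwa [← hG.symm hbc, ← hG.symm hab] at this

theorem IsGeneric.blk_flip_iff (hG : IsGeneric inv F ℓ L r) {B : Finset M} {a c : M} (ha : a ∉ B)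
    (hc : c ∉ B) {R : Γ} : Blk F r B c a (inv R) ↔ Blk F r B a c R :=
  ⟨fun h => by simpa only [hG.invol R] using hG.blk_flip hc ha h, hG.blk_flip ha hc⟩

theorem IsChooser.flip (hG : IsGeneric inv F ℓ L r) {col : Finset M → M → M → Γ}
    (hcol : IsChooser inv F ℓ r col) : IsChooser inv F ℓ r (flipCol inv col) where
  isSol ha hc := hG.isSol_inv.2 (hcol.isSol hc ha)
  not_blk ha hc := fun h => hcol.not_blk hc ha ((hG.blk_flip_iff hc ha).1 h)
  congr ha hc ha' hc' h := by
    refine congrArg inv (hcol.congr hc ha hc' ha' fun R hR => ?_)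
    rw [← hG.blk_flip_iff hc ha, ← hG.blk_flip_iff hc' ha']
    exact h _ (hG.isSol_inv.2 hR)

theorem IndCol.flip (hG : IsGeneric inv F ℓ L r) {col : Finset M → M → M → Γ} {A B C : Finset M}
    (h : IndCol r col A B C) : IndCol r (flipCol inv col) C B A := by
  intro c hc hcB a ha haB
  obtain ⟨hne, he⟩ := h a ha haB c hc hcB
  exact ⟨hne.symm, by rw [hG.symm hne, he]; rfl⟩

theorem indCol_flip_iff (hG : IsGeneric inv F ℓ L r) {col : Finset M → M → M → Γ}
    {A B C : Finset M} : IndCol r (flipCol inv col) C B A ↔ IndCol r col A B C :=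
  ⟨fun h => by simpa only [flipCol_flipCol hG.invol] using h.flip hG, fun h => h.flip hG⟩

section Chooser

variable {col : Finset M → M → M → Γ}

/-- Enlarging the base by points that are joined to `a` or to `c` by an edge coloured from `ℓ` does
not change the choice, as no forbidden triangle has two such edges. -/
theorem IsChooser.base_eq (hG : IsGeneric inv F ℓ L r) (hcol : IsChooser inv F ℓ r col)
    {B B' : Finset M} {a c : M} (ha : a ∉ B') (hc : c ∉ B') (hB : B ⊆ B')
    (h : ∀ b ∈ B', b ∉ B → IsSol inv ℓ (r a b) ∨ IsSol inv ℓ (r b c)) :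
    col B' a c = col B a c := by
  refine hcol.congr ha hc (fun h => ha (hB h)) (fun h => hc (hB h)) fun R hR => ⟨?_, ?_⟩
  · rintro ⟨b, hb, hF⟩
    refine ⟨b, ?_, hF⟩
    by_contra hbB
    rcases h b hb hbB with h | h
    · exact hG.two hF ⟨h, hR⟩
    · exact hG.two_right hF hR h
  · rintro ⟨b, hb, hF⟩
    exact ⟨b, hB hb, hF⟩

theorem IndCol.isSol (hcol : IsChooser inv F ℓ r col) {A B C : Finset M} (h : IndCol r col A B C)
    {a c : M} (ha : a ∈ A) (haB : a ∉ B) (hc : c ∈ C) (hcB : c ∉ B) : IsSol inv ℓ (r a c) := by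
  rw [(h a ha haB c hc hcB).2]
  exact hcol.isSol haB hcB

theorem IndCol.mono {A A' B C C' : Finset M} (h : IndCol r col A B C) (hA : A' ⊆ A) (hC : C' ⊆ C) :
    IndCol r col A' B C' := fun a ha haB c hc hcB => h a (hA ha) haB c (hC hc) hcB

theorem IndCol.base_union (hG : IsGeneric inv F ℓ L r) (hcol : IsChooser inv F ℓ r col)
    {A B C D : Finset M} (h : IndCol r col A B (C ∪ D)) : IndCol r col A (B ∪ C) D := by
  intro a ha haB d hd hdB
  have haB' : a ∉ B := fun h => haB (Finset.mem_union_left _ h)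
  have hdB' : d ∉ B := fun h => hdB (Finset.mem_union_left _ h)
  obtain ⟨hne, he⟩ := h a ha haB' d (Finset.mem_union_right _ hd) hdB'
  refine ⟨hne, he.trans (hcol.base_eq hG haB hdB Finset.subset_union_left fun b hb hbB => ?_).symm⟩
  exact Or.inl (h.isSol hcol ha haB'
    (Finset.mem_union_left _ ((Finset.mem_union.1 hb).resolve_left hbB)) hbB)

theorem IndCol.trans (hG : IsGeneric inv F ℓ L r) (hcol : IsChooser inv F ℓ r col)
    {A B C D : Finset M} (h₁ : IndCol r col A B C) (h₂ : IndCol r col A (B ∪ C) D) :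
    IndCol r col A B D := by
  intro a ha haB d hd hdB
  by_cases hdC : d ∈ C
  · exact h₁ a ha haB d hdC hdB
  have haC : a ∉ C := fun h => (h₁ a ha haB a h haB).1 rfl
  have haBC : a ∉ B ∪ C := by simp [haB, haC]
  have hdBC : d ∉ B ∪ C := by simp [hdB, hdC]
  obtain ⟨hne, he⟩ := h₂ a ha haBC d hd hdBC
  refine ⟨hne, he.trans (hcol.base_eq hG haBC hdBC Finset.subset_union_left fun b hb hbB => ?_)⟩
  exact Or.inl (h₁.isSol hcol ha haB ((Finset.mem_union.1 hb).resolve_left hbB) hbB)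

theorem IsChooser.apply_eq (hG : IsGeneric inv F ℓ L r) (hcol : IsChooser inv F ℓ r col)
    (g : M ≃[L] M) {B : Finset M} {a c : M} (ha : a ∉ B) (hc : c ∉ B) :
    col (B.image g) (g a) (g c) = col B a c := by
  have hmem : ∀ {x}, x ∉ B → g x ∉ B.image g := fun hx h => by
    rw [mem_image_aut, aut_inv_apply_self] at h
    exact hx h
  refine hcol.congr (hmem ha) (hmem hc) ha hc fun R _ => ?_
  simp only [Blk, Finset.mem_image, exists_exists_and_eq_and, hG.aut]

theorem IndCol.image (hG : IsGeneric inv F ℓ L r) (hcol : IsChooser inv F ℓ r col)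
    (g : M ≃[L] M) {A B C : Finset M} (h : IndCol r col A B C) :
    IndCol r col (A.image g) (B.image g) (C.image g) := by
  intro a ha haB c hc hcB
  obtain ⟨a, ha', rfl⟩ := Finset.mem_image.1 ha
  obtain ⟨c, hc', rfl⟩ := Finset.mem_image.1 hc
  have haB' : a ∉ B := fun h => haB (Finset.mem_image_of_mem _ h)
  have hcB' : c ∉ B := fun h => hcB (Finset.mem_image_of_mem _ h)
  obtain ⟨hne, he⟩ := h a ha' haB' c hc' hcB'
  exact ⟨fun h => hne (g.injective h), by rw [hG.aut, he, hcol.apply_eq hG g haB' hcB']⟩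

theorem exists_indCol_left (hG : IsGeneric inv F ℓ L r) (hcol : IsChooser inv F ℓ r col)
    (A B C : Finset M) :
    ∃ σ : M ≃[L] M, (∀ b ∈ B, σ b = b) ∧ IndCol r col (A.image σ) B C := by
  induction A using Finset.induction_on with
  | empty => exact ⟨1, fun _ _ => rfl, fun a ha => by simp at ha⟩
  | insert a A haA ih =>
    obtain ⟨σ, hσ, hi⟩ := ih
    by_cases haB : a ∈ B
    · refine ⟨σ, hσ, fun x hx hxB => hi x ?_ hxB⟩
      rw [Finset.image_insert, Finset.mem_insert] at hx
      refine hx.resolve_left fun h => hxB ?_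
      rwa [h, hσ a haB]
    have hσaB : σ a ∉ B := fun h => haB (by
      have := hσ _ h
      rw [aut_inj] at this
      rwa [this] at h)
    obtain ⟨τ, hτ, hτY, hτC, hτr⟩ := hG.exists_point (Y := B ∪ A.image σ) (a := σ a)
      (by
        rw [Finset.mem_union, not_or]
        refine ⟨hσaB, fun h => haA ?_⟩
        rwa [mem_image_aut, aut_inv_apply_self] at h) C (fun x => col B (σ a) x)
      (fun x _ y _ hxY hyY _ hF => hG.two hF
        ⟨hcol.isSol hσaB fun h => hxY (Finset.mem_union_left _ h),
          hcol.isSol hσaB fun h => hyY (Finset.mem_union_left _ h)⟩) (by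
        intro y hy x hx hxY hF
        have hxB : x ∉ B := fun h => hxY (Finset.mem_union_left _ h)
        by_cases hyB : y ∈ B
        · exact hcol.not_blk hσaB hxB ⟨y, hyB, hF⟩
        · exact hG.two_right hF (hcol.isSol hσaB hxB)
            (hi.isSol hcol ((Finset.mem_union.1 hy).resolve_left hyB) hyB hx hxB))
    have hτB : ∀ b ∈ B, τ b = b := fun b hb => hτ b (Finset.mem_union_left _ hb)
    refine ⟨τ * σ, fun b hb => by rw [aut_mul_apply, hσ b hb, hτB b hb], ?_⟩
    intro x hx hxB c hc hcB
    rw [image_mul, Finset.image_insert, Finset.image_insert, Finset.mem_insert] at hx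
    rw [image_eq_self fun y hy => hτ y (Finset.mem_union_right _ hy)] at hx
    rcases hx with rfl | hx
    · have hcY : c ∉ B ∪ A.image σ := by
        rw [Finset.mem_union, not_or]
        exact ⟨hcB, fun h => (hi c h hcB c hc hcB).1 rfl⟩
      refine ⟨fun h => hτC (h ▸ hc), ?_⟩
      rw [hτr c hc hcY]
      refine hcol.congr hσaB hcB hxB hcB fun R _ => ?_
      refine exists_congr fun b => and_congr_right fun hb => ?_
      conv_rhs => rw [← hτB b hb, hG.aut, hτB b hb]
    · exact hi x hx hxB c hc hcB

theorem exists_indCol_right (hG : IsGeneric inv F ℓ L r) (hcol : IsChooser inv F ℓ r col)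
    (A B C : Finset M) :
    ∃ σ : M ≃[L] M, (∀ b ∈ B, σ b = b) ∧ IndCol r col C B (A.image σ) := by
  obtain ⟨σ, hσ, h⟩ := exists_indCol_left hG (hcol.flip hG) A B C
  exact ⟨σ, hσ, (indCol_flip_iff hG).1 h⟩

theorem IndCol.stationary (hG : IsGeneric inv F ℓ L r) (hcol : IsChooser inv F ℓ r col)
    {A B C : Finset M} {σ : M ≃[L] M} (hσ : ∀ b ∈ B, σ b = b) (h₁ : IndCol r col A B C)
    (h₂ : IndCol r col (A.image σ) B C) :
    ∃ τ : M ≃[L] M, (∀ b ∈ B ∪ C, τ b = b) ∧ ∀ a ∈ A, τ a = σ a := by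
  have hσB : ∀ {a}, a ∉ B → σ a ∉ B := fun {a} ha h => ha (by
    have := hσ _ h
    rw [aut_inj] at this
    rwa [this] at h)
  have hmix : ∀ a ∈ A, ∀ c ∈ B ∪ C, a ≠ c → c ∉ A → σ a ≠ c ∧ r (σ a) c = r a c := by
    intro a ha c hc hac hcA
    by_cases hcB : c ∈ B
    · have : σ a ≠ σ c := fun h => hac (σ.injective h)
      rw [hσ c hcB] at this
      refine ⟨this, ?_⟩
      conv_lhs => rw [← hσ c hcB, hG.aut]
    have hcC := (Finset.mem_union.1 hc).resolve_left hcB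
    by_cases haB : a ∈ B
    · rw [hσ a haB]; exact ⟨hac, rfl⟩
    obtain ⟨hne, he⟩ := h₂ (σ a) (Finset.mem_image_of_mem _ ha) (hσB haB) c hcC hcB
    refine ⟨hne, ?_⟩
    rw [he, (h₁ a ha haB c hcC hcB).2]
    refine hcol.congr (hσB haB) hcB haB hcB fun R _ => ?_
    refine exists_congr fun b => and_congr_right fun hb => ?_
    conv_lhs => rw [← hσ b hb, hG.aut, hσ b hb]
  obtain ⟨τ, hτ⟩ := hG.hom (A ∪ (B ∪ C)) (fun x => if x ∈ A then σ x else x) (by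
      intro x hx y hy hxy
      by_contra hne
      rw [Finset.mem_coe, Finset.mem_union] at hx hy
      by_cases hxA : x ∈ A <;> by_cases hyA : y ∈ A <;>
        simp only [hxA, hyA, if_true, if_false] at hxy
      · exact hne (σ.injective hxy)
      · exact (hmix x hxA y (hy.resolve_left hyA) hne hyA).1 hxy
      · exact (hmix y hyA x (hx.resolve_left hxA) (Ne.symm hne) hxA).1 hxy.symm
      · exact hne hxy) (by
      intro x hx y hy hxy
      rw [Finset.mem_union] at hx hy
      by_cases hxA : x ∈ A <;> by_cases hyA : y ∈ A <;>
        simp only [hxA, hyA, if_true, if_false]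
      · exact hG.aut σ x y
      · exact (hmix x hxA y (hy.resolve_left hyA) hxy hyA).2
      · obtain ⟨hne, he⟩ := hmix y hyA x (hx.resolve_left hxA) hxy.symm hxA
        rw [hG.symm hne, he, ← hG.symm hxy.symm])
  refine ⟨τ, fun b hb => ?_, fun a ha => ?_⟩
  · rw [hτ b (Finset.mem_union_right _ hb)]
    split_ifs with hbA
    · rcases Finset.mem_union.1 hb with hbB | hbC
      · exact hσ b hbB
      · by_cases hbB : b ∈ B
        · exact hσ b hbB
        · exact absurd rfl (h₁ b hbA hbB b hbC hbB).1
    · rfl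
  · rw [hτ a (Finset.mem_union_left _ ha), if_pos ha]

end Chooser

/-- Being a prioritised amalgam is a stationary weak independence relation. -/
theorem IsGeneric.isStationaryWeakIndependence (hG : IsGeneric inv F ℓ L r) :
    IsStationaryWeakIndependence L M (IndCol r (prio F ℓ r)) := by
  have hp := hG.isChooser_prio
  have hmem : ∀ {n} {B : Finset M} {a a' : Fin n → M}, SameType L B a a' →
      ∃ σ : M ≃[L] M, (∀ b ∈ B, σ b = b) ∧ a' = (fun i => σ (a i)) := by
    rintro n B a a' ⟨σ, hσ, h⟩
    exact ⟨σ, hσ, funext fun i => (h i).symm⟩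
  refine ⟨?_, ?_, ?_, ?_, ?_, ?_, ?_, ?_, ?_⟩
  · intro g A B C h
    convert h.image hG hp g
  · intro A B C D h
    have h' : IndCol r (prio F ℓ r) A B (C ∪ D) := by convert h
    refine ⟨h'.mono subset_rfl Finset.subset_union_left, ?_⟩
    convert h'.base_union hG hp
  · intro A B C D h
    have h' : IndCol r (prio F ℓ r) (A ∪ D) B C := by convert h
    refine ⟨h'.mono Finset.subset_union_left subset_rfl, ?_⟩
    have := (indCol_flip_iff hG).1 ((h'.flip hG).base_union hG (hp.flip hG))
    rw [Finset.union_comm] at this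
    convert this
  · intro A B C D h₁ h₂
    exact h₁.trans hG hp (by convert h₂)
  · intro A B C D h₁ h₂
    refine (indCol_flip_iff hG).1 ((h₁.flip hG).trans hG (hp.flip hG) (D := D) ?_)
    rw [Finset.union_comm]
    refine IndCol.flip hG ?_
    convert h₂
  · intro B C n p
    obtain ⟨σ, hσ, h⟩ := exists_indCol_left hG hp (entries p) B C
    exact ⟨fun i => σ (p i), ⟨σ, hσ, fun _ => rfl⟩, by rwa [entries_comp]⟩
  · intro B C n p
    obtain ⟨σ, hσ, h⟩ := exists_indCol_right hG hp (entries p) B C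
    exact ⟨fun i => σ (p i), ⟨σ, hσ, fun _ => rfl⟩, by rwa [entries_comp]⟩
  · intro B C n a a' h h₁ h₂
    obtain ⟨σ, hσ, rfl⟩ := hmem h
    rw [entries_comp] at h₂
    obtain ⟨τ, hτ, hτa⟩ := h₁.stationary hG hp hσ h₂
    exact ⟨τ, fun b hb => hτ b (by convert hb), fun i => hτa _ (mem_entries.2 ⟨i, rfl⟩)⟩
  · intro B C n a a' h h₁ h₂
    obtain ⟨σ, hσ, rfl⟩ := hmem h
    rw [entries_comp] at h₂
    obtain ⟨τ, hτ, hτa⟩ := (h₁.flip hG).stationary hG (hp.flip hG) hσ (h₂.flip hG)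
    exact ⟨τ, fun b hb => hτ b (by convert hb), fun i => hτa _ (mem_entries.2 ⟨i, rfl⟩)⟩

end Generic

/-! ### Generic commutators -/

section Commutators

variable {Γ : Type u} {inv : Γ → Γ} {F : Γ → Γ → Γ → Prop} {ℓ : List Γ}
  {L : FirstOrder.Language.{0, u}} {M : Type w} [L.Structure M] {r : M → M → Γ}

open Classical

/-- If `w` is moved and `t` is joined to `w` by a colour that is not a solution, then the type of
`t` over any finite set `Y ∋ w` is realised by a moved point: a realisation joined to `g w` by a
solution cannot be fixed. -/
theorem IsGeneric.exists_moved_of_notMem (hG : IsGeneric inv F ℓ L r) {g : M ≃[L] M}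
    {Y : Finset M} {w t : M} (hw : w ∈ Y) (hgw : g w ∉ Y) (ht : t ∉ Y) (htw : r t w ∉ ℓ)
    (C : Finset M) :
    ∃ σ : M ≃[L] M, (∀ y ∈ Y, σ y = y) ∧ g (σ t) ≠ σ t ∧ σ t ∉ Y ∧ σ t ∉ C ∧
      ∀ c ∈ C, c ∉ Y → IsSol inv ℓ (r (σ t) c) := by
  obtain ⟨σ, hσ, hi⟩ := exists_indCol_left hG hG.isChooser_prio {t} Y (insert (g w) C)
  have hσt : σ t ∈ ({t} : Finset M).image σ := by simp
  have hσY : σ t ∉ Y := fun h => ht (by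
    have := hσ _ h
    rw [aut_inj] at this
    rwa [this] at h)
  refine ⟨σ, hσ, fun hfix => htw ?_, hσY, fun hC => ?_, fun c hc hcY => ?_⟩
  · have h := (hi _ hσt hσY (g w) (Finset.mem_insert_self _ _) hgw).2
    have h' := hG.prio_mem_list hσY hgw
    rw [← h, ← hfix, hG.aut] at h'
    rwa [← hσ w hw, hG.aut] at h'
  · exact (hi _ hσt hσY _ (Finset.mem_insert_of_mem hC) hσY).1 rfl
  · exact hi.isSol hG.isChooser_prio hσt hσY (Finset.mem_insert_of_mem hc) hcY

/-- Every one-point type over a finite set `X` has a realisation moved by a given non-trivial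
automorphism `g`. A moved point is transported to the type along a path of edges whose colour is
not a solution; the first steps serve to reach a point that is joined to `X` by solutions only. -/
theorem IsGeneric.exists_moved_point (hG : IsGeneric inv F ℓ L r) {g : M ≃[L] M} (hg : g ≠ 1)
    {X : Finset M} {a : M} (ha : a ∉ X) (C : Finset M) :
    ∃ σ : M ≃[L] M, (∀ x ∈ X, σ x = x) ∧ g (σ a) ≠ σ a ∧ σ a ∉ C := by
  obtain ⟨Q, hQ⟩ := hG.exists_notMem
  have hstep : ∀ (w : M), g w ≠ w → ∀ C : Finset M, ∃ w', g w' ≠ w' ∧ w' ∉ C ∧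
      ∀ c ∈ C, c ≠ w → IsSol inv ℓ (r w' c) := by
    intro w hw C
    obtain ⟨t, ht, htw⟩ := hG.ext {w} (fun _ => Q) (fun x hx y hy hxy => by
      rw [Finset.mem_singleton] at hx hy
      exact absurd (hx.trans hy.symm) hxy)
    obtain ⟨σ, -, h₁, -, h₃, h₄⟩ := hG.exists_moved_of_notMem (Finset.mem_singleton_self w)
      (by rwa [Finset.mem_singleton]) ht (by rwa [htw w (Finset.mem_singleton_self w)]) C
    exact ⟨σ t, h₁, h₃, fun c hc hcw => h₄ c hc (by rwa [Finset.mem_singleton])⟩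
  obtain ⟨w₀, hw₀⟩ : ∃ w, g w ≠ w := by
    by_contra! h
    exact hg (aut_ext h)
  obtain ⟨w₁, hw₁, hw₁X, -⟩ := hstep w₀ hw₀ X
  obtain ⟨w, hw, hwX, hwsol⟩ := hstep w₁ hw₁ (X ∪ X.image (g⁻¹ : M ≃[L] M))
  rw [Finset.mem_union, mem_image_inv, not_or] at hwX
  replace hwsol : ∀ x ∈ X, IsSol inv ℓ (r w x) := fun x hx =>
    hwsol x (Finset.mem_union_left _ hx) fun h => hw₁X (h ▸ hx)
  -- a point `z₀` with the colour `Q` from `a`, and joined to `X` by solutions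
  obtain ⟨z₀, hz₀a, hz₀Q, hz₀X⟩ : ∃ z₀, z₀ ≠ a ∧ r a z₀ = Q ∧ ∀ x ∈ X, z₀ ≠ x ∧
      IsSol inv ℓ (r z₀ x) := by
    obtain ⟨t, ht, hta⟩ := hG.ext {a} (fun _ => inv Q) (fun x hx y hy hxy => by
      rw [Finset.mem_singleton] at hx hy
      exact absurd (hx.trans hy.symm) hxy)
    replace hta := hta a (Finset.mem_singleton_self a)
    rw [Finset.mem_singleton] at ht
    obtain ⟨σ, hσ, hi⟩ := exists_indCol_left hG hG.isChooser_prio {t} {a} X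
    have hσa : σ a = a := hσ a (Finset.mem_singleton_self a)
    have hne : σ t ≠ a := fun h => ht (σ.injective (h.trans hσa.symm))
    have hσt : σ t ∈ ({t} : Finset M).image σ := by simp
    refine ⟨σ t, hne, ?_, fun x hx => ?_⟩
    · rw [hG.symm hne, ← hG.invol Q, ← hta]
      conv_lhs => rw [← hσa, hG.aut]
    · have hxa : x ∉ ({a} : Finset M) := by
        rw [Finset.mem_singleton]; rintro rfl; exact ha hx
      have hne' : σ t ∉ ({a} : Finset M) := by rwa [Finset.mem_singleton]
      exact ⟨(hi _ hσt hne' x hx hxa).1, hi.isSol hG.isChooser_prio hσt hne' hx hxa⟩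
  obtain ⟨τ, hτ, hτX, hτw, hτr⟩ := hG.exists_point (Y := X) (a := z₀)
    (fun h => (hz₀X _ h).1 rfl) {w} (fun _ => Q)
    (fun x hx y hy _ _ hxy => by
      rw [Finset.mem_singleton] at hx hy
      exact absurd (hx.trans hy.symm) hxy)
    (fun y hy x hx _ hF => by
      rw [Finset.mem_singleton] at hx
      subst hx
      refine hG.two_left hF (hz₀X y hy).2 ?_
      rw [hG.isSol_symm (a := x) (b := y) (fun h => hwX.1 (h ▸ hy))]
      exact hwsol y hy)
  rw [Finset.mem_singleton] at hτw
  obtain ⟨σ₁, hσ₁, hm₁, hY₁, hC₁, -⟩ := hG.exists_moved_of_notMem (g := g) (Y := insert w X)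
    (w := w) (t := τ z₀) (Finset.mem_insert_self _ _)
    (by rw [Finset.mem_insert, not_or]; exact ⟨hw, hwX.2⟩)
    (by rw [Finset.mem_insert, not_or]; exact ⟨hτw, hτX⟩)
    (by rwa [hτr w (Finset.mem_singleton_self w) hwX.1]) (X.image (g⁻¹ : M ≃[L] M))
  rw [mem_image_inv] at hC₁
  have hX₁ : ∀ x ∈ X, σ₁ (τ x) = x := fun x hx => by
    rw [hτ x hx, hσ₁ x (Finset.mem_insert_of_mem hx)]
  obtain ⟨σ₂, hσ₂, hm₂, -, hC₂, -⟩ := hG.exists_moved_of_notMem (g := g)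
    (Y := insert (σ₁ (τ z₀)) X) (w := σ₁ (τ z₀)) (t := σ₁ (τ a)) (Finset.mem_insert_self _ _)
    (by rw [Finset.mem_insert, not_or]; exact ⟨hm₁, hC₁⟩)
    (by
      rw [Finset.mem_insert, not_or, aut_inj, aut_inj]
      refine ⟨hz₀a.symm, fun h => ha ?_⟩
      have := hX₁ _ h
      rw [aut_inj, aut_inj] at this
      rwa [this] at h)
    (by rwa [hG.aut, hG.aut, hz₀Q]) C
  exact ⟨σ₂ * σ₁ * τ, fun x hx => by
    rw [aut_mul_apply, aut_mul_apply, hX₁ x hx, hσ₂ x (Finset.mem_insert_of_mem hx)], hm₂, hC₂⟩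

/-- The version for tuples: the realisation `σ A` is disjoint from its image under `g`. -/
theorem IsGeneric.exists_moved_set (hG : IsGeneric inv F ℓ L r) {g : M ≃[L] M} (hg : g ≠ 1)
    {X A : Finset M} (hA : ∀ a ∈ A, a ∉ X) (C : Finset M) :
    ∃ σ : M ≃[L] M, (∀ x ∈ X, σ x = x) ∧ ∀ a ∈ A, σ a ∉ C ∧ ∀ a' ∈ A, g (σ a) ≠ σ a' := by
  induction A using Finset.induction_on with
  | empty => exact ⟨1, fun _ _ => rfl, fun a ha => by simp at ha⟩
  | insert a A haA ih =>
    obtain ⟨σ, hσ, h⟩ := ih fun a ha => hA a (Finset.mem_insert_of_mem ha)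
    have haX := hA a (Finset.mem_insert_self _ _)
    obtain ⟨τ, hτ, hm, hC⟩ := hG.exists_moved_point hg (X := X ∪ A.image σ) (a := σ a)
      (by
        rw [Finset.mem_union, not_or, mem_image_aut, aut_inv_apply_self]
        refine ⟨fun h => haX ?_, haA⟩
        have := hσ _ h
        rw [aut_inj] at this
        rwa [this] at h)
      (C ∪ ((A.image σ).image g ∪ (A.image σ).image (g⁻¹ : M ≃[L] M)))
    simp only [Finset.mem_union, not_or] at hC
    have hτA : ∀ a ∈ A, τ (σ a) = σ a := fun a ha =>
      hτ _ (Finset.mem_union_right _ (Finset.mem_image_of_mem _ ha))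
    refine ⟨τ * σ, fun x hx => by rw [aut_mul_apply, hσ x hx, hτ x (Finset.mem_union_left _ hx)],
      fun b hb => ?_⟩
    rw [Finset.mem_insert] at hb
    rcases hb with rfl | hb
    · refine ⟨hC.1, fun b' hb' => ?_⟩
      rw [Finset.mem_insert] at hb'
      rcases hb' with rfl | hb'
      · exact hm
      · rw [aut_mul_apply, aut_mul_apply, hτA b' hb']
        intro h
        refine hC.2.2 (mem_image_inv.2 ?_)
        rw [h]
        exact Finset.mem_image_of_mem _ hb'
    · rw [aut_mul_apply, hτA b hb]
      refine ⟨(h b hb).1, fun b' hb' => ?_⟩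
      rw [Finset.mem_insert] at hb'
      rcases hb' with rfl | hb'
      · intro h
        refine hC.2.1 ?_
        rw [aut_mul_apply] at h
        rw [← h]
        exact Finset.mem_image_of_mem _ (Finset.mem_image_of_mem _ hb)
      · rw [aut_mul_apply, hτA b' hb']
        exact (h b hb).2 b' hb'

/-- Every type over a finite set `X`, of a tuple outside `X`, has a realisation all of whose points
are joined to all points of its image under `v` by edges coloured from `ℓ`. -/
def MovesSol (inv : Γ → Γ) (ℓ : List Γ) (r : M → M → Γ) (v : M ≃[L] M) : Prop :=
  ∀ X A : Finset M, (∀ a ∈ A, a ∉ X) → ∃ σ : M ≃[L] M, (∀ x ∈ X, σ x = x) ∧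
    ∀ a ∈ A, ∀ a' ∈ A, σ a ≠ v (σ a') ∧ IsSol inv ℓ (r (σ a) (v (σ a')))

theorem commutator_apply (g h : M ≃[L] M) (x : M) :
    commutator g h x = g⁻¹ (h⁻¹ (g (h x))) := rfl

theorem commutator_apply_eq_left {h h' g : M ≃[L] M} {x : M} (h₁ : h' (g x) = h (g x))
    (h₂ : h' (commutator h g x) = h (commutator h g x)) :
    commutator h' g x = commutator h g x := by
  rw [commutator_apply h', aut_inv_eq_iff, h₂, h₁, commutator_apply, aut_apply_inv_self]

theorem commutator_apply_eq_right {v k k' : M ≃[L] M} {x : M} (h₁ : k' x = k x)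
    (h₂ : k' (k⁻¹ (v (k x))) = v (k x)) :
    commutator v k' x = commutator v k x := by
  rw [commutator_apply, commutator_apply, h₁]
  congr 1
  rw [aut_inv_eq_iff, h₂]

theorem aut_apply_notMem {σ : M ≃[L] M} {X : Finset M} (hσ : ∀ x ∈ X, σ x = x) {a : M}
    (ha : a ∉ X) : σ a ∉ X := fun h => ha (by
  have := hσ _ h
  rw [aut_inj] at this
  rwa [this] at h)

/-- For a generic `h`, the commutator `[h, g] = h⁻¹ g⁻¹ h g` moves almost all tuples along edges
coloured from `ℓ`: the four factors lead from `a` through new points, and the last one can be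
chosen independent from `a`. -/
theorem IsGeneric.exists_commutator_movesSol [Countable M] (hG : IsGeneric inv F ℓ L r)
    {g : M ≃[L] M} (hg : g ≠ 1) : ∃ h : M ≃[L] M, MovesSol inv ℓ r (commutator h g) := by
  obtain ⟨h, hh⟩ := exists_aut_of_dense (L := L) (M := M) (ι := Finset M × Finset M)
    (fun p h => (∀ a ∈ p.2, a ∉ p.1) → ∃ σ : M ≃[L] M, (∀ x ∈ p.1, σ x = x) ∧
      ∀ a ∈ p.2, ∀ a' ∈ p.2, σ a ≠ commutator h g (σ a') ∧
        IsSol inv ℓ (r (σ a) (commutator h g (σ a')))) (by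
    rintro ⟨X, A⟩ h₀ D
    by_cases hA : ∀ a ∈ A, a ∉ X
    swap
    · exact ⟨h₀, fun _ _ => rfl, ∅, fun _ _ h => absurd h hA⟩
    set Z := D ∪ X with hZ
    obtain ⟨σ, hσ, hσA⟩ := hG.exists_moved_set hg hA (Z ∪ Z.image (g⁻¹ : M ≃[L] M))
    have h₁ : ∀ a ∈ A, σ a ∉ Z := fun a ha h => (hσA a ha).1 (Finset.mem_union_left _ h)
    have h₂ : ∀ a ∈ A, g (σ a) ∉ Z := fun a ha h =>
      (hσA a ha).1 (Finset.mem_union_right _ (mem_image_inv.2 h))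
    obtain ⟨σ', hσ', hσA'⟩ := hG.exists_moved_set hg (X := Z.image h₀)
      (A := ((A.image σ).image g).image h₀) (by
        intro c hc hcZ
        rw [← image_mul, ← image_mul] at hc
        obtain ⟨a, ha, rfl⟩ := Finset.mem_image.1 hc
        rw [mem_image_aut, aut_mul_apply, aut_mul_apply, aut_inv_apply_self] at hcZ
        exact h₂ a ha hcZ) ((Z.image h₀).image g)
    have hmem : ∀ a ∈ A, h₀ (g (σ a)) ∈ ((A.image σ).image g).image h₀ := fun a ha =>
      Finset.mem_image_of_mem _ (Finset.mem_image_of_mem _ (Finset.mem_image_of_mem _ ha))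
    obtain ⟨h', hh'⟩ : ∃ h', h' = σ' * h₀ := ⟨_, rfl⟩
    have hh'Z : ∀ z ∈ Z, h' z = h₀ z := fun z hz => by
      rw [hh', aut_mul_apply, hσ' _ (Finset.mem_image_of_mem _ hz)]
    have h₃ : ∀ a ∈ A, commutator h' g (σ a) ∉ Z ∪ (A.image σ).image g := by
      intro a ha h
      rw [Finset.mem_union] at h
      rcases h with h | h
      · refine (hσA' _ (hmem a ha)).1 ?_
        rw [mem_image_aut, mem_image_aut]
        have := hh'Z _ h
        rw [commutator_apply, aut_apply_inv_self] at this
        change h₀⁻¹ (g⁻¹ ((σ' * h₀) (g (σ a)))) ∈ Z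
        rw [← hh', aut_inv_eq_iff.2 this]
        exact h
      · rw [← image_mul] at h
        obtain ⟨a', ha', h⟩ := Finset.mem_image.1 h
        rw [commutator_apply, eq_comm, aut_inv_eq_iff, aut_inv_eq_iff, hh'] at h
        exact (hσA' _ (hmem a' ha')).2 _ (hmem a ha) h.symm
    obtain ⟨τ, hτ, hi⟩ := exists_indCol_right hG hG.isChooser_prio
      ((A.image σ).image (commutator h' g : M ≃[L] M)) (Z ∪ (A.image σ).image g) (A.image σ)
    obtain ⟨h'', hh''⟩ : ∃ h'', h'' = h' * τ⁻¹ := ⟨_, rfl⟩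
    have hfix : ∀ x ∈ Z ∪ (A.image σ).image g, h'' x = h' x := fun x hx => by
      rw [hh'', aut_mul_apply, aut_inv_eq_self (hτ x hx)]
    have hgA : ∀ a ∈ A, g (σ a) ∈ Z ∪ (A.image σ).image g := fun a ha =>
      Finset.mem_union_right _ (Finset.mem_image_of_mem _ (Finset.mem_image_of_mem _ ha))
    have hcomm : ∀ a ∈ A, commutator h'' g (σ a) = τ (commutator h' g (σ a)) := fun a ha => by
      rw [commutator_apply, hfix _ (hgA a ha), aut_inv_eq_iff, hh'', aut_mul_apply,
        aut_inv_apply_self, commutator_apply, aut_apply_inv_self]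
    refine ⟨h'', fun x hx => ?_, A.image (g * σ) ∪ A.image (commutator h'' g * σ : M ≃[L] M),
      fun k hk _ => ⟨σ, hσ, fun a ha a' ha' => ?_⟩⟩
    · rw [hfix x (Finset.mem_union_left _ (Finset.mem_union_left _ hx))]
      exact hh'Z x (Finset.mem_union_left _ hx)
    · have hka : commutator k g (σ a') = commutator h'' g (σ a') :=
        commutator_apply_eq_left
          (hk _ (Finset.mem_union_left _ (Finset.mem_image_of_mem (g * σ) ha')))
          (hk _ (Finset.mem_union_right _ (Finset.mem_image_of_mem (commutator h'' g * σ) ha')))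
      rw [hka, hcomm a' ha']
      have haZ : σ a ∉ Z ∪ (A.image σ).image g := by
        rw [Finset.mem_union, not_or]
        refine ⟨h₁ a ha, fun h => ?_⟩
        rw [← image_mul] at h
        obtain ⟨a'', ha'', h⟩ := Finset.mem_image.1 h
        exact (hσA a'' ha'').2 a ha h
      have hcZ : τ (commutator h' g (σ a')) ∉ Z ∪ (A.image σ).image g :=
        aut_apply_notMem hτ (h₃ a' ha')
      have hc : τ (commutator h' g (σ a')) ∈
          ((A.image σ).image (commutator h' g : M ≃[L] M)).image τ :=
        Finset.mem_image_of_mem _ (Finset.mem_image_of_mem _ (Finset.mem_image_of_mem _ ha'))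
      exact ⟨(hi _ (Finset.mem_image_of_mem _ ha) haZ _ hc hcZ).1,
        hi.isSol hG.isChooser_prio (Finset.mem_image_of_mem _ ha) haZ hc hcZ⟩)
  exact ⟨h, fun X A => hh (X, A)⟩

/-- The step of the construction of a generic `k`: a finite part of `k` is extended so that a given
type over `X` gets a realisation `σ A` that is independent from its image under `[v, k]`. -/
theorem IsGeneric.exists_extend_indCol (hG : IsGeneric inv F ℓ L r)
    {col : Finset M → M → M → Γ} (hcol : IsChooser inv F ℓ r col) {v : M ≃[L] M}
    (hv : MovesSol inv ℓ r v) (X A D : Finset M) (k₀ : M ≃[L] M) :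
    ∃ k : M ≃[L] M, (∀ x ∈ D, k x = k₀ x) ∧ ∃ σ : M ≃[L] M, (∀ x ∈ X, σ x = x) ∧
      IndCol r col (A.image σ) X ((A.image σ).image (commutator v k : M ≃[L] M)) := by
  set Z := D ∪ X ∪ X.image (k₀⁻¹ * v * k₀) with hZ
  have hXZ : X ⊆ Z := fun x hx => by simp [hZ, hx]
  set T := Z ∪ Z.image (v⁻¹ : M ≃[L] M) ∪ X.image v ∪ X.image (commutator v k₀ : M ≃[L] M) with hT
  -- a realisation of the type in general position
  obtain ⟨σ₁, hσ₁, hi₁⟩ := exists_indCol_left hG hcol A X T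
  set A₁ := (A.image σ₁).filter (· ∉ X) with hA₁
  have hA₁T : ∀ a ∈ A₁, a ∉ X ∪ T := fun a ha h => by
    rw [hA₁, Finset.mem_filter] at ha
    exact (hi₁ a ha.1 ha.2 a ((Finset.mem_union.1 h).resolve_left ha.2) ha.2).1 rfl
  obtain ⟨σ₂, hσ₂, hvA⟩ := hv (X ∪ T) A₁ hA₁T
  have hσ₂X : ∀ x ∈ X, σ₂ x = x := fun x hx => hσ₂ x (Finset.mem_union_left _ hx)
  set A₂ := (A.image σ₁).image σ₂ with hA₂
  have hi₂ : IndCol r col A₂ X T := by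
    have := hi₁.image hG hcol σ₂
    rwa [image_eq_self hσ₂X, image_eq_self fun x hx => hσ₂ x (Finset.mem_union_right _ hx)] at this
  set A' := A₁.image σ₂ with hA'
  have hA'mem : ∀ a ∈ A₂, a ∉ X → a ∈ A' := by
    intro a ha haX
    obtain ⟨a, ha', rfl⟩ := Finset.mem_image.1 ha
    refine Finset.mem_image_of_mem _ (Finset.mem_filter.2 ⟨ha', fun h => haX ?_⟩)
    rwa [hσ₂X a h]
  have hA'T : ∀ a ∈ A', a ∉ X ∪ T := by
    intro a ha
    obtain ⟨a, ha', rfl⟩ := Finset.mem_image.1 ha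
    exact aut_apply_notMem hσ₂ (hA₁T a ha')
  have hA'v : ∀ a ∈ A', ∀ a' ∈ A', a ≠ v a' := by
    intro a ha a' ha'
    obtain ⟨a, ha, rfl⟩ := Finset.mem_image.1 ha
    obtain ⟨a', ha', rfl⟩ := Finset.mem_image.1 ha'
    exact (hvA _ ‹_› _ ‹_›).1
  have hA'Z : ∀ a ∈ A', a ∉ Z := fun a ha h => hA'T a ha (by simp [hT, h])
  -- the image of the new points under `k`
  obtain ⟨σ₃, hσ₃, hi₃⟩ := exists_indCol_left hG hcol (A'.image k₀) (Z.image k₀)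
    ((Z.image k₀).image (v⁻¹ : M ≃[L] M))
  have h₃ : ∀ a ∈ A', σ₃ (k₀ a) ∉ Z.image k₀ := fun a ha => aut_apply_notMem hσ₃ fun h => by
    rw [mem_image_aut, aut_inv_apply_self] at h
    exact hA'Z a ha h
  obtain ⟨σ₄, hσ₄, hvB⟩ := hv (Z.image k₀ ∪ (Z.image k₀).image (v⁻¹ : M ≃[L] M))
    ((A'.image k₀).image σ₃) (by
      intro b hb hbY
      have hb' := hb
      rw [← image_mul] at hb'
      obtain ⟨a, ha, rfl⟩ := Finset.mem_image.1 hb'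
      have hb₃ := h₃ a ha
      exact (hi₃ _ hb hb₃ _ ((Finset.mem_union.1 hbY).resolve_left hb₃) hb₃).1 rfl)
  obtain ⟨k', hk'⟩ : ∃ k', k' = σ₄ * σ₃ * k₀ := ⟨_, rfl⟩
  have hk'Z : ∀ z ∈ Z, k' z = k₀ z := fun z hz => by
    rw [hk', aut_mul_apply, aut_mul_apply, hσ₃ _ (Finset.mem_image_of_mem _ hz),
      hσ₄ _ (Finset.mem_union_left _ (Finset.mem_image_of_mem _ hz))]
  have hmem : ∀ a ∈ A', σ₃ (k₀ a) ∈ (A'.image k₀).image σ₃ := fun a ha =>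
    Finset.mem_image_of_mem _ (Finset.mem_image_of_mem _ ha)
  have hk'v : ∀ a ∈ A', ∀ a' ∈ A', k' a ≠ v (k' a') ∧ IsSol inv ℓ (r (k' a) (v (k' a'))) := by
    intro a ha a' ha'
    rw [hk']
    exact hvB _ (hmem a ha) _ (hmem a' ha')
  have hvk' : ∀ a ∈ A', v (k' a) ∉ Z.image k₀ := by
    intro a ha h
    have hb := hmem a ha
    have hb₃ := h₃ a ha
    have h' : σ₄ (σ₃ (k₀ a)) ∈ (Z.image k₀).image (v⁻¹ : M ≃[L] M) := by
      rw [mem_image_inv]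
      rwa [hk'] at h
    have h'' : σ₃ (k₀ a) ∈ (Z.image k₀).image (v⁻¹ : M ≃[L] M) := by
      have := hσ₄ _ (Finset.mem_union_right _ h')
      rw [aut_inj] at this
      rwa [this] at h'
    exact (hi₃ _ hb hb₃ _ h'' hb₃).1 rfl
  -- the preimage under `k` of the images of the new points under `v k`
  have hd : ∀ a ∈ A', (k'⁻¹ * v * k') a ∉ Z ∪ A' := by
    intro a ha h
    rw [Finset.mem_union] at h
    rcases h with h | h
    · have := Finset.mem_image_of_mem k₀ h
      rw [← hk'Z _ h] at this
      rw [aut_mul_apply, aut_mul_apply, aut_apply_inv_self] at this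
      exact hvk' a ha this
    · refine (hk'v _ h a ha).1 ?_
      rw [aut_mul_apply, aut_mul_apply, aut_apply_inv_self]
  obtain ⟨τ, hτ, hi₅⟩ := exists_indCol_right hG hcol (A'.image (k'⁻¹ * v * k')) (Z ∪ A')
    (A'.image v ∪ X.image v)
  obtain ⟨k, hk⟩ : ∃ k, k = k' * τ⁻¹ := ⟨_, rfl⟩
  have hkfix : ∀ x ∈ Z ∪ A', k x = k' x := fun x hx => by
    rw [hk, aut_mul_apply, aut_inv_eq_self (hτ x hx)]
  have hkZ : ∀ z ∈ Z, k z = k₀ z := fun z hz => by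
    rw [hkfix z (Finset.mem_union_left _ hz), hk'Z z hz]
  have hkX : ∀ x ∈ X, commutator v k x = commutator v k₀ x := fun x hx =>
    commutator_apply_eq_right (hkZ x (hXZ hx)) (by
      have : k₀⁻¹ (v (k₀ x)) ∈ Z :=
        Finset.mem_union_right _ (Finset.mem_image_of_mem (k₀⁻¹ * v * k₀) hx)
      rw [hkZ _ this, aut_apply_inv_self])
  have hkA : ∀ a ∈ A', v (commutator v k a) = τ ((k'⁻¹ * v * k') a) := fun a ha => by
    rw [commutator_apply, aut_apply_inv_self, hkfix a (Finset.mem_union_right _ ha),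
      aut_inv_eq_iff, hk]
    simp only [aut_mul_apply, aut_inv_apply_self, aut_apply_inv_self]
  refine ⟨k, fun x hx => hkZ x (by simp [hZ, hx]), σ₂ * σ₁, fun x hx => ?_, ?_⟩
  · rw [aut_mul_apply, hσ₁ x hx, hσ₂X x hx]
  rw [image_mul, ← hA₂]
  intro a ha haX e he heX
  obtain ⟨y, hy, rfl⟩ := Finset.mem_image.1 he
  by_cases hyX : y ∈ X
  · refine hi₂ a ha haX _ ?_ heX
    rw [hkX y hyX]
    exact Finset.mem_union_right _ (Finset.mem_image_of_mem _ hyX)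
  have ha' := hA'mem a ha haX
  have hy' := hA'mem y hy hyX
  set d := τ ((k'⁻¹ * v * k') y) with hd'
  have hve : v (commutator v k y) = d := hkA y hy'
  have hdZ : d ∉ Z ∪ A' := aut_apply_notMem hτ (hd y hy')
  have hdmem : d ∈ (A'.image (k'⁻¹ * v * k')).image τ :=
    Finset.mem_image_of_mem _ (Finset.mem_image_of_mem _ hy')
  have hvaZ : v a ∉ Z ∪ A' := by
    rw [Finset.mem_union, not_or]
    refine ⟨fun h => hA'T a ha' ?_, fun h => hA'v _ h a ha' rfl⟩
    have := mem_image_inv.2 h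
    simp only [hT, Finset.mem_union]
    tauto
  have hva : v a ∈ A'.image v ∪ X.image v :=
    Finset.mem_union_left _ (Finset.mem_image_of_mem _ ha')
  obtain ⟨hne, hr⟩ := hi₅ _ hva hvaZ d hdmem hdZ
  have hvaX : v a ∉ X.image v := by rwa [mem_image_aut, aut_inv_apply_self]
  have hdX : d ∉ X.image v := by rwa [← hve, mem_image_aut, aut_inv_apply_self]
  -- only the points of `Z ∩ v X` can matter for the choice of the colour of `(v a, d)`
  have e₁ : col (Z ∪ A') (v a) d = col (Z ∩ X.image v) (v a) d := by
    refine hcol.base_eq hG hvaZ hdZ (fun x hx => Finset.mem_union_left _ (Finset.mem_inter.1 hx).1)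
      fun b hb hbn => ?_
    by_cases hbA : b ∈ A'
    · refine Or.inr ?_
      rw [hd', ← hτ b hb, hG.aut, aut_mul_apply, aut_mul_apply, ← hG.aut k', aut_apply_inv_self]
      exact (hk'v b hbA y hy').2
    · have hbZ := (Finset.mem_union.1 hb).resolve_right hbA
      refine Or.inl ?_
      rw [← hG.aut v⁻¹, aut_inv_apply_self]
      refine hi₂.isSol hcol ha haX ?_ fun h => hbn (Finset.mem_inter.2 ⟨hbZ, mem_image_aut.2 h⟩)
      have := Finset.mem_image_of_mem (v⁻¹ : M ≃[L] M) hbZ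
      simp only [hT, Finset.mem_union]
      tauto
  have e₂ : col (X.image v) (v a) d = col (Z ∩ X.image v) (v a) d := by
    refine hcol.base_eq hG hvaX hdX Finset.inter_subset_right fun b hb hbn => Or.inr ?_
    have hbZ : b ∉ Z := fun h => hbn (Finset.mem_inter.2 ⟨h, hb⟩)
    refine hi₅.isSol hcol (Finset.mem_union_right _ hb) ?_ hdmem hdZ
    rw [Finset.mem_union, not_or]
    refine ⟨hbZ, fun h => hA'T b h ?_⟩
    simp only [hT, Finset.mem_union]
    tauto
  refine ⟨fun h => hne (by rw [h, hve]), ?_⟩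
  rw [← hcol.apply_eq hG v haX heX, hve, e₂, ← e₁, ← hr, ← hve, hG.aut]

/-- For a generic `k`, the commutator `[v, k]` moves almost maximally on both sides. Each side is a
countable family of requirements on `k`, and the two correspond to the choices `prio` and its
flipped version. -/
theorem IsGeneric.exists_commutator_max [Countable M] (hG : IsGeneric inv F ℓ L r)
    {v : M ≃[L] M} (hv : MovesSol inv ℓ r v) :
    ∃ k : M ≃[L] M, MovesAlmostRMax (IndCol r (prio F ℓ r)) (commutator v k) ∧
      MovesAlmostLMax (IndCol r (prio F ℓ r)) (commutator v k) := by
  let c : Bool → Finset M → M → M → Γ := fun b =>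
    if b then prio F ℓ r else flipCol inv (prio F ℓ r)
  have hc : ∀ b, IsChooser inv F ℓ r (c b) := by
    rintro (_ | _)
    · exact hG.isChooser_prio.flip hG
    · exact hG.isChooser_prio
  obtain ⟨k, hk⟩ := exists_aut_of_dense (L := L) (M := M) (ι := (Finset M × Finset M) × Bool)
    (fun p k => ∃ σ : M ≃[L] M, (∀ x ∈ p.1.1, σ x = x) ∧
      IndCol r (c p.2) (p.1.2.image σ) p.1.1
        ((p.1.2.image σ).image (commutator v k : M ≃[L] M))) (by
    rintro ⟨⟨X, A⟩, b⟩ k₀ D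
    obtain ⟨k, hk, σ, hσ, hi⟩ := hG.exists_extend_indCol (hc b) hv X A D k₀
    refine ⟨k, hk, A.image σ ∪ (A.image σ).image (k⁻¹ * v * k), fun k₂ hk₂ => ⟨σ, hσ, ?_⟩⟩
    convert hi using 1
    refine Finset.image_congr fun y hy => commutator_apply_eq_right ?_ ?_
    · exact hk₂ y (Finset.mem_union_left _ hy)
    · have := hk₂ _ (Finset.mem_union_right _ (Finset.mem_image_of_mem (k⁻¹ * v * k) hy))
      simpa using this)
  refine ⟨k, fun X n p => ?_, fun X n p => ?_⟩
  · obtain ⟨σ, hσ, hi⟩ := hk ((X, entries p), true)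
    replace hi : IndCol r (prio F ℓ r) _ _ _ := hi
    refine ⟨fun i => σ (p i), ⟨σ, hσ, fun _ => rfl⟩, ?_⟩
    simpa only [← entries_comp] using hi
  · obtain ⟨σ, hσ, hi⟩ := hk ((X, entries p), false)
    replace hi := (indCol_flip_iff hG).1 hi
    refine ⟨fun i => σ (p i), ⟨σ, hσ, fun _ => rfl⟩, ?_⟩
    simpa only [← entries_comp] using hi

theorem IsGeneric.exists_commutators [Countable M] (hG : IsGeneric inv F ℓ L r)
    {g : M ≃[L] M} (hg : g ≠ 1) :
    ∃ h k : M ≃[L] M,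
      MovesAlmostRMax (IndCol r (prio F ℓ r)) (commutator (commutator h g) k) ∧
      MovesAlmostLMax (IndCol r (prio F ℓ r)) (commutator (commutator h g) k) := by
  obtain ⟨h, hh⟩ := hG.exists_commutator_movesSol hg
  obtain ⟨k, hk⟩ := hG.exists_commutator_max hh
  exact ⟨h, k, hk⟩

end Commutators

/-! ### Complete structures as edge colourings -/

section Colourings

universe v v'

open CategoryTheory

variable {Γ : Type u}

/-- The structure given by an edge colouring; the values on the diagonal are ignored. -/
def ofColouring {A : Type v} (r : A → A → Γ) : Bundled.{v} (colourLang Γ).Structure where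
  α := A
  str :=
    { funMap := fun f => Empty.elim f
      RelMap := fun {_} R => match R with
        | ColourRel.edge x => fun v => v 0 ≠ v 1 ∧ r (v 0) (v 1) = x }

theorem hasColour_ofColouring {A : Type v} {r : A → A → Γ} {x : Γ} {a b : A} :
    HasColour (A := ofColouring r) x a b ↔ a ≠ b ∧ r a b = x := Iff.rfl

/-- The colour of a pair in a complete structure; a junk value on the diagonal. -/
noncomputable def colour [Nonempty Γ] {A : Type v} [(colourLang Γ).Structure A] (a b : A) : Γ :=
  Classical.epsilon fun x => HasColour x a b

section Maps

variable {A : Type v} {B : Type v'} [(colourLang Γ).Structure A] [(colourLang Γ).Structure B]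

theorem hasColour_map (f : A ↪[colourLang Γ] B) {x : Γ} {a b : A} :
    HasColour x (f a) (f b) ↔ HasColour x a b := by
  have := f.map_rel (ColourRel.edge x : (colourLang Γ).Relations 2) ![a, b]
  rw [HasColour, HasColour, ← this]
  exact iff_of_eq (congrArg _ (funext fun i => by fin_cases i <;> rfl))

theorem colour_map [Nonempty Γ] (f : A ↪[colourLang Γ] B) (a b : A) :
    (colour (f a) (f b) : Γ) = colour a b := by
  simp only [colour, hasColour_map]

/-- Every relation of the language is a colour. -/
theorem relMap_iff {n : ℕ} (R : (colourLang Γ).Relations n) (v : Fin n → A) :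
    FirstOrder.Language.Structure.RelMap R v ↔
      ∃ (x : Γ) (h : n = 2), HasColour x (v (Fin.cast h.symm 0)) (v (Fin.cast h.symm 1)) ∧
        HEq R (ColourRel.edge x : (colourLang Γ).Relations 2) := by
  cases R with
  | edge x =>
    have hv : v = ![v 0, v 1] := funext fun i => by fin_cases i <;> rfl
    constructor
    · intro h
      refine ⟨x, rfl, ?_, HEq.rfl⟩
      rw [hv] at h
      exact h
    · rintro ⟨y, h₂, hy, h⟩
      have hxy : x = y := by
        have := eq_of_heq h
        injection this
      subst hxy
      rw [hv]
      exact hy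

/-- An injection that preserves and reflects colours is an embedding. -/
theorem exists_embedding (f : A → B) (hf : Function.Injective f)
    (h : ∀ (x : Γ) (a b : A), HasColour x (f a) (f b) ↔ HasColour x a b) :
    ∃ e : A ↪[colourLang Γ] B, ∀ a, e a = f a := by
  refine ⟨⟨⟨f, hf⟩, fun F => Empty.elim F, fun R v => ?_⟩, fun a => rfl⟩
  rw [relMap_iff, relMap_iff]
  exact exists_congr fun x => exists_congr fun _ => and_congr_left fun _ => h x _ _

end Maps

/-- An edge colouring is admissible if it is compatible with converses and has no triangle in
`F`. -/
structure IsGood (inv : Γ → Γ) (F : Γ → Γ → Γ → Prop) {A : Type v} (r : A → A → Γ) : Prop where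
  symm : ∀ {a b : A}, a ≠ b → r b a = inv (r a b)
  avoid : ∀ {a b c : A}, a ≠ b → a ≠ c → b ≠ c → ¬ F (r a b) (r a c) (r b c)

theorem IsGood.comap {inv : Γ → Γ} {F : Γ → Γ → Γ → Prop} {A : Type v} {B : Type v'}
    {r : A → A → Γ} (h : IsGood inv F r) {f : B → A} (hf : Function.Injective f) :
    IsGood inv F fun x y => r (f x) (f y) :=
  ⟨fun hab => h.symm (hf.ne hab), fun hab hac hbc => h.avoid (hf.ne hab) (hf.ne hac) (hf.ne hbc)⟩

variable {inv : Γ → Γ} {S : Set (Bundled.{0} (colourLang Γ).Structure)}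

theorem IsCompleteStructure.hasColour_iff [Nonempty Γ] {A : Type v} [(colourLang Γ).Structure A]
    (hA : IsCompleteStructure inv A) {x : Γ} {a b : A} :
    HasColour x a b ↔ a ≠ b ∧ colour a b = x := by
  constructor
  · intro h
    have hab : a ≠ b := by
      rintro rfl
      exact hA.irrefl x a h
    exact ⟨hab, (hA.existsUnique a b hab).unique
      (Classical.epsilon_spec (p := fun x => HasColour x a b) ⟨x, h⟩) h⟩
  · rintro ⟨hab, rfl⟩
    exact Classical.epsilon_spec (p := fun x => HasColour x a b) (hA.existsUnique a b hab).exists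

theorem IsCompleteStructure.comap {A : Type v} {B : Type v'} [(colourLang Γ).Structure A]
    [(colourLang Γ).Structure B] (hB : IsCompleteStructure inv B) (f : A ↪[colourLang Γ] B) :
    IsCompleteStructure inv A where
  irrefl x a h := hB.irrefl x (f a) ((hasColour_map f).2 h)
  existsUnique a b hab := by
    simpa only [hasColour_map] using hB.existsUnique (f a) (f b) (f.injective.ne hab)
  converse x a b h := (hasColour_map f).1 (hB.converse x _ _ ((hasColour_map f).2 h))

/-- A complete structure omits the triangles of `S` if and only if its colouring does. -/
theorem isGood_colour_iff [Nonempty Γ] (hS : ∀ T ∈ S, IsTriangle inv T) {A : Type v}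
    [(colourLang Γ).Structure A] (hA : IsCompleteStructure inv A) :
    IsGood inv (IsForbidden S) (colour : A → A → Γ) ↔
      ∀ T ∈ S, IsEmpty (T ↪[colourLang Γ] A) := by
  have hcol : ∀ {a b : A}, a ≠ b → HasColour (colour a b : Γ) a b := fun h =>
    hA.hasColour_iff.2 ⟨h, rfl⟩
  constructor
  · intro h T hT
    refine ⟨fun f => ?_⟩
    obtain ⟨hTc, hT3⟩ := hS T hT
    have : Finite T := Nat.finite_of_card_ne_zero (by rw [hT3]; norm_num)
    have := Fintype.ofFinite T
    obtain ⟨p, q, s, hpq, hps, hqs⟩ : ∃ p q s : T, p ≠ q ∧ p ≠ s ∧ q ≠ s := by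
      obtain ⟨e⟩ := Fintype.card_eq.1 (show Fintype.card T = Fintype.card (Fin 3) by
        rw [Fintype.card_fin, ← hT3, Nat.card_eq_fintype_card])
      exact ⟨e.symm 0, e.symm 1, e.symm 2, by simp, by simp, by simp⟩
    refine h.avoid (f.injective.ne hpq) (f.injective.ne hps) (f.injective.ne hqs)
      ⟨T, hT, p, q, s, ?_, ?_, ?_⟩ <;> rw [← hasColour_map f] <;>
    exact hcol (f.injective.ne ‹_›)
  · intro h
    refine ⟨fun {a b} hab => ?_, fun {a b c} hab hac hbc => ?_⟩
    · exact (hA.hasColour_iff.1 (hA.converse _ _ _ (hcol hab))).2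
    · rintro ⟨T, hT, p, q, s, h₁, h₂, h₃⟩
      obtain ⟨hTc, hT3⟩ := hS T hT
      have hpq := (hTc.hasColour_iff.1 h₁).1
      have hps := (hTc.hasColour_iff.1 h₂).1
      have hqs := (hTc.hasColour_iff.1 h₃).1
      have : Finite T := Nat.finite_of_card_ne_zero (by rw [hT3]; norm_num)
      have hall : ∀ t : T, t = p ∨ t = q ∨ t = s := by
        classical
        have := Fintype.ofFinite T
        have h₁ : ({p, q, s} : Finset T).card = 3 := Finset.card_eq_three.2
          ⟨p, q, s, hpq, hps, hqs, rfl⟩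
        have h₂ : ({p, q, s} : Finset T) = Finset.univ := by
          rw [← Finset.card_eq_iff_eq_univ, h₁, ← hT3, Nat.card_eq_fintype_card]
        intro t
        have := Finset.mem_univ t
        rw [← h₂] at this
        simpa using this
      classical
      let f : T → A := fun t => if t = p then a else if t = q then b else c
      have fp : f p = a := by simp [f]
      have fq : f q = b := by simp [f, hpq.symm]
      have fs : f s = c := by simp [f, hps.symm, hqs.symm]
      have hinj : Function.Injective f := by
        intro t t' htt
        rcases hall t with e | e | e <;> rcases hall t' with e' | e' | e' <;>
          rw [e, e'] at htt ⊢ <;> simp only [fp, fq, fs] at htt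
        · exact absurd htt hab
        · exact absurd htt hac
        · exact absurd htt.symm hab
        · exact absurd htt hbc
        · exact absurd htt.symm hac
        · exact absurd htt.symm hbc
      have key : ∀ {x : Γ} {t t' : T} {y : Γ}, HasColour y t t' → HasColour y (f t) (f t') →
          (HasColour x (f t) (f t') ↔ HasColour x t t') := by
        intro x t t' y h₁ h₂
        rw [hA.hasColour_iff, hTc.hasColour_iff, (hA.hasColour_iff.1 h₂).2,
          (hTc.hasColour_iff.1 h₁).2, hinj.ne_iff]
      have g₁ : HasColour (colour a b : Γ) (f p) (f q) := by rw [fp, fq]; exact hcol hab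
      have g₂ : HasColour (colour a c : Γ) (f p) (f s) := by rw [fp, fs]; exact hcol hac
      have g₃ : HasColour (colour b c : Γ) (f q) (f s) := by rw [fq, fs]; exact hcol hbc
      have key₀ : ∀ (x : Γ) (t : T), HasColour x (f t) (f t) ↔ HasColour x t t := fun x t =>
        iff_of_false (hA.irrefl _ _) (hTc.irrefl _ _)
      obtain ⟨e, -⟩ := exists_embedding (Γ := Γ) f hinj (by
        intro x t t'
        rcases hall t with e | e | e <;> rcases hall t' with e' | e' | e' <;> rw [e, e']
        · exact key₀ x _
        · exact key h₁ g₁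
        · exact key h₂ g₂
        · exact key (hTc.converse _ _ _ h₁) (hA.converse _ _ _ g₁)
        · exact key₀ x _
        · exact key h₃ g₃
        · exact key (hTc.converse _ _ _ h₂) (hA.converse _ _ _ g₂)
        · exact key (hTc.converse _ _ _ h₃) (hA.converse _ _ _ g₃)
        · exact key₀ x _)
      exact (h T hT).false e

theorem isCompleteStructure_ofColouring {A : Type v}
    {r : A → A → Γ} (h : ∀ {a b : A}, a ≠ b → r b a = inv (r a b)) :
    IsCompleteStructure inv (ofColouring r) where
  irrefl x a ha := (hasColour_ofColouring.1 ha).1 rfl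
  existsUnique a b hab := ⟨r a b, hasColour_ofColouring.2 ⟨hab, rfl⟩,
    fun y hy => (hasColour_ofColouring.1 hy).2.symm⟩
  converse x a b hx := by
    obtain ⟨hab, rfl⟩ := hasColour_ofColouring.1 hx
    exact hasColour_ofColouring.2 ⟨hab.symm, h hab⟩

theorem colour_ofColouring [Nonempty Γ] {A : Type v} {r : A → A → Γ} {a b : A} (hab : a ≠ b) :
    (colour (A := ofColouring r) a b : Γ) = r a b :=
  (hasColour_ofColouring.1 (Classical.epsilon_spec
    (p := fun x => HasColour (A := ofColouring r) x a b)
    ⟨r a b, hasColour_ofColouring.2 ⟨hab, rfl⟩⟩)).2.symm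

theorem IsGood.of_eq {F : Γ → Γ → Γ → Prop} {A : Type v} {r r' : A → A → Γ} (h : IsGood inv F r)
    (hr : ∀ {a b : A}, a ≠ b → r' a b = r a b) : IsGood inv F r' :=
  ⟨fun hab => by rw [hr hab, hr hab.symm, h.symm hab], fun hab hac hbc => by
    rw [hr hab, hr hac, hr hbc]; exact h.avoid hab hac hbc⟩

/-- Membership in `Forb inv S` in terms of the colouring. -/
theorem mem_forb_iff [Nonempty Γ] (hS : ∀ T ∈ S, IsTriangle inv T)
    {A : Bundled.{v} (colourLang Γ).Structure} : A ∈ Forb inv S ↔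
      Finite A ∧ IsCompleteStructure inv A ∧ IsGood inv (IsForbidden S) (colour : A → A → Γ) := by
  refine and_congr_right fun _ => and_congr_right fun hA => ?_
  exact (isGood_colour_iff hS hA).symm

theorem ofColouring_mem_forb [Nonempty Γ]
    (hS : ∀ T ∈ S, IsTriangle inv T) {A : Type v} [Finite A] {r : A → A → Γ}
    (hr : IsGood inv (IsForbidden S) r) : ofColouring r ∈ Forb inv S :=
  (mem_forb_iff hS).2 ⟨‹_›, isCompleteStructure_ofColouring hr.symm,
    hr.of_eq colour_ofColouring⟩

theorem isTriangleSystem (hinv : Function.Involutive inv) (hS : ∀ T ∈ S, IsTriangle inv T)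
    {ℓ : List Γ} (hcond : NoTwoSolutionEdges S {x | x ∈ ℓ}) :
    IsTriangleSystem inv (IsForbidden S) ℓ where
  invol := hinv
  swap := by
    rintro x y z ⟨T, hT, p, q, s, h₁, h₂, h₃⟩
    exact ⟨T, hT, q, p, s, (hS T hT).1.converse _ _ _ h₁, h₃, h₂⟩
  swap' := by
    rintro x y z ⟨T, hT, p, q, s, h₁, h₂, h₃⟩
    exact ⟨T, hT, p, s, q, h₂, h₁, (hS T hT).1.converse _ _ _ h₃⟩
  two := by
    rintro x y z ⟨T, hT, p, q, s, h₁, h₂, h₃⟩ ⟨hx, hy⟩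
    have hqs : q ≠ s := by
      rintro rfl
      exact (hS T hT).1.irrefl _ _ h₃
    have key : ∀ {x : Γ} {a b : T}, IsSol inv ℓ x → HasColour x a b →
        IsSolutionEdge {x | x ∈ ℓ} a b := by
      rintro x a b (hx | hx) h
      · exact ⟨x, hx, Or.inl h⟩
      · exact ⟨inv x, hx, Or.inr ((hS T hT).1.converse _ _ _ h)⟩
    exact hcond T hT p q s hqs ⟨key hx h₁, key hy h₂⟩

/-- The colouring of `Option B` that extends `r` by a new point joined to `b` by the colour
`t b`. -/
noncomputable def optColouring [Nonempty Γ] {B : Type v} (inv : Γ → Γ) (r : B → B → Γ)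
    (t : B → Γ) : Option B → Option B → Γ
  | some a, some b => r a b
  | none, some b => t b
  | some a, none => inv (t a)
  | none, none => Classical.arbitrary Γ

theorem isGood_optColouring [Nonempty Γ] {F : Γ → Γ → Γ → Prop} {ℓ : List Γ}
    (hF : IsTriangleSystem inv F ℓ) {B : Type v} {r : B → B → Γ} (hr : IsGood inv F r) {t : B → Γ}
    (ht : ∀ x y, x ≠ y → ¬ F (t x) (t y) (r x y)) : IsGood inv F (optColouring inv r t) := by
  refine ⟨fun {a b} hab => ?_, fun {a b c} hab hac hbc h => ?_⟩
  · rcases a with _ | a <;> rcases b with _ | b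
    · exact absurd rfl hab
    · rfl
    · exact (hF.invol _).symm
    · exact hr.symm (fun h => hab (congrArg some h))
  · rcases a with _ | a <;> rcases b with _ | b <;> rcases c with _ | c <;>
      first | exact hab rfl | exact hac rfl | exact hbc rfl | skip
    · exact ht b c (fun h => hbc (congrArg some h)) h
    · have := hF.swap h
      simp only [optColouring, hF.invol (t _)] at this
      exact ht a c (fun h => hac (congrArg some h)) this
    · have hab' : a ≠ b := fun h => hab (congrArg some h)
      have := hF.swap' (hF.rev h)
      simp only [optColouring, hF.invol _] at this
      exact ht a b hab' this
    · exact hr.avoid (fun h => hab (congrArg some h)) (fun h => hac (congrArg some h))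
        (fun h => hbc (congrArg some h)) h

/-- Over a finite set of points, any two one-point extensions can be amalgamated by a solution:
semi-freeness in terms of colours. -/
theorem exists_solution [Nonempty Γ] (hS : ∀ T ∈ S, IsTriangle inv T) {ℓ : List Γ}
    (hsf : IsSemiFree (Forb.{u, v} inv S) {x | x ∈ ℓ})
    (hF : IsTriangleSystem inv (IsForbidden S) ℓ) {B : Type v} [Finite B] {r : B → B → Γ}
    (hr : IsGood inv (IsForbidden S) r) {t s : B → Γ}
    (ht : ∀ x y, x ≠ y → ¬ IsForbidden S (t x) (t y) (r x y))
    (hs : ∀ x y, x ≠ y → ¬ IsForbidden S (s x) (s y) (r x y)) :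
    ∃ R ∈ ℓ, ∀ b, ¬ IsForbidden S (t b) R (inv (s b)) := by
  have hemb : ∀ t : B → Γ, ∃ e : ofColouring r ↪[colourLang Γ] ofColouring (optColouring inv r t),
      ∀ b, e b = some b := fun t =>
    exists_embedding (A := ofColouring r) (B := ofColouring (optColouring inv r t)) (Γ := Γ)
      (fun b => some b) (Option.some_injective B) (fun x a b =>
        and_congr_left fun _ => (Option.some_injective B).ne_iff)
  obtain ⟨f₁, hf₁⟩ := hemb t
  obtain ⟨f₂, hf₂⟩ := hemb s
  obtain ⟨D, hD, g₁, g₂, ⟨hg, hrange⟩, hsol⟩ := hsf.2.2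
    (ofColouring (optColouring inv r t)) (ofColouring_mem_forb hS (isGood_optColouring hF hr ht))
    (ofColouring r) (ofColouring_mem_forb hS hr)
    (ofColouring (optColouring inv r s)) (ofColouring_mem_forb hS (isGood_optColouring hF hr hs))
    f₁ f₂
  obtain ⟨-, hDc, hDg⟩ := (mem_forb_iff hS).1 hD
  let n₁ : ofColouring (optColouring inv r t) := (none : Option B)
  let n₂ : ofColouring (optColouring inv r s) := (none : Option B)
  have hn₁ : ∀ b, f₁ b ≠ n₁ := fun b h => Option.some_ne_none b ((hf₁ b).symm.trans h)
  have hn₂ : ∀ b, f₂ b ≠ n₂ := fun b h => Option.some_ne_none b ((hf₂ b).symm.trans h)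
  have hne : g₁ n₁ ≠ g₂ n₂ := by
    intro h
    have : g₁ n₁ ∈ Set.range g₁ ∩ Set.range g₂ := ⟨⟨n₁, rfl⟩, ⟨n₂, h.symm⟩⟩
    rw [hrange] at this
    obtain ⟨b, hb⟩ := this
    exact hn₁ b (g₁.injective hb)
  refine ⟨colour (g₁ n₁) (g₂ n₂),
    hsol n₁ (fun ⟨b, hb⟩ => hn₁ b hb) n₂ (fun ⟨b, hb⟩ => hn₂ b hb) _
    (hDc.hasColour_iff.2 ⟨hne, rfl⟩), fun b₀ hb => ?_⟩
  let b : ofColouring r := b₀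
  refine hDg.avoid (a := g₁ n₁) (b := g₁ (f₁ b)) (c := g₂ n₂) (g₁.injective.ne (hn₁ b).symm) hne
    (by rw [hg]; exact g₂.injective.ne (hn₂ b)) ?_
  have e₁ : (colour (g₁ n₁) (g₁ (f₁ b)) : Γ) = t b₀ := by
    rw [colour_map, hf₁]
    exact colour_ofColouring (r := optColouring inv r t) (a := none) (b := some b₀) (by simp)
  have e₂ : (colour (g₁ (f₁ b)) (g₂ n₂) : Γ) = inv (s b₀) := by
    rw [hg, colour_map, hf₂]
    exact colour_ofColouring (r := optColouring inv r s) (a := some b₀) (b := none) (by simp)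
  rw [e₁, e₂]
  exact hb

end Colourings

/-! ### Prioritised amalgams -/

section Amalgam

universe v

open CategoryTheory
open scoped Classical

variable {Γ : Type u}

/-- The pair `(d, e)` has to be recoloured: `d` lies only in the first part `P` and `e` only in the
second part `Q`. -/
def IsCross {E : Type v} (P Q : Set E) (d e : E) : Prop := d ∉ Q ∧ e ∉ P

/-- The colouring that agrees with `r` on `P` and on `Q`, with the colours between `P \ Q` and
`Q \ P` chosen as in the prioritised amalgam over `B`. -/
noncomputable def recolour (inv : Γ → Γ) (F : Γ → Γ → Γ → Prop) (ℓ : List Γ) {E : Type v}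
    (r : E → E → Γ) (P Q : Set E) (B : Finset E) (d e : E) : Γ :=
  if IsCross P Q d e then prio F ℓ r B d e
  else if IsCross P Q e d then inv (prio F ℓ r B e d)
  else r d e

variable {inv : Γ → Γ} {F : Γ → Γ → Γ → Prop} {ℓ : List Γ} {E : Type v} {r : E → E → Γ}
  {P Q : Set E} {B : Finset E}

theorem IsCross.asymm (hPQ : P ∪ Q = Set.univ) {d e : E} (h : IsCross P Q d e) :
    ¬ IsCross P Q e d := by
  intro h'
  have : d ∈ P ∪ Q := hPQ ▸ Set.mem_univ d
  exact this.elim h'.2 h.1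

theorem recolour_of_cross {d e : E} (h : IsCross P Q d e) :
    recolour inv F ℓ r P Q B d e = prio F ℓ r B d e := if_pos h

theorem recolour_of_cross_symm (hPQ : P ∪ Q = Set.univ) {d e : E} (h : IsCross P Q e d) :
    recolour inv F ℓ r P Q B d e = inv (prio F ℓ r B e d) := by
  rw [recolour, if_neg (h.asymm hPQ), if_pos h]

theorem recolour_of_not_cross {d e : E} (h : ¬ IsCross P Q d e) (h' : ¬ IsCross P Q e d) :
    recolour inv F ℓ r P Q B d e = r d e := by
  rw [recolour, if_neg h, if_neg h']

/-- If the colour of `(d, e)` is itself a solution, then some solution is not blocked. -/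
theorem find_prio (hr : IsGood inv F r) (hB : ∀ b, b ∈ B ↔ b ∈ P ∧ b ∈ Q) {d e : E} (hde : d ≠ e)
    (h : IsCross P Q d e) (hℓ : r d e ∈ ℓ) :
    (ℓ.find? fun R => decide (¬ Blk F r B d e R)) = some (prio F ℓ r B d e) := by
  have hnot : ¬ Blk F r B d e (r d e) := by
    rintro ⟨b, hb, hF⟩
    refine hr.avoid ?_ hde ?_ hF
    · rintro rfl
      exact h.1 ((hB _).1 hb).2
    · rintro rfl
      exact h.2 ((hB _).1 hb).1
  have : (ℓ.find? fun R => decide (¬ Blk F r B d e R)).isSome := by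
    rw [List.find?_isSome]
    exact ⟨r d e, hℓ, by simpa using hnot⟩
  obtain ⟨R, hR⟩ := Option.isSome_iff_exists.1 this
  rw [prio, hR, Option.getD_some]

/-- The prioritised amalgam contains no forbidden triangle: one with a single new edge is excluded
by the choice of its colour, and one with more new edges has two edges coloured from `ℓ`. -/
theorem isGood_recolour (hF : IsTriangleSystem inv F ℓ) (hr : IsGood inv F r)
    (hPQ : P ∪ Q = Set.univ) (hB : ∀ b, b ∈ B ↔ b ∈ P ∧ b ∈ Q)
    (hℓ : ∀ d e, d ≠ e → IsCross P Q d e → r d e ∈ ℓ) :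
    IsGood inv F (recolour inv F ℓ r P Q B) := by
  have hsymm : ∀ {a b : E}, a ≠ b →
      recolour inv F ℓ r P Q B b a = inv (recolour inv F ℓ r P Q B a b) := by
    intro a b hab
    by_cases h : IsCross P Q a b
    · rw [recolour_of_cross h, recolour_of_cross_symm hPQ h]
    by_cases h' : IsCross P Q b a
    · rw [recolour_of_cross h', recolour_of_cross_symm hPQ h', hF.invol]
    rw [recolour_of_not_cross h h', recolour_of_not_cross h' h, hr.symm hab]
  have hne : ∀ {a b : E}, IsCross P Q a b → a ≠ b := by
    rintro a b h rfl
    exact h.asymm hPQ h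
  have hsol : ∀ {a b : E}, IsCross P Q a b → IsSol inv ℓ (recolour inv F ℓ r P Q B a b) := by
    intro a b h
    rw [recolour_of_cross h]
    exact Or.inl (List.mem_of_find?_eq_some (find_prio hr hB (hne h) h (hℓ a b (hne h) h)))
  have hcross : ∀ {a b c : E}, IsCross P Q a c → ¬ F (recolour inv F ℓ r P Q B a b)
      (recolour inv F ℓ r P Q B a c) (recolour inv F ℓ r P Q B b c) := by
    intro a b c h hFF
    by_cases hbP : b ∈ P
    · by_cases hbQ : b ∈ Q
      · rw [recolour_of_cross h,
          recolour_of_not_cross (d := a) (fun h => h.2 hbP) (fun h => h.1 hbQ),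
          recolour_of_not_cross (d := b) (fun h => h.1 hbQ) (fun h => h.2 hbP)] at hFF
        have := List.find?_some (find_prio hr hB (hne h) h (hℓ a c (hne h) h))
        exact (of_decide_eq_true this) ⟨b, (hB b).2 ⟨hbP, hbQ⟩, hFF⟩
      · exact hF.two_right hFF (hsol h) (hsol ⟨hbQ, h.2⟩)
    · exact hF.two hFF ⟨hsol ⟨h.1, hbP⟩, hsol h⟩
  have hcross' : ∀ {a b c : E}, a ≠ b → b ≠ c → IsCross P Q a c ∨ IsCross P Q c a →
      ¬ F (recolour inv F ℓ r P Q B a b) (recolour inv F ℓ r P Q B a c)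
        (recolour inv F ℓ r P Q B b c) := by
    rintro a b c hab hbc (h | h) hFF
    · exact hcross h hFF
    · refine hcross h (b := b) ?_
      rw [hsymm hbc, hsymm (hne h).symm, hsymm hab]
      exact hF.rev hFF
  refine ⟨hsymm, fun {a b c} hab hac hbc hFF => ?_⟩
  by_cases h₁ : IsCross P Q a c ∨ IsCross P Q c a
  · exact hcross' hab hbc h₁ hFF
  by_cases h₂ : IsCross P Q a b ∨ IsCross P Q b a
  · refine hcross' hac hbc.symm h₂ ?_
    rw [hsymm hbc]
    exact hF.swap' hFF
  by_cases h₃ : IsCross P Q b c ∨ IsCross P Q c b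
  · refine hcross' hab.symm hac h₃ ?_
    rw [hsymm hab]
    exact hF.swap hFF
  rw [not_or] at h₁ h₂ h₃
  rw [recolour_of_not_cross h₁.1 h₁.2, recolour_of_not_cross h₂.1 h₂.2,
    recolour_of_not_cross h₃.1 h₃.2] at hFF
  exact hr.avoid hab hac hbc hFF

/-- Any amalgam with new colours in `ℓ` becomes the prioritised amalgam when the new pairs are
recoloured and all superfluous points are removed. -/
theorem isPrioritisedSemiFree {S : Set (Bundled.{0} (colourLang Γ).Structure)}
    (hinv : Function.Involutive inv) (hS : ∀ T ∈ S, IsTriangle inv T) (hℓ : ℓ.Nodup)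
    (hsf : IsSemiFree (Forb.{u, w} inv S) {x | x ∈ ℓ})
    (hcond : NoTwoSolutionEdges S {x | x ∈ ℓ}) : IsPrioritisedSemiFree.{u, w} inv S ℓ := by
  have hF := isTriangleSystem hinv hS hcond
  obtain ⟨Q₀, -, -⟩ := Set.exists_of_ssubset hsf.2.1
  have : Nonempty Γ := ⟨Q₀⟩
  refine ⟨hsf.1, hℓ, hsf.2.1, fun A hA B hB C hC f₁ f₂ => ?_⟩
  obtain ⟨D, hD, g₁, g₂, ⟨hg, hrange⟩, hsol⟩ := hsf.2.2 A hA B hB C hC f₁ f₂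
  obtain ⟨hDfin, hDc, hDg⟩ := (mem_forb_iff hS).1 hD
  let E := {d : D // d ∈ Set.range g₁ ∪ Set.range g₂}
  let P : Set E := {d | d.1 ∈ Set.range g₁}
  let Q : Set E := {d | d.1 ∈ Set.range g₂}
  have := Fintype.ofFinite E
  let B' : Finset E := Finset.univ.filter fun d => d ∈ P ∧ d ∈ Q
  have hB' : ∀ b, b ∈ B' ↔ b ∈ P ∧ b ∈ Q := fun b => by simp [B']
  have hPQ : P ∪ Q = Set.univ := Set.eq_univ_of_forall fun d => d.2
  let r : E → E → Γ := fun d e => colour d.1 e.1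
  have hr : IsGood inv (IsForbidden S) r := hDg.comap Subtype.val_injective
  let p : A → E := fun a => ⟨g₁ a, Or.inl ⟨a, rfl⟩⟩
  let q : C → E := fun c => ⟨g₂ c, Or.inr ⟨c, rfl⟩⟩
  have hpP : ∀ a, p a ∈ P := fun a => ⟨a, rfl⟩
  have hqQ : ∀ c, q c ∈ Q := fun c => ⟨c, rfl⟩
  have hpinj : Function.Injective p := fun a a' h => g₁.injective (congrArg Subtype.val h)
  have hqinj : Function.Injective q := fun a a' h => g₂.injective (congrArg Subtype.val h)
  have hpQ : ∀ a, p a ∈ Q ↔ a ∈ Set.range f₁ := by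
    intro a
    constructor
    · intro h
      have : g₁ a ∈ Set.range g₁ ∩ Set.range g₂ := ⟨⟨a, rfl⟩, h⟩
      rw [hrange] at this
      obtain ⟨b, hb⟩ := this
      exact ⟨b, g₁.injective hb⟩
    · rintro ⟨b, rfl⟩
      exact ⟨f₂ b, (hg b).symm⟩
  have hqP : ∀ c, q c ∈ P ↔ c ∈ Set.range f₂ := by
    intro c
    constructor
    · intro h
      have : g₂ c ∈ Set.range g₁ ∩ Set.range g₂ := ⟨h, ⟨c, rfl⟩⟩
      rw [hrange] at this
      obtain ⟨b, hb⟩ := this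
      exact ⟨b, g₂.injective ((hg b).symm.trans hb)⟩
    · rintro ⟨b, rfl⟩
      exact ⟨f₁ b, hg b⟩
  have hrℓ : ∀ d e, d ≠ e → IsCross P Q d e → r d e ∈ ℓ := by
    rintro ⟨d, hd⟩ ⟨e, he⟩ hde ⟨hdQ, heP⟩
    obtain ⟨a, rfl⟩ := hd.resolve_right hdQ
    obtain ⟨c, rfl⟩ := he.resolve_left heP
    exact hsol a (fun h => hdQ ((hpQ a).2 h)) c (fun h => heP ((hqP c).2 h)) _
      (hDc.hasColour_iff.2 ⟨fun h => hde (Subtype.ext h), rfl⟩)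
  let r' := recolour inv (IsForbidden S) ℓ r P Q B'
  have hr' : IsGood inv (IsForbidden S) r' := isGood_recolour hF hr hPQ hB' hrℓ
  obtain ⟨k₁, hk₁⟩ := exists_embedding (Γ := Γ) (A := A) (B := ofColouring r') p hpinj (by
    intro x a a'
    have : r' (p a) (p a') = colour (g₁ a) (g₁ a') :=
      recolour_of_not_cross (fun h => h.2 (hpP a')) (fun h => h.2 (hpP a))
    rw [← hasColour_map g₁, hDc.hasColour_iff, ← this, g₁.injective.ne_iff, ← hpinj.ne_iff]
    exact Iff.rfl)
  obtain ⟨k₂, hk₂⟩ := exists_embedding (Γ := Γ) (A := C) (B := ofColouring r') q hqinj (by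
    intro x a a'
    have : r' (q a) (q a') = colour (g₂ a) (g₂ a') :=
      recolour_of_not_cross (fun h => h.1 (hqQ a)) (fun h => h.1 (hqQ a'))
    rw [← hasColour_map g₂, hDc.hasColour_iff, ← this, g₂.injective.ne_iff, ← hqinj.ne_iff]
    exact Iff.rfl)
  have hk₁' : Set.range k₁ = P := Set.ext fun d =>
    ⟨fun ⟨a, ha⟩ => by rw [← ha, hk₁]; exact hpP a,
      fun ⟨a, ha⟩ => ⟨a, (hk₁ a).trans (Subtype.ext ha)⟩⟩
  have hk₂' : Set.range k₂ = Q := Set.ext fun d =>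
    ⟨fun ⟨a, ha⟩ => by rw [← ha, hk₂]; exact hqQ a,
      fun ⟨a, ha⟩ => ⟨a, (hk₂ a).trans (Subtype.ext ha)⟩⟩
  have hpq : ∀ b, p (f₁ b) = q (f₂ b) := fun b => Subtype.ext (hg b)
  refine ⟨ofColouring r', ofColouring_mem_forb hS hr', k₁, k₂, ⟨fun b => ?_, ?_⟩, ?_, ?_⟩
  · rw [hk₁, hk₂, hpq]
  · rw [hk₁', hk₂']
    ext d
    constructor
    · rintro ⟨⟨a, ha⟩, hdQ⟩
      have ha' : p a = d := Subtype.ext ha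
      obtain ⟨b, rfl⟩ := (hpQ a).1 (ha' ▸ hdQ)
      exact ⟨b, (hk₁ _).trans ha'⟩
    · rintro ⟨b, rfl⟩
      simp only [hk₁]
      exact ⟨hpP _, (hpQ _).2 ⟨b, rfl⟩⟩
  · rw [hk₁', hk₂']
    exact hPQ
  · intro a ha c hc
    have hcross : IsCross P Q (p a) (q c) := ⟨fun h => ha ((hpQ a).1 h), fun h => hc ((hqP c).1 h)⟩
    have hne : p a ≠ q c := fun h => hcross.2 (h ▸ hpP a)
    have hblk : ∀ y, Blocks S f₁ f₂ a c y ↔ Blk (IsForbidden S) r B' (p a) (q c) y := by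
      intro y
      constructor
      · rintro ⟨b, x, z, hx, hz, hxyz⟩
        refine ⟨p (f₁ b), (hB' _).2 ⟨hpP _, (hpQ _).2 ⟨b, rfl⟩⟩, ?_⟩
        have e₁ : r (p a) (p (f₁ b)) = x := (hDc.hasColour_iff.1 ((hasColour_map g₁).2 hx)).2
        have e₂ : r (p (f₁ b)) (q c) = z := by
          rw [hpq]
          exact (hDc.hasColour_iff.1 ((hasColour_map g₂).2 hz)).2
        rwa [e₁, e₂]
      · rintro ⟨d, hd, hF⟩
        obtain ⟨⟨a', ha'⟩, hdQ⟩ := (hB' d).1 hd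
        have ha'' : p a' = d := Subtype.ext ha'
        rw [← ha'', hpQ] at hdQ
        obtain ⟨b, rfl⟩ := hdQ
        rw [← ha''] at hF
        refine ⟨b, _, _, ?_, ?_, hF⟩
        · rw [← hasColour_map g₁, hDc.hasColour_iff]
          exact ⟨g₁.injective.ne fun h => ha ⟨b, h.symm⟩, rfl⟩
        · rw [← hasColour_map g₂, hDc.hasColour_iff, hpq]
          exact ⟨g₂.injective.ne fun h => hc ⟨b, h⟩, rfl⟩
    obtain ⟨hy, i, hi, hiy, hj⟩ := List.find?_eq_some_iff_getElem.1
      (find_prio hr hB' hne hcross (hrℓ _ _ hne hcross))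
    refine ⟨⟨i, hi⟩, ?_, ?_, fun j hji => ?_⟩
    · rw [hk₁, hk₂]
      exact hasColour_ofColouring.2 ⟨hne, (recolour_of_cross hcross).trans hiy.symm⟩
    · rw [hblk]
      have : ℓ.get ⟨i, hi⟩ = prio (IsForbidden S) ℓ r B' (p a) (q c) := hiy
      rw [this]
      exact of_decide_eq_true hy
    · rw [hblk]
      simpa using hj j hji

end Amalgam

/-! ### Existence of the Fraïssé limit -/

section Existence

universe v v'

open CategoryTheory
open scoped Classical

variable {Γ : Type u}

/-- Joining a new point to every `x ∈ X` by the colour `t x` creates no triangle in `F`. -/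
def IsConsistent (F : Γ → Γ → Γ → Prop) {A : Type v} (r : A → A → Γ) (X : Finset A) (t : A → Γ) :
    Prop :=
  ∀ x ∈ X, ∀ y ∈ X, x ≠ y → ¬ F (t x) (t y) (r x y)

/-- Every consistent one-point extension of a finite set of points is realised outside this set. -/
def IsSaturated (F : Γ → Γ → Γ → Prop) {A : Type v} (r : A → A → Γ) : Prop :=
  ∀ (X : Finset A) (t : A → Γ), IsConsistent F r X t → ∃ a ∉ X, ∀ x ∈ X, r a x = t x

variable {inv : Γ → Γ} {S : Set (Bundled.{0} (colourLang Γ).Structure)} {ℓ : List Γ}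

/-- A consistent one-point extension of a finite set `X` extends to every finite superset. -/
theorem exists_isConsistent [Nonempty Γ] (hS : ∀ T ∈ S, IsTriangle inv T)
    (hsf : IsSemiFree (Forb.{u, w} inv S) {x | x ∈ ℓ})
    (hF : IsTriangleSystem inv (IsForbidden S) ℓ) {r : ℕ → ℕ → Γ} {Z : Finset ℕ}
    (hr : IsGood inv (IsForbidden S) fun a b : Z => r a b) {X : Finset ℕ} (hX : X ⊆ Z) {t : ℕ → Γ}
    (ht : IsConsistent (IsForbidden S) r X t) :
    ∃ t' : ℕ → Γ, (∀ x ∈ X, t' x = t x) ∧ IsConsistent (IsForbidden S) r Z t' := by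
  have key : ∀ W : Finset ℕ, W ⊆ Z → ∃ t' : ℕ → Γ, (∀ x ∈ X, t' x = t x) ∧
      IsConsistent (IsForbidden S) r (X ∪ W) t' := by
    intro W
    induction W using Finset.induction_on with
    | empty => exact fun _ => ⟨t, fun _ _ => rfl, by rwa [Finset.union_empty]⟩
    | insert y W hyW ih =>
      intro hW
      rw [Finset.insert_subset_iff] at hW
      obtain ⟨t', htX, ht'⟩ := ih hW.2
      by_cases hy : y ∈ X ∪ W
      · exact ⟨t', htX, by rwa [Finset.union_insert, Finset.insert_eq_of_mem hy]⟩
      have hYZ : X ∪ W ⊆ Z := Finset.union_subset hX hW.2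
      have hne : ∀ x ∈ X ∪ W, x ≠ y := fun x hx h => hy (h ▸ hx)
      let i : ULift.{w} ↥(X ∪ W) → Z := fun b => ⟨b.down, hYZ b.down.2⟩
      have hi : Function.Injective i := fun b b' h =>
        ULift.down_injective (Subtype.ext (congrArg (fun z : Z => (z : ℕ)) h))
      have hij : ∀ b b' : ULift.{w} ↥(X ∪ W), b ≠ b' → (b.down : ℕ) ≠ b'.down := fun b b' h h' =>
        h (ULift.down_injective (Subtype.ext h'))
      obtain ⟨R, -, hR⟩ := exists_solution hS hsf hF (hr.comap hi) (t := fun b => t' b.down)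
        (s := fun b => r y b.down) (fun b b' h => ht' _ b.down.2 _ b'.down.2 (hij b b' h))
        (fun b b' h => hr.avoid (a := ⟨y, hW.1⟩) (b := i b) (c := i b')
          (fun e => hne _ b.down.2 (congrArg Subtype.val e).symm)
          (fun e => hne _ b'.down.2 (congrArg Subtype.val e).symm) (hi.ne h))
      have hR' : ∀ x ∈ X ∪ W, ¬ IsForbidden S (t' x) R (inv (r y x)) := fun x hx =>
        hR ⟨⟨x, hx⟩⟩
      have hsymm : ∀ x ∈ X ∪ W, r x y = inv (r y x) := fun x hx =>
        hr.symm (a := ⟨y, hW.1⟩) (b := ⟨x, hYZ hx⟩)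
          (fun e => hne x hx (congrArg Subtype.val e).symm)
      refine ⟨Function.update t' y R, fun x hx => ?_, ?_⟩
      · rw [Function.update_of_ne (hne x (Finset.mem_union_left _ hx)), htX x hx]
      · rw [Finset.union_insert]
        intro x hx x' hx' hxx'
        rw [Finset.mem_insert] at hx hx'
        rcases hx with rfl | hx <;> rcases hx' with rfl | hx'
        · exact absurd rfl hxx'
        · rw [Function.update_self, Function.update_of_ne (hne x' hx')]
          exact fun h => hR' x' hx' (hF.swap' h)
        · rw [Function.update_self, Function.update_of_ne (hne x hx), hsymm x hx]
          exact hR' x hx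
        · rw [Function.update_of_ne (hne x hx), Function.update_of_ne (hne x' hx')]
          exact ht' x hx x' hx' hxx'
  obtain ⟨t', h₁, h₂⟩ := key Z subset_rfl
  exact ⟨t', h₁, by rwa [Finset.union_eq_right.2 hX] at h₂⟩

/-- One step of the construction of the limit: a point `n` realising a given one-point extension is
added to a coloured set `{0, …, n - 1}`. -/
theorem exists_extend_colouring [Nonempty Γ] (hS : ∀ T ∈ S, IsTriangle inv T)
    (hsf : IsSemiFree (Forb.{u, w} inv S) {x | x ∈ ℓ})
    (hF : IsTriangleSystem inv (IsForbidden S) ℓ) {n : ℕ} {r : ℕ → ℕ → Γ}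
    (hr : IsGood inv (IsForbidden S) fun a b : Finset.range n => r a b) (X : Finset ℕ) (t : ℕ → Γ) :
    ∃ r' : ℕ → ℕ → Γ, (IsGood inv (IsForbidden S) fun a b : Finset.range (n + 1) => r' a b) ∧
      (∀ a < n, ∀ b < n, r' a b = r a b) ∧
      (X ⊆ Finset.range n → IsConsistent (IsForbidden S) r X t → ∀ x ∈ X, r' n x = t x) := by
  obtain ⟨t', ht', htX⟩ : ∃ t' : ℕ → Γ, IsConsistent (IsForbidden S) r (Finset.range n) t' ∧
      (X ⊆ Finset.range n → IsConsistent (IsForbidden S) r X t → ∀ x ∈ X, t' x = t x) := by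
    by_cases h : X ⊆ Finset.range n ∧ IsConsistent (IsForbidden S) r X t
    · obtain ⟨t', h₁, h₂⟩ := exists_isConsistent hS hsf hF hr h.1 h.2
      exact ⟨t', h₂, fun _ _ => h₁⟩
    · obtain ⟨t', -, h₂⟩ := exists_isConsistent hS hsf hF hr (Finset.empty_subset _) (t := t)
        (fun x hx => absurd hx (Finset.notMem_empty x))
      exact ⟨t', h₂, fun h₃ h₄ => absurd ⟨h₃, h₄⟩ h⟩
  let r' : ℕ → ℕ → Γ := fun a b => if a = n then t' b else if b = n then inv (t' a) else r a b
  let i : Finset.range (n + 1) → Option (Finset.range n) := fun a =>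
    if h : (a : ℕ) < n then some ⟨a, Finset.mem_range.2 h⟩ else none
  have hlt : ∀ a : Finset.range (n + 1), ¬ (a : ℕ) < n → (a : ℕ) = n := fun a h => by
    have := Finset.mem_range.1 a.2
    omega
  have hi : Function.Injective i := by
    intro a b h
    by_cases ha : (a : ℕ) < n <;> by_cases hb : (b : ℕ) < n <;>
      simp only [i, dif_pos, ha, hb, dif_neg, not_false_iff, reduceCtorEq, Option.some.injEq,
        Subtype.mk.injEq] at h
    · exact Subtype.ext h
    · exact Subtype.ext ((hlt a ha).trans (hlt b hb).symm)
  refine ⟨r', ?_, fun a ha b hb => ?_, fun h₁ h₂ x hx => ?_⟩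
  · refine ((isGood_optColouring hF hr (t := fun x => t' x) fun x y hxy => ht' _ x.2 _ y.2
      fun h => hxy (Subtype.ext h)).comap hi).of_eq fun {a b} hab => ?_
    by_cases ha : (a : ℕ) < n <;> by_cases hb : (b : ℕ) < n
    · simp only [r', i, ha, hb, dif_pos, ha.ne, hb.ne, if_false, optColouring]
    · simp only [r', i, ha, dif_pos, ha.ne, hlt b hb, if_false, if_true, optColouring,
        lt_irrefl, dif_neg, not_false_iff]
    · simp only [r', i, hb, dif_pos, hlt a ha, if_true, optColouring,
        lt_irrefl, dif_neg, not_false_iff]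
    · exact absurd (Subtype.ext ((hlt a ha).trans (hlt b hb).symm)) hab
  · simp only [r', ha.ne, hb.ne, if_false]
  · simp only [r', if_true]
    exact htX h₁ h₂ x hx

/-- A countable colouring without forbidden triangles that realises all consistent one-point
extensions, built by adding one point at a time. -/
theorem exists_saturated_colouring [Finite Γ] [Nonempty Γ] (hS : ∀ T ∈ S, IsTriangle inv T)
    (hsf : IsSemiFree (Forb.{u, w} inv S) {x | x ∈ ℓ})
    (hF : IsTriangleSystem inv (IsForbidden S) ℓ) :
    ∃ r : ℕ → ℕ → Γ, IsGood inv (IsForbidden S) r ∧ IsSaturated (IsForbidden S) r := by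
  -- every task occurs at arbitrarily late stages, once as `pair k m` for each `m`
  obtain ⟨e, he⟩ := exists_surjective_nat (Σ X : Finset ℕ, (X → Γ))
  let X : ℕ → Finset ℕ := fun n => (e n.unpair.1).1
  let t : ℕ → ℕ → Γ := fun n x =>
    if h : x ∈ X n then (e n.unpair.1).2 ⟨x, h⟩ else Classical.arbitrary Γ
  let G : ℕ → Type u := fun n =>
    {r : ℕ → ℕ → Γ // IsGood inv (IsForbidden S) fun a b : Finset.range n => r a b}
  choose next hnext hagree htask using fun (n : ℕ) (s : G n) =>
    exists_extend_colouring hS hsf hF s.2 (X n) (t n)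
  let f : ∀ n, G n := fun n => Nat.rec (motive := G)
    ⟨fun _ _ => Classical.arbitrary Γ,
      fun {a} => absurd a.2 (by simp), fun {a} => absurd a.2 (by simp)⟩
    (fun n s => ⟨next n s, hnext n s⟩) n
  have hstep : ∀ n, ∀ a < n, ∀ b < n, (f (n + 1)).1 a b = (f n).1 a b := fun n => hagree n (f n)
  have hle : ∀ n m, n ≤ m → ∀ a < n, ∀ b < n, (f m).1 a b = (f n).1 a b := by
    intro n m h
    induction m, h using Nat.le_induction with
    | base => exact fun _ _ _ _ => rfl
    | succ m hm ih =>
      intro a ha b hb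
      rw [hstep m a (ha.trans_le hm) b (hb.trans_le hm), ih a ha b hb]
  let r : ℕ → ℕ → Γ := fun a b => (f (max a b + 1)).1 a b
  have hr : ∀ n, ∀ a < n, ∀ b < n, r a b = (f n).1 a b := fun n a ha b hb =>
    (hle _ n (by omega) a (by omega) b (by omega)).symm
  refine ⟨r, ⟨fun {a b} hab => ?_, fun {a b c} hab hac hbc => ?_⟩, fun Y s hs => ?_⟩
  · have ha : a < max a b + 1 := by omega
    have hb : b < max a b + 1 := by omega
    rw [hr _ a ha b hb, hr _ b hb a ha]
    exact (f (max a b + 1)).2.symm (a := ⟨a, Finset.mem_range.2 ha⟩)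
      (b := ⟨b, Finset.mem_range.2 hb⟩)
      fun h => hab (congrArg Subtype.val h)
  · have ha : a < max a (max b c) + 1 := by omega
    have hb : b < max a (max b c) + 1 := by omega
    have hc : c < max a (max b c) + 1 := by omega
    rw [hr _ a ha b hb, hr _ a ha c hc, hr _ b hb c hc]
    exact (f (max a (max b c) + 1)).2.avoid (a := ⟨a, Finset.mem_range.2 ha⟩)
      (b := ⟨b, Finset.mem_range.2 hb⟩) (c := ⟨c, Finset.mem_range.2 hc⟩)
      (fun h => hab (congrArg Subtype.val h)) (fun h => hac (congrArg Subtype.val h))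
      fun h => hbc (congrArg Subtype.val h)
  · obtain ⟨k, hk⟩ := he ⟨Y, fun x => s x⟩
    obtain ⟨m, hm⟩ := Y.exists_nat_subset_range
    let n := Nat.pair k m
    have hn : e n.unpair.1 = ⟨Y, fun x => s x⟩ := by rw [Nat.unpair_pair, hk]
    have hX : X n = Y := congrArg Sigma.fst hn
    have hYn : Y ⊆ Finset.range n :=
      hm.trans (Finset.range_subset_range.2 (Nat.right_le_pair k m))
    have hYlt : ∀ y ∈ Y, y < n := fun y hy => Finset.mem_range.1 (hYn hy)
    have ht : ∀ y ∈ Y, t n y = s y := by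
      intro y hy
      have : ∀ (p : Σ X : Finset ℕ, (X → Γ)) (h : y ∈ p.1), p = ⟨Y, fun x => s x⟩ →
          p.2 ⟨y, h⟩ = s y := by
        rintro p h rfl
        rfl
      have hy' : y ∈ X n := hX ▸ hy
      simp only [t, hy', dif_pos]
      exact this _ hy' hn
    refine ⟨n, fun h => lt_irrefl n (hYlt n h), fun y hy => ?_⟩
    rw [hr (n + 1) n n.lt_succ_self y ((hYlt y hy).trans n.lt_succ_self), ← ht y hy]
    refine htask n (f n) (hX ▸ hYn) ?_ y (hX ▸ hy)
    rw [hX]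
    intro x hx y hy hxy
    rw [ht x hx, ht y hy, ← hr n x (hYlt x hx) y (hYlt y hy)]
    exact hs x hx y hy hxy

/-- The extension property in terms of partial maps: a finite partial map that preserves colours
extends to one more point of its domain. -/
theorem IsSaturated.exists_extend {F : Γ → Γ → Γ → Prop} {A : Type v} {N : Type v'}
    {r : A → A → Γ} (hr : IsSaturated F r) {ρ : N → N → Γ} (hρ : IsGood inv F ρ) {X : Finset N}
    {f : N → A} (hf : Set.InjOn f X) (hfr : ∀ x ∈ X, ∀ y ∈ X, x ≠ y → r (f x) (f y) = ρ x y) {y : N}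
    (hy : y ∉ X) : ∃ a, (∀ x ∈ X, f x ≠ a) ∧ ∀ x ∈ X, r a (f x) = ρ y x := by
  have : Nonempty N := ⟨y⟩
  have hinv : ∀ x ∈ X, Function.invFunOn f X (f x) = x := fun x hx => hf.leftInvOn_invFunOn hx
  obtain ⟨a, ha, har⟩ := hr (X.image f) (fun b => ρ y (Function.invFunOn f X b)) (by
    intro b hb c hc hbc
    obtain ⟨x, hx, rfl⟩ := Finset.mem_image.1 hb
    obtain ⟨z, hz, rfl⟩ := Finset.mem_image.1 hc
    have hxz : x ≠ z := fun h => hbc (congrArg f h)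
    simp only [hinv x hx, hinv z hz, hfr x hx z hz hxz]
    exact hρ.avoid (fun h => hy (h ▸ hx)) (fun h => hy (h ▸ hz)) hxz)
  refine ⟨a, fun x hx h => ha (h ▸ Finset.mem_image_of_mem f hx), fun x hx => ?_⟩
  rw [har _ (Finset.mem_image_of_mem f hx), hinv x hx]

end Existence

/-! ### Colourings of Fraïssé limits -/

section Limits

universe v

open CategoryTheory FirstOrder.Language
open scoped Classical

variable {Γ : Type u} {inv : Γ → Γ} {S : Set (Bundled.{0} (colourLang Γ).Structure)}
  {ℓ : List Γ} {M : Type w} [(colourLang Γ).Structure M]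

/-- Extending a finite partial map from a complete structure by one point preserves the property of
being a partial embedding. -/
theorem IsSaturated.exists_insert [Nonempty Γ] {F : Γ → Γ → Γ → Prop}
    (hinv : Function.Involutive inv)
    (hg : IsGood inv F (colour : M → M → Γ)) (hsat : IsSaturated F (colour : M → M → Γ))
    {N : Type v} {ρ : N → N → Γ} (hρ : IsGood inv F ρ) {X : Finset N} {f : N → M}
    (hf : Set.InjOn f X) (hfr : ∀ x ∈ X, ∀ y ∈ X, x ≠ y → colour (f x) (f y) = ρ x y) {y : N}
    (hy : y ∉ X) : ∃ a, Set.InjOn (Function.update f y a) ↑(insert y X) ∧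
      ∀ x ∈ insert y X, ∀ z ∈ insert y X, x ≠ z →
        colour (Function.update f y a x) (Function.update f y a z) = ρ x z := by
  obtain ⟨a, hne, ha⟩ := hsat.exists_extend hρ hf hfr hy
  have hX : ∀ x ∈ X, Function.update f y a x = f x := fun x hx =>
    Function.update_of_ne (ne_of_mem_of_not_mem hx hy) _ _
  refine ⟨a, ?_, ?_⟩
  · intro x hx z hz h
    rw [Finset.mem_coe, Finset.mem_insert] at hx hz
    rcases hx with rfl | hx <;> rcases hz with rfl | hz
    · rfl
    · rw [Function.update_self, hX z hz] at h
      exact absurd h.symm (hne z hz)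
    · rw [Function.update_self, hX x hx] at h
      exact absurd h (hne x hx)
    · rw [hX x hx, hX z hz] at h
      exact hf hx hz h
  · intro x hx z hz hxz
    rw [Finset.mem_insert] at hx hz
    rcases hx with rfl | hx <;> rcases hz with rfl | hz
    · exact absurd rfl hxz
    · rw [Function.update_self, hX z hz, ha z hz]
    · rw [Function.update_self, hX x hx, hg.symm (hne x hx).symm, ha x hx, hρ.symm hxz, hinv]
    · rw [hX x hx, hX z hz, hfr x hx z hz hxz]

theorem exists_embedding_of_colour [Nonempty Γ] {N : Type v} [(colourLang Γ).Structure N]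
    (hM : IsCompleteStructure inv M) (hN : IsCompleteStructure inv N) {f : N → M}
    (hf : Function.Injective f) (h : ∀ x y, x ≠ y → (colour (f x) (f y) : Γ) = colour x y) :
    ∃ e : N ↪[colourLang Γ] M, ∀ x, e x = f x :=
  exists_embedding f hf fun x a b => by
    rw [hM.hasColour_iff, hN.hasColour_iff, hf.ne_iff]
    exact and_congr_right fun hab => by rw [h a b hab]

/-- A countable complete structure without forbidden triangles that realises all consistent
one-point extensions is the Fraïssé limit: finite partial embeddings extend one point at a time. -/
theorem isFraisseLimit_of_isSaturated [Nonempty Γ] [Countable M] (hinv : Function.Involutive inv)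
    (hS : ∀ T ∈ S, IsTriangle inv T) (hM : IsCompleteStructure inv M)
    (hg : IsGood inv (IsForbidden S) (colour : M → M → Γ))
    (hsat : IsSaturated (IsForbidden S) (colour : M → M → Γ)) :
    IsFraisseLimit (Forb.{u, w} inv S) M where
  ultrahomogeneous := by
    rw [isUltrahomogeneous_iff_IsExtensionPair (Structure.cg_iff_countable.2 inferInstance),
      isExtensionPair_iff_exists_embedding_closure_singleton_sup]
    intro A hA f m
    have hAfin : (A : Set M).Finite := Substructure.fg_iff_finite.1 hA
    have hsup : ∀ x ∈ (Substructure.closure (colourLang Γ) {m} ⊔ A : (colourLang Γ).Substructure M),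
        x ∉ A → x = m := by
      intro x hx hxA
      rw [← Substructure.closure_eq A, ← Substructure.closure_union,
        Substructure.mem_closure_iff_of_isRelational] at hx
      exact hx.resolve_right hxA
    by_cases hm : m ∈ A
    · have hle :
          (Substructure.closure (colourLang Γ) {m} ⊔ A : (colourLang Γ).Substructure M) ≤ A :=
        fun x hx => by_contra fun h => h ((hsup x hx h) ▸ hm)
      exact ⟨f.comp (Substructure.inclusion hle), by ext x; rfl⟩
    let f₀ : M → M := fun x => if h : x ∈ A then f ⟨x, h⟩ else x
    have hf₀ : ∀ x : A, f₀ x = f x := fun x => dif_pos x.2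
    have hX : ∀ x, x ∈ hAfin.toFinset ↔ x ∈ A := fun x => hAfin.mem_toFinset
    obtain ⟨a, hinj, hcol⟩ := hsat.exists_insert hinv hg hg (X := hAfin.toFinset) (f := f₀) (y := m)
      (by
        intro x hx y hy h
        have hx' := (hX x).1 hx
        have hy' := (hX y).1 hy
        rw [hf₀ ⟨x, hx'⟩, hf₀ ⟨y, hy'⟩] at h
        exact congrArg Subtype.val (f.injective h))
      (by
        intro x hx y hy hxy
        have hx' := (hX x).1 hx
        have hy' := (hX y).1 hy
        rw [hf₀ ⟨x, hx'⟩, hf₀ ⟨y, hy'⟩, colour_map, ← colour_map A.subtype]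
        rfl)
      (fun h => hm ((hX m).1 h))
    have hmem : ∀ x : (Substructure.closure (colourLang Γ) {m} ⊔ A : (colourLang Γ).Substructure M),
        (x : M) ∈ insert m hAfin.toFinset := fun x => by
      rw [Finset.mem_insert, hX]
      exact or_iff_not_imp_right.2 (hsup x x.2)
    obtain ⟨e, he⟩ := exists_embedding_of_colour hM (hM.comap
      (Substructure.closure (colourLang Γ) {m} ⊔ A : (colourLang Γ).Substructure M).subtype)
      (f := fun x => Function.update f₀ m a x)
      (fun x y h => Subtype.ext (hinj (hmem x) (hmem y) h)) (fun x y hxy => by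
        rw [hcol x (hmem x) y (hmem y) fun h => hxy (Subtype.ext h)]
        exact colour_map (Substructure.subtype _) x y)
    refine ⟨e, ?_⟩
    ext x
    rw [Embedding.comp_apply, he]
    have hxm : (x : M) ≠ m := fun h => hm (h ▸ x.2)
    exact ((hf₀ x).symm.trans (Function.update_of_ne hxm _ _).symm)
  age := by
    ext N
    constructor
    · rintro ⟨hfg, ⟨e⟩⟩
      have hN := hM.comap e
      refine (mem_forb_iff hS).2 ⟨Structure.fg_iff_finite.1 hfg, hN, ?_⟩
      exact (hg.comap e.injective).of_eq fun {a b} _ => (colour_map e a b).symm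
    · intro hN
      obtain ⟨hfin, hNc, hNg⟩ := (mem_forb_iff hS).1 hN
      refine ⟨Structure.fg_iff_finite.2 hfin, ?_⟩
      obtain ⟨a₀, -⟩ := hsat ∅ (fun _ => Classical.arbitrary Γ) fun x hx =>
        absurd hx (Finset.notMem_empty x)
      have key : ∀ X : Finset N, ∃ f : N → M, Set.InjOn f X ∧
          ∀ x ∈ X, ∀ y ∈ X, x ≠ y → (colour (f x) (f y) : Γ) = colour x y := by
        intro X
        induction X using Finset.induction_on with
        | empty => exact ⟨fun _ => a₀, by simp, by simp⟩
        | insert y X hy ih =>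
          obtain ⟨f, hf, hfr⟩ := ih
          obtain ⟨a, ha⟩ := hsat.exists_insert hinv hg hNg hf hfr hy
          exact ⟨_, ha⟩
      have := Fintype.ofFinite N
      obtain ⟨f, hf, hfr⟩ := key Finset.univ
      obtain ⟨e, -⟩ := exists_embedding_of_colour hM hNc (f := f)
        (fun x y h => hf (Finset.mem_univ x) (Finset.mem_univ y) h)
        fun x y => hfr x (Finset.mem_univ x) y (Finset.mem_univ y)
      exact ⟨e⟩

theorem exists_isFraisseLimit [Finite Γ] (hinv : Function.Involutive inv)
    (hS : ∀ T ∈ S, IsTriangle inv T) (hsf : IsSemiFree (Forb.{u, w} inv S) {x | x ∈ ℓ})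
    (hcond : NoTwoSolutionEdges S {x | x ∈ ℓ}) :
    ∃ (M : Type w) (_ : (colourLang Γ).Structure M) (_ : Countable M),
      IsFraisseLimit (Forb.{u, w} inv S) M := by
  obtain ⟨Q₀, -, -⟩ := Set.exists_of_ssubset hsf.2.1
  have : Nonempty Γ := ⟨Q₀⟩
  obtain ⟨r, hr, hsat⟩ := exists_saturated_colouring hS hsf (isTriangleSystem hinv hS hcond)
  let r' : ULift.{w} ℕ → ULift.{w} ℕ → Γ := fun a b => r a.down b.down
  have hr' : IsGood inv (IsForbidden S) r' := hr.comap ULift.down_injective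
  refine ⟨ULift.{w} ℕ, (ofColouring r').str, inferInstance, ?_⟩
  let str : (colourLang Γ).Structure (ULift.{w} ℕ) := (ofColouring r').str
  have hcol : ∀ {a b : ULift.{w} ℕ}, a ≠ b → (colour a b : Γ) = r' a b := colour_ofColouring
  refine isFraisseLimit_of_isSaturated hinv hS (isCompleteStructure_ofColouring hr'.symm)
    (hr'.of_eq hcol) fun X t ht => ?_
  obtain ⟨n, hn, hnt⟩ := hsat (X.image ULift.down) (fun x => t ⟨x⟩) (by
    intro x hx y hy hxy
    obtain ⟨x, hxX, rfl⟩ := Finset.mem_image.1 hx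
    obtain ⟨y, hyX, rfl⟩ := Finset.mem_image.1 hy
    have hxy' : x ≠ y := fun h => hxy (congrArg _ h)
    have := ht x hxX y hyX hxy'
    rwa [hcol hxy'] at this)
  have hnX : (⟨n⟩ : ULift.{w} ℕ) ∉ X := fun h => hn (Finset.mem_image_of_mem ULift.down h)
  refine ⟨⟨n⟩, hnX, fun x hx => ?_⟩
  rw [hcol (ne_of_mem_of_not_mem hx hnX).symm]
  exact hnt _ (Finset.mem_image_of_mem ULift.down hx)

/-- The colouring of the Fraïssé limit of `Forb inv S` is generic. -/
theorem isGeneric_of_isFraisseLimit [Nonempty Γ] [Countable M]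
    (hS : ∀ T ∈ S, IsTriangle inv T)
    (hsf : IsSemiFree (Forb.{u, w} inv S) {x | x ∈ ℓ})
    (hF : IsTriangleSystem inv (IsForbidden S) ℓ) (hM : IsFraisseLimit (Forb.{u, w} inv S) M) :
    IsGeneric inv (IsForbidden S) ℓ (colourLang Γ) (colour : M → M → Γ) := by
  have hage : ∀ X : Finset M,
      Bundled.mk (Substructure.closure (colourLang Γ) (X : Set M)) ∈ Forb.{u, w} inv S := by
    intro X
    rw [← hM.age]
    exact age.fg_substructure (Substructure.fg_closure X.finite_toSet)
  have hmem : ∀ {X : Finset M} {x : M}, x ∈ X →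
      x ∈ Substructure.closure (colourLang Γ) (X : Set M) := fun h => Substructure.subset_closure h
  have hMc : IsCompleteStructure inv M := by
    refine ⟨fun x a => ?_, fun a b hab => ?_, fun x a b => ?_⟩
    · have := ((mem_forb_iff hS).1 (hage {a})).2.1.irrefl x ⟨a, hmem (by simp)⟩
      rwa [← hasColour_map (Substructure.subtype _)] at this
    · have := ((mem_forb_iff hS).1 (hage {a, b})).2.1.existsUnique ⟨a, hmem (by simp)⟩
        ⟨b, hmem (by simp)⟩ (fun h => hab (congrArg Subtype.val h))
      simp only [← hasColour_map (Substructure.subtype _)] at this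
      exact this
    · have := ((mem_forb_iff hS).1 (hage {a, b})).2.1.converse x ⟨a, hmem (by simp)⟩
        ⟨b, hmem (by simp)⟩
      simp only [← hasColour_map (Substructure.subtype _)] at this
      exact this
  have hMg : IsGood inv (IsForbidden S) (colour : M → M → Γ) := by
    refine ⟨fun {a b} hab => ?_, fun {a b c} hab hac hbc => ?_⟩
    · exact (hMc.hasColour_iff.1 (hMc.converse _ _ _ (hMc.hasColour_iff.2 ⟨hab, rfl⟩))).2
    · have := ((mem_forb_iff hS).1 (hage {a, b, c})).2.2.avoid (a := ⟨a, hmem (by simp)⟩)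
        (b := ⟨b, hmem (by simp)⟩) (c := ⟨c, hmem (by simp)⟩)
        (fun h => hab (congrArg Subtype.val h)) (fun h => hac (congrArg Subtype.val h))
        (fun h => hbc (congrArg Subtype.val h))
      simp only [← colour_map (Substructure.subtype _)] at this
      exact this
  have hom : ∀ (X : Finset M) (f : M → M), Set.InjOn f X →
      (∀ x ∈ X, ∀ y ∈ X, x ≠ y → (colour (f x) (f y) : Γ) = colour x y) →
      ∃ g : M ≃[colourLang Γ] M, ∀ x ∈ X, g x = f x := by
    intro X f hf hfr
    have hcl : ∀ x : Substructure.closure (colourLang Γ) (X : Set M), (x : M) ∈ X := fun x =>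
      (Substructure.mem_closure_iff_of_isRelational _ _ _).1 x.2
    obtain ⟨e, he⟩ := exists_embedding_of_colour hMc (hMc.comap
      (Substructure.closure (colourLang Γ) (X : Set M)).subtype) (f := fun x => f x)
      (fun x y h => Subtype.ext (hf (hcl x) (hcl y) h)) (fun x y hxy => by
        rw [hfr x (hcl x) y (hcl y) fun h => hxy (Subtype.ext h)]
        exact colour_map (Substructure.subtype _) x y)
    obtain ⟨g, hg⟩ := hM.ultrahomogeneous _ (Substructure.fg_closure X.finite_toSet) e
    refine ⟨g, fun x hx => ?_⟩
    have := he ⟨x, hmem hx⟩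
    rw [hg] at this
    exact this
  refine { hF with
    symm := hMg.symm
    aut := fun g a b => colour_map g.toEmbedding a b
    avoid := hMg.avoid
    solve := fun B a c ha hc => ?_
    hom := hom
    ext := fun X t ht => ?_
    exists_notMem := ?_ }
  · obtain ⟨R, hR, h⟩ := exists_solution hS hsf hF (hMg.comap (f := fun b : B => (b : M))
      Subtype.val_injective) (t := fun b => colour a (b : M)) (s := fun b => colour c (b : M))
      (fun x y hxy => hMg.avoid (fun h => ha (h ▸ x.2)) (fun h => ha (h ▸ y.2))
        fun h => hxy (Subtype.ext h))
      (fun x y hxy => hMg.avoid (fun h => hc (h ▸ x.2)) (fun h => hc (h ▸ y.2))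
        fun h => hxy (Subtype.ext h))
    refine ⟨R, hR, fun b hb => ?_⟩
    rw [hMg.symm (ne_of_mem_of_not_mem hb hc).symm]
    exact h ⟨b, hb⟩
  · have hgood : IsGood inv (IsForbidden S)
        (optColouring inv (fun x y : X => (colour (x : M) (y : M) : Γ)) fun x => t x) :=
      isGood_optColouring hF (hMg.comap Subtype.val_injective) fun x y hxy =>
        ht x x.2 y y.2 fun h => hxy (Subtype.ext h)
    have hN := ofColouring_mem_forb hS hgood
    rw [← hM.age] at hN
    obtain ⟨-, ⟨e⟩⟩ := hN
    let e' : Option X → M := e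
    have he' : Function.Injective e' := e.injective
    have hcol : ∀ {x y : Option X}, x ≠ y → (colour (e' x) (e' y) : Γ) =
        optColouring inv (fun x y : X => (colour (x : M) (y : M) : Γ)) (fun x => t x) x y :=
      fun {x y} hxy => (colour_map e x y).trans (colour_ofColouring hxy)
    obtain ⟨g, hg⟩ := hom X (fun x => if h : x ∈ X then e' (some ⟨x, h⟩) else x)
      (by
        intro x hx y hy h
        rw [Finset.mem_coe] at hx hy
        simp only [hx, hy, dif_pos] at h
        exact congrArg Subtype.val (Option.some_injective _ (he' h)))
      (by
        intro x hx y hy hxy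
        simp only [hx, hy, dif_pos]
        exact hcol (by simpa using hxy))
    have hgX : ∀ x (hx : x ∈ X), g x = e' (some ⟨x, hx⟩) := fun x hx => (hg x hx).trans (dif_pos hx)
    refine ⟨g⁻¹ (e' none), fun h => ?_, fun x hx => ?_⟩
    · have := hgX _ h
      rw [aut_apply_inv_self] at this
      exact Option.some_ne_none _ (he' this).symm
    · rw [← colour_map g.toEmbedding]
      change (colour (g (g⁻¹ (e' none))) (g x) : Γ) = t x
      rw [aut_apply_inv_self, hgX x hx]
      exact hcol (by simp)
  · obtain ⟨Q, -, hQ⟩ := Set.exists_of_ssubset hsf.2.1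
    exact ⟨Q, hQ⟩

end Limits

theorem IsGeneric.nontrivial_aut {Γ : Type u} {inv : Γ → Γ} {F : Γ → Γ → Γ → Prop} {ℓ : List Γ}
    {L : FirstOrder.Language.{0, u}} {M : Type w} [L.Structure M] {r : M → M → Γ}
    (hG : IsGeneric inv F ℓ L r) : Nontrivial (M ≃[L] M) := by
  obtain ⟨Q, -⟩ := hG.exists_notMem
  obtain ⟨a, -⟩ := hG.ext ∅ (fun _ => Q) fun x hx => absurd hx (Finset.notMem_empty x)
  obtain ⟨b, hb, -⟩ := hG.ext {a} (fun _ => Q) fun x hx y hy hxy =>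
    absurd ((Finset.mem_singleton.1 hx).trans (Finset.mem_singleton.1 hy).symm) hxy
  obtain ⟨g, hg⟩ := hG.hom {a} (fun _ => b) (by simp) fun x hx y hy hxy =>
    absurd ((Finset.mem_singleton.1 hx).trans (Finset.mem_singleton.1 hy).symm) hxy
  refine ⟨⟨g, 1, fun h => hb ?_⟩⟩
  have := hg a (Finset.mem_singleton_self a)
  rw [h, aut_one_apply] at this
  exact Finset.mem_singleton.2 this.symm

end ForbTriangles

theorem mainTheorem7 {Γ : Type u} [Finite Γ] (inv : Γ → Γ) (hinv : Function.Involutive inv)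
    (S : Set (CategoryTheory.Bundled.{0} (ForbTriangles.colourLang Γ).Structure))
    (hS : ∀ T ∈ S, ForbTriangles.IsTriangle inv T)
    (ℓ : List Γ) (hℓ : ℓ.Nodup)
    (hsf : ForbTriangles.IsSemiFree (ForbTriangles.Forb.{u, w} inv S) {x | x ∈ ℓ})
    (hcond : ForbTriangles.NoTwoSolutionEdges S {x | x ∈ ℓ}) :
    ForbTriangles.IsPrioritisedSemiFree.{u, w} inv S ℓ ∧
    (∃ (M : Type w) (_ : (ForbTriangles.colourLang Γ).Structure M) (_ : Countable M),
      FirstOrder.Language.IsFraisseLimit (ForbTriangles.Forb.{u, w} inv S) M) ∧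
    ∀ (M : Type w) [(ForbTriangles.colourLang Γ).Structure M] [Countable M],
      FirstOrder.Language.IsFraisseLimit (ForbTriangles.Forb.{u, w} inv S) M →
      (∃ ind : Finset M → Finset M → Finset M → Prop,
        ForbTriangles.IsStationaryWeakIndependence (ForbTriangles.colourLang Γ) M ind ∧
        ∀ g : M ≃[ForbTriangles.colourLang Γ] M, g ≠ 1 →
          ∃ h k : M ≃[ForbTriangles.colourLang Γ] M,
            ForbTriangles.MovesAlmostRMax ind (ForbTriangles.commutator (ForbTriangles.commutator h g) k) ∧
            ForbTriangles.MovesAlmostLMax ind (ForbTriangles.commutator (ForbTriangles.commutator h g) k)) ∧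
      IsSimpleGroup (M ≃[ForbTriangles.colourLang Γ] M) := by
  open ForbTriangles in
  refine ⟨isPrioritisedSemiFree hinv hS hℓ hsf hcond, exists_isFraisseLimit hinv hS hsf hcond,
    fun M _ _ hM => ?_⟩
  obtain ⟨Q₀, -, -⟩ := Set.exists_of_ssubset hsf.2.1
  have : Nonempty Γ := ⟨Q₀⟩
  have hG := ForbTriangles.isGeneric_of_isFraisseLimit hS hsf
    (ForbTriangles.isTriangleSystem hinv hS hcond) hM
  have hi := hG.isStationaryWeakIndependence
  have hc := fun g (hg : g ≠ 1) => hG.exists_commutators hg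
  have := hG.nontrivial_aut
  exact ⟨⟨_, hi, hc⟩, hi.isSimpleGroup hc⟩
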